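/- **Setting.** Let $R$ be a commutative ring. A DG $R$-algebra is a non-negatively graded $R$-algebra $A=\bigoplus_{n\ge 0}A_n$ which is graded commutative ($ab=(-1)^{|a||b|}ba$, and $a^2=0$ for $|a|$ odd), with an $R$-linear differential $d$ of degree $-1$, $d^2=0$, satisfying the Leibniz rule. DG modules are right DG modules, graded by $\mathbb Z$, with $\partial(ma)=\partial(m)a+(-1)^{|m|}m\,d(a)$; $(\Sigma^iM)_j=M_{j-i}$ with differential $(-1)^i\partial$. For a DG algebra $B$, $\mathcal C(B)$ is the category of DG $B$-modules and DG module homomorphisms, $\mathcal K(B)$ its homotopy category, and $\mathcal D(B)$ its localization at the quasi-isomorphisms. A DG $B$-module $P$ is *semifree* if its underlying graded module has a well-ordered homogeneous basis $F$ with $\partial(f)\in\sum_{e<f}eB$ for all $f\in F$; it is *perfect* if it is quasi-isomorphic to a semifree DG module with a finite semifree basis. Let $\varphi\colon A\to B$ be an injective homomorphism of DG $R$-algebras such that $B$ is semifree as a DG $A$-module and $B/A$ is concentrated in positive degrees. Let $J=\ker(B\otimes_AB\to B,\ b\otimes b'\mapsto bb')$, a DG $B$-bimodule, and let $\delta\colon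 B\to J$, $\delta(b)=b\otimes 1-1\otimes b$. The bimodule $\Sigma J$ has differential $\partial(\Sigma x)=-\Sigma\,\partial x$, left action $b\cdot\Sigma x=(-1)^{|b|}\Sigma(bx)$ and right action $(\Sigma x)b=\Sigma(xb)$. Let $T=\bigoplus_{n\ge0}T^n$, $T^n=(\Sigma J)^{\otimes_Bn}$, be the tensor algebra of $\Sigma J$ over $B$. A *tensor graded DG $T$-module* is a direct sum $M=\bigoplus_{i\in\mathbb Z}M^i$ of DG $B$-modules with DG $B$-module homomorphisms $M^i\otimes_B\Sigma J\to M^{i+1}$; its homomorphisms are the families of DG $B$-module homomorphisms $M^i\to N^i$ compatible with these maps, and homotopies are the families of graded $B$-linear maps $M^i\to\Sigma^{-1}N^i$ compatible with these maps. Write $\mathcal K^{gr}(T)$ for the resulting homotopy category, $M[n]^i=M^{i+n}$, and $$\Gamma_M=\bigoplus_{n\in\mathbb Z}\Gamma_M^n,\qquad \Gamma_M^n=\operatorname{Hom}_{\mathcal K^{gr}(T)}(M,M[n]),$$ a graded ring under composition. For a DG $B$-module $N$ the module $N\otimes_BT=\bigoplus_{i\ge0}N\otimes_BT^i$ is a tensor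 graded DG $T$-module, and $[f]\mapsto[f\otimes_B\mathrm{id}_T]$ is a ring homomorphism $\operatorname{End}_{\mathcal K(B)}(N)\to\Gamma_{N\otimes_BT}$. If $N$ is semifree with semifree basis $\{e_\lambda\}$ and $\partial(e_\lambda)=\sum_{\mu<\lambda}e_\mu b_{\mu\lambda}$, let $\omega_N\in\Gamma^1_{N\otimes_BT}$ be the class of the homomorphism $N\otimes_BT\to(N\otimes_BT)[1]$ with $$e_\lambda\otimes t\ \longmapsto\ \sum_{\mu<\lambda}(-1)^{|e_\mu|}\,e_\mu\otimes\Sigma\,\delta(b_{\mu\lambda})\otimes t .$$ $N$ is *naïvely liftable to $A$* if the homomorphism $\pi_N\colon N|_A\otimes_AB\to N$, $n\otimes b\mapsto nb$, has a right inverse in $\mathcal C(B)$. **Theorem.** Let $N$ be a DG $B$-module satisfying (AR1): $N$ is semifree over $B$ and $N_n=0$ for $n<0$; $B$ and $N$ are perfect as DG $A$-modules; and $\operatorname{Hom}_{\mathcal K(B)}(N,\Sigma^nB)=0$ for all integers $n\ge1$. Then, for any semifree basis of $N$ used to define $\omega_N$, the following conditions are equivalent: 1. $N$ is naïvely liftable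 to $A$; 2. $\omega_N=0$ in $\Gamma_{N\otimes_BT}$; 3. $\omega_N$ is nilpotent, i.e. $\omega_N^n=0$ for some $n\ge1$; 4. the natural ring homomorphism $\operatorname{End}_{\mathcal K(B)}(N)\to\Gamma_{N\otimes_BT}$ is an isomorphism; 5. $\Gamma_{N\otimes_BT}$ is finitely generated as a right $\operatorname{End}_{\mathcal K(B)}(N)$-module; 6. $\Gamma^i_{N\otimes_BT}=0$ for all integers $i\ge1$; equivalently, $\operatorname{Hom}_{\mathcal K(B)}(N,N\otimes_BT^i)=0$ for all integers $i\ge1$; 7. $\Gamma^i_{N\otimes_BT}=0$ for some integer $i\ge1$; equivalently, $\operatorname{Hom}_{\mathcal K(B)}(N,N\otimes_BT^i)=0$ for some integer $i\ge1$; 8. $\operatorname{Hom}_{\mathcal K(B)}(N,N\otimes_B\Sigma J)=0$; 9. $N$ is a direct summand of a finite direct sum $B^{\oplus n}$ in $\mathcal D(B)$. -/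

import Mathlib

open scoped DirectSum TensorProduct
open MulOpposite (op)
open CategoryTheory

universe u v

noncomputable section

/-! ## Gradings indexed by the integers -/

namespace GradedGroup

section

variable {M : Type*} [AddCommGroup M] {σ : Type*} [SetLike σ M] [AddSubgroupClass σ M]
  (deg : ℤ → σ) [DirectSum.Decomposition deg]

/-- The projection of a graded group onto its homogeneous component of degree `n`. -/
def proj (n : ℤ) : M →+ M :=
  (AddSubmonoidClass.subtype (deg n)).comp
    ((DFinsupp.evalAddMonoidHom n).comp (DirectSum.decomposeAddEquiv deg).toAddMonoidHom)

lemma proj_mem (n : ℤ) (x : M) : proj deg n x ∈ deg n :=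
  (DirectSum.decompose deg x n).2

lemma proj_same {n : ℤ} {x : M} (hx : x ∈ deg n) : proj deg n x = x :=
  DirectSum.decompose_of_mem_same deg hx

lemma proj_ne {n m : ℤ} {x : M} (hx : x ∈ deg n) (h : n ≠ m) : proj deg m x = 0 :=
  DirectSum.decompose_of_mem_ne deg hx h

/-- The sign involution `x ↦ (-1)^|x| x`. -/
def sgn : M →+ M :=
  (DirectSum.toAddMonoid fun n : ℤ =>
    DistribSMul.toAddMonoidHom M n.negOnePow |>.comp (AddSubmonoidClass.subtype (deg n))).comp
    (DirectSum.decomposeAddEquiv deg).toAddMonoidHom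

lemma sgn_of_mem {n : ℤ} {x : M} (hx : x ∈ deg n) : sgn deg x = n.negOnePow • x := by
  simp [sgn, DirectSum.decomposeAddEquiv, DirectSum.decompose_of_mem deg hx]

lemma sgn_mem {n : ℤ} {x : M} (hx : x ∈ deg n) : sgn deg x ∈ deg n := by
  rw [sgn_of_mem deg hx]
  rcases Int.even_or_odd n with h | h
  · rwa [Int.negOnePow_even _ h, one_smul]
  · rw [Int.negOnePow_odd _ h, Units.neg_smul, one_smul]; exact neg_mem hx

/-- Induction over homogeneous elements. -/
lemma induct {p : M → Prop} (hom : ∀ n x, x ∈ deg n → p x)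
    (add : ∀ x y, p x → p y → p (x + y)) (x : M) : p x :=
  DirectSum.Decomposition.inductionOn deg (hom 0 0 (zero_mem _)) (fun m => hom _ _ m.2)
    (fun a b => add a b) x

lemma sgn_sgn (x : M) : sgn deg (sgn deg x) = x := by
  induction x using induct deg with
  | hom n x hx =>
    rw [sgn_of_mem deg hx, sgn_of_mem deg (by rw [← sgn_of_mem deg hx]; exact sgn_mem deg hx),
      smul_smul, ← Int.negOnePow_add, Int.negOnePow_even _ ⟨n, rfl⟩, one_smul]
  | add x y hx hy => simp [hx, hy]

end

/-- A family of projections onto subgroups spanning the group gives a grading. -/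
@[reducible]
def ofProj {M : Type*} [AddCommGroup M] (deg : ℤ → AddSubgroup M) (p : ℤ → M →+ M)
    (same : ∀ n x, x ∈ deg n → p n x = x) (ne : ∀ n m x, x ∈ deg n → n ≠ m → p m x = 0)
    (top : ∀ x, x ∈ ⨆ n, deg n) : DirectSum.Decomposition deg := by
  have inj : Function.Injective (DirectSum.coeAddMonoidHom deg) := by
    have key : ∀ (y : ⨁ n, deg n) (m : ℤ), p m (DirectSum.coeAddMonoidHom deg y) = y m := by
      intro y m
      induction y using DirectSum.induction_on with
      | zero => simp
      | of i x =>
        rw [DirectSum.coeAddMonoidHom_of]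
        by_cases h : i = m
        · subst h; rw [same _ _ x.2, DirectSum.of_eq_same]
        · rw [ne _ _ _ x.2 h, DirectSum.of_eq_of_ne _ _ _ (Ne.symm h)]; rfl
      | add x y hx hy => simp [hx, hy]
    intro y z h
    ext m
    rw [← key, ← key, h]
  have surj : Function.Surjective (DirectSum.coeAddMonoidHom deg) := by
    intro x
    induction top x using AddSubgroup.iSup_induction' with
    | hp i x hx => exact ⟨DirectSum.of (fun i => deg i) i ⟨x, hx⟩, DirectSum.coeAddMonoidHom_of _ _ _⟩
    | h1 => exact ⟨0, map_zero _⟩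
    | hadd x y _ _ hx hy =>
      obtain ⟨a, rfl⟩ := hx
      obtain ⟨b, rfl⟩ := hy
      exact ⟨a + b, map_add _ _ _⟩
  exact DirectSum.IsInternal.chooseDecomposition deg ⟨inj, surj⟩

end GradedGroup

open GradedGroup

/-! ## DG algebras and DG modules -/

/-- A (graded-commutative, non-negatively graded) DG `R`-algebra. -/
structure DGAlg (R : Type v) [CommRing R] where
  carrier : Type u
  [ring : Ring carrier]
  [algebra : Algebra R carrier]
  deg : ℤ → Submodule R carrier
  [graded : GradedAlgebra deg]
  deg_neg : ∀ n < 0, deg n = ⊥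
  d : carrier →ₗ[R] carrier
  d_mem : ∀ n x, x ∈ deg n → d x ∈ deg (n - 1)
  d_d : ∀ x, d (d x) = 0
  leibniz : ∀ n a b, a ∈ deg n → d (a * b) = d a * b + n.negOnePow • (a * d b)
  comm : ∀ m n a b, a ∈ deg m → b ∈ deg n → a * b = (m * n).negOnePow • (b * a)
  mul_self : ∀ n a, Odd n → a ∈ deg n → a * a = 0

namespace DGAlg

variable {R : Type v} [CommRing R]

instance : CoeSort (DGAlg.{u} R) (Type u) := ⟨carrier⟩

attribute [instance] DGAlg.ring DGAlg.algebra DGAlg.graded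

/-- The automorphism `b ↦ (-1)^|b| b` of the underlying graded ring. -/
def twist (B : DGAlg.{u} R) : B →+* B where
  toFun := sgn B.deg
  map_one' := by
    rw [sgn_of_mem B.deg SetLike.GradedOne.one_mem, Int.negOnePow_zero, one_smul]
  map_zero' := map_zero _
  map_add' := map_add _
  map_mul' x y := by
    induction x using induct B.deg with
    | hom m x hx =>
      induction y using induct B.deg with
      | hom n y hy =>
        rw [sgn_of_mem B.deg (SetLike.GradedMul.mul_mem hx hy), sgn_of_mem B.deg hx,
          sgn_of_mem B.deg hy, smul_mul_smul_comm, Int.negOnePow_add]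
      | add y z hy hz => simp only [mul_add, map_add, hy, hz]
    | add x z hx hz => simp only [add_mul, map_add, hx, hz]

end DGAlg

/-- A homomorphism of DG `R`-algebras. -/
structure DGAlg.Hom {R : Type v} [CommRing R] (A B : DGAlg.{u} R) where
  toAlgHom : A →ₐ[R] B
  map_mem : ∀ n a, a ∈ A.deg n → toAlgHom a ∈ B.deg n
  map_d : ∀ a, toAlgHom (A.d a) = B.d (toAlgHom a)

variable {R : Type v} [CommRing R]

/-- A right DG module over `B`; the product `x b` is written `op b • x`. -/
structure DGMod (B : DGAlg.{u} R) where
  carrier : Type u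
  [addCommGroup : AddCommGroup carrier]
  [module : Module Bᵐᵒᵖ carrier]
  deg : ℤ → AddSubgroup carrier
  [graded : DirectSum.Decomposition deg]
  smul_mem : ∀ i j x (b : B), x ∈ deg i → b ∈ B.deg j → op b • x ∈ deg (i + j)
  d : carrier →+ carrier
  d_mem : ∀ n x, x ∈ deg n → d x ∈ deg (n - 1)
  d_d : ∀ x, d (d x) = 0
  leibniz : ∀ n x (b : B), x ∈ deg n → d (op b • x) = op b • d x + n.negOnePow • (op (B.d b) • x)

namespace DGMod

instance (B : DGAlg.{u} R) : CoeSort (DGMod B) (Type u) := ⟨carrier⟩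

attribute [instance] DGMod.addCommGroup DGMod.module DGMod.graded

variable {B : DGAlg.{u} R}

lemma leibniz' (M : DGMod B) (x : M) (b : B) :
    M.d (op b • x) = op b • M.d x + op (B.d b) • sgn M.deg x := by
  induction x using induct M.deg with
  | hom n x hx => rw [M.leibniz n x b hx, sgn_of_mem M.deg hx, smul_comm]
  | add x y hx hy => simp only [smul_add, map_add, hx, hy]; abel

lemma sgn_d (M : DGMod B) (x : M) : sgn M.deg (M.d x) = - M.d (sgn M.deg x) := by
  induction x using induct M.deg with
  | hom n x hx =>
    rw [sgn_of_mem M.deg hx, sgn_of_mem M.deg (M.d_mem n x hx), Int.negOnePow_sub]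
    rcases Int.even_or_odd n with h | h
    · simp [Int.negOnePow_even _ h]
    · simp [Int.negOnePow_odd _ h]
  | add x y hx hy => simp only [map_add, hx, hy]; abel

lemma sgn_smul (M : DGMod B) (x : M) (b : B) :
    sgn M.deg (op b • x) = op (B.twist b) • sgn M.deg x := by
  change _ = op (sgn B.deg b) • sgn M.deg x
  induction x using induct M.deg with
  | hom n x hx =>
    induction b using induct B.deg with
    | hom m b hb =>
      rw [sgn_of_mem M.deg hx, sgn_of_mem M.deg (M.smul_mem _ _ _ _ hx hb), sgn_of_mem B.deg hb,
        Int.negOnePow_add]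
      rcases Int.even_or_odd n with h | h <;> rcases Int.even_or_odd m with h' | h' <;>
        simp [Int.negOnePow_even _, Int.negOnePow_odd _, h, h']
    | add b c hb hc => simp only [MulOpposite.op_add, add_smul, map_add, hb, hc]
  | add x y hx hy => simp only [smul_add, map_add, hx, hy]

/-- `B` as a right DG module over itself. -/
def self (B : DGAlg.{u} R) : DGMod B where
  carrier := B
  deg n := (B.deg n).toAddSubgroup
  graded := ofProj _ (proj B.deg) (fun _ _ h => proj_same B.deg h)
    (fun _ _ _ h h' => proj_ne B.deg h h')
    (fun x => by
      induction x using induct B.deg with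
      | hom n x hx => exact AddSubgroup.mem_iSup_of_mem n hx
      | add x y hx hy => exact add_mem hx hy)
  smul_mem i j x b hx hb := SetLike.GradedMul.mul_mem (A := B.deg) hx hb
  d := B.d.toAddMonoidHom
  d_mem := B.d_mem
  d_d := B.d_d
  leibniz := B.leibniz

/-- Restriction of scalars along a homomorphism of DG algebras. -/
def restrict {A B : DGAlg.{u} R} (φ : DGAlg.Hom A B) (M : DGMod B) : DGMod A where
  carrier := M
  module := Module.compHom M (RingHom.op φ.toAlgHom.toRingHom)
  deg := M.deg
  smul_mem i j x a hx ha := M.smul_mem i j x _ hx (φ.map_mem j a ha)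
  d := M.d
  d_mem := M.d_mem
  d_d := M.d_d
  leibniz n x a hx := by
    have := M.leibniz n x (φ.toAlgHom a) hx
    rw [← φ.map_d] at this
    exact this

/-- The shift `Σ^i M`: `(Σ^i M)_j = M_{j-i}` with differential `(-1)^i d`. -/
def shift (M : DGMod B) (i : ℤ) : DGMod B where
  carrier := M
  deg n := M.deg (n - i)
  graded := ofProj _ (fun n => proj M.deg (n - i)) (fun _ _ h => proj_same M.deg h)
    (fun _ _ _ h h' => proj_ne M.deg h (by omega))
    (fun x => by
      induction x using induct M.deg with
      | hom n x hx => exact AddSubgroup.mem_iSup_of_mem (n + i) (by simpa using hx)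
      | add x y hx hy => exact add_mem hx hy)
  smul_mem m j x b hx hb := by
    have := M.smul_mem _ j x b hx hb
    rwa [show m + j - i = m - i + j by omega]
  d := i.negOnePow • M.d
  d_mem n x hx := by
    have h := M.d_mem _ x hx
    rw [show n - 1 - i = n - i - 1 by omega]
    rcases Int.even_or_odd i with hi | hi
    · simpa [Int.negOnePow_even _ hi] using h
    · simpa [Int.negOnePow_odd _ hi] using h
  d_d x := by simp [M.d_d]
  leibniz n x b hx := by
    have h := M.leibniz _ x b hx
    rw [Int.negOnePow_sub] at h
    rcases Int.even_or_odd i with hi | hi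
    · simpa [Int.negOnePow_even _ hi] using h
    · simp only [Int.negOnePow_odd _ hi, mul_neg, mul_one, Units.neg_smul] at h
      simp [Int.negOnePow_odd _ hi, h, add_comm]

/-- The direct sum of a family of DG modules. -/
def directSum {ι : Type} [DecidableEq ι] (X : ι → DGMod B) : DGMod B where
  carrier := ⨁ i, X i
  deg n :=
    { carrier := {x | ∀ i, x i ∈ (X i).deg n}
      zero_mem' := fun _ => zero_mem _
      add_mem' := fun hx hy i => add_mem (hx i) (hy i)
      neg_mem' := fun hx i => neg_mem (hx i) }
  graded := ofProj _ (fun n => DirectSum.map fun i => proj (X i).deg n)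
    (fun n x hx => by
      ext i
      exact proj_same _ (hx i))
    (fun n m x hx h => by
      ext i
      exact proj_ne _ (hx i) h)
    (fun x => by
      induction x using DirectSum.induction_on with
      | zero => exact zero_mem _
      | of i x =>
        induction x using induct (X i).deg with
        | hom n x hx =>
          refine AddSubgroup.mem_iSup_of_mem n fun j => ?_
          by_cases h : i = j
          · subst h; rwa [DirectSum.of_eq_same]
          · rw [DirectSum.of_eq_of_ne _ _ _ (Ne.symm h)]; exact zero_mem _
        | add x y hx hy => rw [map_add]; exact add_mem hx hy
      | add x y hx hy => exact add_mem hx hy)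
  smul_mem m n x b hx hb i := (X i).smul_mem m n _ b (hx i) hb
  d := DirectSum.map fun i => (X i).d
  d_mem n x hx i := (X i).d_mem n _ (hx i)
  d_d x := by
    ext i
    exact (X i).d_d _
  leibniz n x b hx := by
    ext i
    exact (X i).leibniz n _ b (hx i)

end DGMod

/-! ## Tensor products over a non-commutative ring -/

section BTensor

variable (S : Type u) [Ring S] (M L : Type u) [AddCommGroup M] [Module Sᵐᵒᵖ M]
  [AddCommGroup L] [Module S L]

/-- The relations `m s ⊗ l = m ⊗ s l`. -/
def BTensor.rel : AddSubgroup (M ⊗[ℤ] L) :=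
  AddSubgroup.closure {t | ∃ (m : M) (s : S) (l : L), t = (op s • m) ⊗ₜ l - m ⊗ₜ (s • l)}

/-- The tensor product `M ⊗_S L` of a right `S`-module and a left `S`-module. -/
def BTensor : Type u := (M ⊗[ℤ] L) ⧸ BTensor.rel S M L

instance : AddCommGroup (BTensor S M L) :=
  inferInstanceAs (AddCommGroup ((M ⊗[ℤ] L) ⧸ BTensor.rel S M L))

namespace BTensor

variable {S M L}

/-- The biadditive map `(m, l) ↦ m ⊗ l`. -/
def mkHom : M →+ L →+ BTensor S M L :=
  AddMonoidHom.mk' (fun m => AddMonoidHom.mk'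
      (fun l => (QuotientAddGroup.mk (m ⊗ₜ[ℤ] l) : (M ⊗[ℤ] L) ⧸ BTensor.rel S M L))
      (fun a b => by rw [TensorProduct.tmul_add]; rfl))
    (fun a b => by
      ext l
      simp only [AddMonoidHom.add_apply, TensorProduct.add_tmul]; rfl)

variable (S) in
/-- The pure tensor `m ⊗ l`. -/
def tmul (m : M) (l : L) : BTensor S M L := mkHom m l

lemma tmul_add (m : M) (l l' : L) : tmul S m (l + l') = tmul S m l + tmul S m l' :=
  map_add (mkHom m) l l'

lemma add_tmul (m m' : M) (l : L) : tmul S (m + m') l = tmul S m l + tmul S m' l :=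
  DFunLike.congr_fun (map_add (mkHom (S := S)) m m') l

lemma zero_tmul (l : L) : tmul S (0 : M) l = 0 :=
  DFunLike.congr_fun (map_zero (mkHom (S := S) (M := M))) l

lemma tmul_zero (m : M) : tmul S m (0 : L) = 0 := map_zero (mkHom m)

lemma neg_tmul (m : M) (l : L) : tmul S (-m) l = - tmul S m l :=
  DFunLike.congr_fun (map_neg (mkHom (S := S)) m) l

lemma tmul_neg (m : M) (l : L) : tmul S m (-l) = - tmul S m l := map_neg (mkHom m) l

lemma tmul_sub (m : M) (l l' : L) : tmul S m (l - l') = tmul S m l - tmul S m l' :=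
  map_sub (mkHom m) l l'

lemma units_smul_tmul (e : ℤˣ) (m : M) (l : L) : tmul S (e • m) l = e • tmul S m l := by
  rcases Int.units_eq_one_or e with h | h <;> simp [h, neg_tmul]

lemma tmul_units_smul (e : ℤˣ) (m : M) (l : L) : tmul S m (e • l) = e • tmul S m l := by
  rcases Int.units_eq_one_or e with h | h <;> simp [h, tmul_neg]

lemma smul_tmul (m : M) (s : S) (l : L) : tmul S (op s • m) l = tmul S m (s • l) :=
  (QuotientAddGroup.eq_iff_sub_mem).2 (AddSubgroup.subset_closure ⟨m, s, l, rfl⟩)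

lemma induct {p : BTensor S M L → Prop} (tmul : ∀ m l, p (tmul S m l))
    (add : ∀ x y, p x → p y → p (x + y)) (x : BTensor S M L) : p x := by
  obtain ⟨y, rfl⟩ := QuotientAddGroup.mk_surjective x
  induction y using TensorProduct.induction_on with
  | zero => have := tmul 0 0; rwa [zero_tmul] at this
  | tmul m l => exact tmul m l
  | add x y hx hy => exact add _ _ hx hy

/-- The universal property: a balanced biadditive map factors through `M ⊗_S L`. -/
def lift {P : Type*} [AddCommGroup P] (f : M →+ L →+ P)
    (h : ∀ m (s : S) l, f (op s • m) l = f m (s • l)) : BTensor S M L →+ P :=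
  QuotientAddGroup.lift (BTensor.rel S M L)
    (TensorProduct.liftAddHom f fun r m l => by simp) (by
      rw [BTensor.rel, AddSubgroup.closure_le]
      rintro _ ⟨m, s, l, rfl⟩
      simp [h])

@[simp] lemma lift_tmul {P : Type*} [AddCommGroup P] (f : M →+ L →+ P)
    (h : ∀ m (s : S) l, f (op s • m) l = f m (s • l)) (m : M) (l : L) :
    lift f h (tmul S m l) = f m l := rfl

/-- The map `f ⊗ g` for an additive right `S`-linear `f` and an additive left `S`-linear `g`. -/
def map {M' L' : Type u} [AddCommGroup M'] [Module Sᵐᵒᵖ M'] [AddCommGroup L'] [Module S L']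
    (f : M →+ M') (g : L →+ L') (hf : ∀ (s : S) m, f (op s • m) = op s • f m)
    (hg : ∀ (s : S) l, g (s • l) = s • g l) : BTensor S M L →+ BTensor S M' L' :=
  lift ((AddMonoidHom.compHom' g).comp (mkHom.comp f)) (fun m s l => by
    change tmul S (f (op s • m)) (g l) = tmul S (f m) (g (s • l))
    rw [hf, hg, smul_tmul])

@[simp] lemma map_tmul {M' L' : Type u} [AddCommGroup M'] [Module Sᵐᵒᵖ M'] [AddCommGroup L']
    [Module S L'] (f : M →+ M') (g : L →+ L') (hf : ∀ (s : S) m, f (op s • m) = op s • f m)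
    (hg : ∀ (s : S) l, g (s • l) = s • g l) (m : M) (l : L) :
    map f g hf hg (tmul S m l) = tmul S (f m) (g l) := rfl

/-- The right action of `U` on `M ⊗_S L` for an `S`-`U`-bimodule `L`. -/
instance {U : Type u} [Ring U] [Module Uᵐᵒᵖ L] [SMulCommClass S Uᵐᵒᵖ L] :
    Module Uᵐᵒᵖ (BTensor S M L) where
  smul b := map (AddMonoidHom.id M) (DistribSMul.toAddMonoidHom L b) (fun _ _ => rfl)
    (fun s l => (smul_comm s b l).symm)
  one_smul x := by
    induction x using induct with
    | tmul m l => exact congrArg (tmul S m) (one_smul _ l)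
    | add x y hx hy => exact (map_add _ x y).trans (congrArg₂ _ hx hy)
  mul_smul a b x := by
    induction x using induct with
    | tmul m l => exact congrArg (tmul S m) (mul_smul a b l)
    | add x y hx hy =>
      exact (map_add _ x y).trans ((congrArg₂ _ hx hy).trans
        ((congrArg _ (map_add _ x y)).trans (map_add _ _ _)).symm)
  smul_zero a := map_zero _
  smul_add a := map_add _
  add_smul a b x := by
    induction x using induct with
    | tmul m l => exact (congrArg (tmul S m) (add_smul a b l)).trans (tmul_add _ _ _)
    | add x y hx hy =>
      refine (map_add _ x y).trans ((congrArg₂ _ hx hy).trans ?_)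
      refine Eq.trans ?_ (congrArg₂ _ (map_add _ x y).symm (map_add _ x y).symm)
      exact add_add_add_comm _ _ _ _
  zero_smul x := by
    induction x using induct with
    | tmul m l => exact (congrArg (tmul S m) (zero_smul _ l)).trans (tmul_zero _)
    | add x y hx hy => exact (map_add _ x y).trans ((congrArg₂ _ hx hy).trans (add_zero _))

lemma op_smul_tmul {U : Type u} [Ring U] [Module Uᵐᵒᵖ L] [SMulCommClass S Uᵐᵒᵖ L] (b : Uᵐᵒᵖ)
    (m : M) (l : L) : b • tmul S m l = tmul S m (b • l) := rfl

end BTensor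

end BTensor

/-- A DG `A`-`B`-bimodule: a right DG `B`-module with a compatible left action of `A`. -/
structure DGBimod (A B : DGAlg.{u} R) extends DGMod B where
  [leftModule : Module A carrier]
  [smulComm : SMulCommClass A Bᵐᵒᵖ carrier]
  left_smul_mem : ∀ i j (a : A) x, a ∈ A.deg i → x ∈ deg j → a • x ∈ deg (i + j)
  left_leibniz : ∀ n (a : A) x, a ∈ A.deg n →
    d (a • x) = A.d a • x + n.negOnePow • (a • d x)

namespace DGBimod

attribute [instance] DGBimod.leftModule DGBimod.smulComm

variable {A B : DGAlg.{u} R}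

instance : CoeSort (DGBimod A B) (Type u) := ⟨fun M => M.carrier⟩

instance (M : DGBimod A B) : Module A M.toDGMod := M.leftModule

instance (M : DGBimod A B) : SMulCommClass A Bᵐᵒᵖ M.toDGMod := M.smulComm

lemma left_leibniz' (M : DGBimod A B) (a : A) (x : M) :
    M.d (a • x) = A.d a • x + A.twist a • M.d x := by
  change _ = _ + sgn A.deg a • _
  induction a using induct A.deg with
  | hom n a ha =>
    rw [M.left_leibniz n a x ha, sgn_of_mem A.deg ha]
    rcases Int.even_or_odd n with h | h
    · simp [Int.negOnePow_even _ h]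
    · simp [Int.negOnePow_odd _ h]
  | add a b ha hb => simp only [add_smul, map_add, ha, hb]; abel

lemma left_smul_proj (M : DGBimod A B) {i : ℤ} {a : A} (ha : a ∈ A.deg i) (n : ℤ) (x : M) :
    proj M.deg n (a • x) = a • proj M.deg (n - i) x := by
  induction x using induct M.deg with
  | hom j x hx =>
    by_cases h : i + j = n
    · subst h
      rw [proj_same M.deg (M.left_smul_mem i j a x ha hx), proj_same M.deg (by simpa using hx)]
    · rw [proj_ne M.deg (M.left_smul_mem i j a x ha hx) h, proj_ne M.deg hx (by omega), smul_zero]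
  | add x y hx hy => simp only [smul_add, map_add, hx, hy]

/-- `B` as an `A`-`B`-bimodule along a homomorphism of DG algebras `A → B`. -/
def ofHom (φ : DGAlg.Hom A B) : DGBimod A B :=
  letI : Module A (DGMod.self B) := Module.compHom B φ.toAlgHom.toRingHom
  { toDGMod := DGMod.self B
    smulComm := ⟨fun a b x => (mul_assoc (φ.toAlgHom a) (x : B) b.unop).symm⟩
    left_smul_mem := fun i j a (x : B) ha (hx : x ∈ B.deg j) => by
      have h : φ.toAlgHom a * x ∈ B.deg (i + j) :=
        SetLike.GradedMul.mul_mem (φ.map_mem i a ha) hx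
      exact h
    left_leibniz := fun n a x ha => by
      have := B.leibniz n (φ.toAlgHom a) x (φ.map_mem n a ha)
      rw [← φ.map_d] at this
      exact this }

/-- The shift `Σ M` of a bimodule. On `Σ M` the differential and the left action carry the signs
`d (Σ x) = - Σ (d x)` and `a (Σ x) = (-1)^|a| Σ (a x)`; the right action is unchanged. -/
def susp (M : DGBimod A B) : DGBimod A B :=
  letI : Module A (M.toDGMod.shift 1) := Module.compHom M.carrier A.twist
  { toDGMod := M.toDGMod.shift 1
    smulComm := ⟨fun a b (x : M) => smul_comm (A.twist a) b x⟩
    left_smul_mem := fun i j a (x : M) ha hx => by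
      have := M.left_smul_mem i (j - 1) (A.twist a) x (sgn_mem A.deg ha) hx
      change A.twist a • x ∈ M.deg (i + j - 1)
      rwa [show i + j - 1 = i + (j - 1) by omega]
    left_leibniz := fun n a (x : M) ha => by
      have h1 := M.left_leibniz n (A.twist a) x (sgn_mem A.deg ha)
      have h2 : A.d (A.twist a) = - A.twist (A.d a) := by
        change A.d (sgn A.deg a) = - sgn A.deg (A.d a)
        rw [sgn_of_mem A.deg ha, sgn_of_mem A.deg (A.d_mem n a ha), Int.negOnePow_sub]
        rcases Int.even_or_odd n with h | h
        · simp [Int.negOnePow_even _ h]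
        · simp [Int.negOnePow_odd _ h]
      rw [h2] at h1
      change (Int.negOnePow 1) • M.d (A.twist a • x) =
        A.twist (A.d a) • x + n.negOnePow • (A.twist a • ((Int.negOnePow 1) • M.d x))
      rw [h1]
      simp }

end DGBimod

namespace DGMod

variable {A B : DGAlg.{u} R}

section tensor

variable (M : DGMod A) (L : DGBimod A B)

/-- The component of degree `n` of `M ⊗_A L`, spanned by all `m ⊗ l` with `|m| + |l| = n`. -/
def tensorDeg (n : ℤ) : AddSubgroup (BTensor A M L) :=
  AddSubgroup.closure {t | ∃ i j m l, m ∈ M.deg i ∧ l ∈ L.deg j ∧ i + j = n ∧ t = BTensor.tmul A m l}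

lemma tmul_mem {i j : ℤ} {m : M} {l : L} (hm : m ∈ M.deg i) (hl : l ∈ L.deg j) :
    BTensor.tmul A m l ∈ tensorDeg M L (i + j) :=
  AddSubgroup.subset_closure ⟨i, j, m, l, hm, hl, rfl, rfl⟩

/-- The projection of `M ⊗_A L` to its component of degree `n`, as a biadditive map. -/
def tensorProjAux (n : ℤ) : M →+ L →+ BTensor A M L :=
  (DirectSum.toAddMonoid fun i : ℤ =>
    (AddMonoidHom.compHom' (proj L.deg (n - i))).comp
      (BTensor.mkHom.comp (M.deg i).subtype)).comp
    (DirectSum.decomposeAddEquiv M.deg).toAddMonoidHom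

lemma tensorProjAux_of_mem (n : ℤ) {i : ℤ} {m : M} (hm : m ∈ M.deg i) (l : L) :
    tensorProjAux M L n m l = BTensor.tmul A m (proj L.deg (n - i) l) := by
  simp [tensorProjAux, DirectSum.decomposeAddEquiv, DirectSum.decompose_of_mem M.deg hm]
  rfl

/-- The projection of `M ⊗_A L` to its component of degree `n`. -/
def tensorProj (n : ℤ) : BTensor A M L →+ BTensor A M L :=
  BTensor.lift (tensorProjAux M L n) (fun m a l => by
    induction m using induct M.deg with
    | hom i m hm =>
      induction a using induct A.deg with
      | hom j a ha =>
        rw [tensorProjAux_of_mem M L n hm, tensorProjAux_of_mem M L n (M.smul_mem _ _ _ _ hm ha),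
          L.left_smul_proj ha, BTensor.smul_tmul, sub_sub]
      | add a b ha hb => simp only [MulOpposite.op_add, add_smul, map_add, AddMonoidHom.add_apply, ha, hb]
    | add x y hx hy => simp only [smul_add, map_add, AddMonoidHom.add_apply, hx, hy])

lemma tensorProj_tmul (n : ℤ) {i j : ℤ} {m : M} {l : L} (hm : m ∈ M.deg i) (hl : l ∈ L.deg j) :
    tensorProj M L n (BTensor.tmul A m l) = if i + j = n then BTensor.tmul A m l else 0 := by
  rw [tensorProj, BTensor.lift_tmul, tensorProjAux_of_mem M L n hm]
  split_ifs with h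
  · rw [proj_same L.deg (by rwa [← h, add_sub_cancel_left])]
  · rw [proj_ne L.deg hl (by omega), BTensor.tmul_zero]

/-- Induction over pure tensors of homogeneous elements. -/
lemma tensor_induct {p : BTensor A M L → Prop}
    (hom : ∀ i j m l, m ∈ M.deg i → l ∈ L.deg j → p (BTensor.tmul A m l))
    (add : ∀ x y, p x → p y → p (x + y)) (x : BTensor A M L) : p x := by
  induction x using BTensor.induct with
  | tmul m l =>
    induction m using induct M.deg with
    | hom i m hm =>
      induction l using induct L.deg with
      | hom j l hl => exact hom i j m l hm hl
      | add x y hx hy => rw [BTensor.tmul_add]; exact add _ _ hx hy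
    | add x y hx hy => rw [BTensor.add_tmul]; exact add _ _ hx hy
  | add x y hx hy => exact add _ _ hx hy

/-- The differential `m ⊗ l ↦ d m ⊗ l + (-1)^|m| m ⊗ d l`. -/
def tensorD : BTensor A M L →+ BTensor A M L :=
  BTensor.lift ((BTensor.mkHom (S := A) (L := L)).comp M.d +
      (AddMonoidHom.compHom' L.d).comp ((BTensor.mkHom (S := A) (L := L)).comp (sgn M.deg))) (fun m a l => by
    change BTensor.tmul A (M.d (op a • m)) l + BTensor.tmul A (sgn M.deg (op a • m)) (L.d l) =
      BTensor.tmul A (M.d m) (a • l) + BTensor.tmul A (sgn M.deg m) (L.d (a • l))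
    rw [M.leibniz', L.left_leibniz', M.sgn_smul, BTensor.add_tmul, BTensor.tmul_add,
      BTensor.smul_tmul, BTensor.smul_tmul, BTensor.smul_tmul, add_assoc])

lemma tensorD_tmul (m : M) (l : L) : tensorD M L (BTensor.tmul A m l) =
    BTensor.tmul A (M.d m) l + BTensor.tmul A (sgn M.deg m) (L.d l) := rfl

/-- The tensor product `M ⊗_A L` as a right DG `B`-module. -/
def tensor : DGMod B where
  carrier := BTensor A M L
  deg := tensorDeg M L
  graded := ofProj _ (tensorProj M L)
    (fun n x hx => by
      induction hx using AddSubgroup.closure_induction with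
      | mem x hx =>
        obtain ⟨i, j, m, l, hm, hl, h, rfl⟩ := hx
        rw [tensorProj_tmul M L n hm hl, if_pos h]
      | zero => exact map_zero _
      | add x y _ _ hx hy => rw [map_add, hx, hy]
      | neg x _ hx => rw [map_neg, hx])
    (fun n k x hx hnk => by
      induction hx using AddSubgroup.closure_induction with
      | mem x hx =>
        obtain ⟨i, j, m, l, hm, hl, h, rfl⟩ := hx
        rw [tensorProj_tmul M L k hm hl, if_neg (by omega)]
      | zero => exact map_zero _
      | add x y _ _ hx hy => rw [map_add, hx, hy, add_zero]
      | neg x _ hx => rw [map_neg, hx, neg_zero])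
    (fun x => by
      induction x using tensor_induct with
      | hom i j m l hm hl => exact AddSubgroup.mem_iSup_of_mem (i + j) (tmul_mem M L hm hl)
      | add x y hx hy => exact add_mem hx hy)
  smul_mem n k x b hx hb := by
    induction hx using AddSubgroup.closure_induction with
    | mem x hx =>
      obtain ⟨i, j, m, l, hm, hl, rfl, rfl⟩ := hx
      rw [BTensor.op_smul_tmul, add_assoc]
      exact tmul_mem M L hm (L.smul_mem _ _ _ _ hl hb)
    | zero => rw [smul_zero]; exact zero_mem _
    | add x y _ _ hx hy => rw [smul_add]; exact add_mem hx hy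
    | neg x _ hx => rw [smul_neg]; exact neg_mem hx
  d := tensorD M L
  d_mem n x hx := by
    induction hx using AddSubgroup.closure_induction with
    | mem x hx =>
      obtain ⟨i, j, m, l, hm, hl, rfl, rfl⟩ := hx
      rw [tensorD_tmul]
      refine add_mem ?_ ?_
      · rw [show i + j - 1 = i - 1 + j by omega]
        exact tmul_mem M L (M.d_mem _ _ hm) hl
      · rw [show i + j - 1 = i + (j - 1) by omega]
        exact tmul_mem M L (sgn_mem _ hm) (L.d_mem _ _ hl)
    | zero => rw [map_zero]; exact zero_mem _
    | add x y _ _ hx hy => rw [map_add]; exact add_mem hx hy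
    | neg x _ hx => rw [map_neg]; exact neg_mem hx
  d_d x := by
    induction x using BTensor.induct with
    | tmul m l =>
      rw [tensorD_tmul, map_add, tensorD_tmul, tensorD_tmul, M.d_d, L.d_d, M.sgn_d,
        BTensor.zero_tmul, BTensor.tmul_zero, BTensor.neg_tmul]
      abel
    | add x y hx hy => rw [map_add, map_add, hx, hy, add_zero]
  leibniz n x b hx := by
    induction hx using AddSubgroup.closure_induction with
    | mem x hx =>
      obtain ⟨i, j, m, l, hm, hl, rfl, rfl⟩ := hx
      rw [BTensor.op_smul_tmul, BTensor.op_smul_tmul, tensorD_tmul, tensorD_tmul, smul_add,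
        BTensor.op_smul_tmul, BTensor.op_smul_tmul, L.leibniz j l b hl, BTensor.tmul_add,
        BTensor.tmul_units_smul, sgn_of_mem _ hm, BTensor.units_smul_tmul,
        BTensor.units_smul_tmul, smul_smul, ← Int.negOnePow_add, add_comm j i, add_assoc]
    | zero => simp
    | add x y _ _ hx hy => simp only [smul_add, map_add, hx, hy]; abel
    | neg x _ hx => simp only [smul_neg, map_neg, hx]; abel

end tensor

end DGMod

namespace DGMod

variable {A B : DGAlg.{u} R}

/-- Pure tensors in `M ⊗_A L`. -/
def tmul {M : DGMod A} {L : DGBimod A B} (m : M) (l : L) : M.tensor L := BTensor.tmul A m l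

section

variable {M : DGMod A} {L : DGBimod A B}

lemma tmul_add (m : M) (l l' : L) : tmul m (l + l') = tmul m l + tmul m l' :=
  BTensor.tmul_add m l l'

lemma add_tmul (m m' : M) (l : L) : tmul (m + m') l = tmul m l + tmul m' l :=
  BTensor.add_tmul m m' l

lemma zero_tmul (l : L) : tmul (0 : M) l = 0 := BTensor.zero_tmul l

lemma tmul_zero (m : M) : tmul m (0 : L) = 0 := BTensor.tmul_zero m

lemma neg_tmul (m : M) (l : L) : tmul (-m) l = - tmul m l := BTensor.neg_tmul m l

lemma tmul_neg (m : M) (l : L) : tmul m (-l) = - tmul m l := BTensor.tmul_neg m l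

lemma smul_tmul (m : M) (a : A) (l : L) : tmul (op a • m) l = tmul m (a • l) :=
  BTensor.smul_tmul m a l

lemma op_smul_tmul (b : Bᵐᵒᵖ) (m : M) (l : L) : b • tmul m l = tmul m (b • l) := rfl

lemma d_tmul (m : M) (l : L) :
    (M.tensor L).d (tmul m l) = tmul (M.d m) l + tmul (sgn M.deg m) (L.d l) := rfl

lemma tmul_mem_deg {i j : ℤ} {m : M} {l : L} (hm : m ∈ M.deg i) (hl : l ∈ L.deg j) :
    tmul m l ∈ (M.tensor L).deg (i + j) := tmul_mem M L hm hl

lemma induct_tmul {p : M.tensor L → Prop} (tmul : ∀ m l, p (tmul m l))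
    (add : ∀ x y, p x → p y → p (x + y)) (x : M.tensor L) : p x :=
  BTensor.induct (p := p) tmul add x

lemma sgn_tmul (m : M) (l : L) :
    sgn (M.tensor L).deg (tmul m l) = tmul (sgn M.deg m) (sgn L.deg l) := by
  induction m using induct M.deg with
  | hom i m hm =>
    induction l using induct L.deg with
    | hom j l hl =>
      rw [sgn_of_mem _ (tmul_mem_deg hm hl), sgn_of_mem _ hm, sgn_of_mem _ hl, Int.negOnePow_add]
      rcases Int.even_or_odd i with h | h <;> rcases Int.even_or_odd j with h' | h' <;>
        simp [Int.negOnePow_even _, Int.negOnePow_odd _, h, h', neg_tmul, tmul_neg]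
    | add x y hx hy => simp only [tmul_add, map_add, hx, hy]
  | add x y hx hy => simp only [add_tmul, map_add, hx, hy]

end

/-! ### Homomorphisms and homotopies -/

/-- The group `Hom_{C(B)}(M, N)` of DG module homomorphisms. -/
def dgHom (M N : DGMod B) : AddSubgroup (M →ₗ[Bᵐᵒᵖ] N) where
  carrier := {f | (∀ n x, x ∈ M.deg n → f x ∈ N.deg n) ∧ ∀ x, f (M.d x) = N.d (f x)}
  zero_mem' := ⟨fun _ _ _ => zero_mem _, fun _ => (map_zero _).symm⟩
  add_mem' := fun {f g} hf hg => ⟨fun n x hx => add_mem (hf.1 n x hx) (hg.1 n x hx), fun x => by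
    rw [LinearMap.add_apply, LinearMap.add_apply, hf.2, hg.2, map_add]⟩
  neg_mem' := fun {f} hf => ⟨fun n x hx => neg_mem (hf.1 n x hx), fun x => by
    rw [LinearMap.neg_apply, LinearMap.neg_apply, hf.2, map_neg]⟩

/-- `h` is a homotopy from `f` to zero: a homogeneous linear map of degree one with
`f = d h + h d`. -/
structure IsHomotopy {M N : DGMod B} (f h : M →ₗ[Bᵐᵒᵖ] N) : Prop where
  map_mem : ∀ n x, x ∈ M.deg n → h x ∈ N.deg (n + 1)
  eq : ∀ x, f x = N.d (h x) + h (M.d x)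

lemma IsHomotopy.zero {M N : DGMod B} : IsHomotopy (0 : M →ₗ[Bᵐᵒᵖ] N) 0 :=
  ⟨fun _ _ _ => zero_mem _, fun _ => by simp⟩

lemma IsHomotopy.add {M N : DGMod B} {f g h k : M →ₗ[Bᵐᵒᵖ] N} (hf : IsHomotopy f h)
    (hg : IsHomotopy g k) : IsHomotopy (f + g) (h + k) :=
  ⟨fun n x hx => add_mem (hf.1 n x hx) (hg.1 n x hx), fun x => by
    simp only [LinearMap.add_apply, map_add, hf.2, hg.2]; abel⟩

lemma IsHomotopy.neg {M N : DGMod B} {f h : M →ₗ[Bᵐᵒᵖ] N} (hf : IsHomotopy f h) :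
    IsHomotopy (-f) (-h) :=
  ⟨fun n x hx => neg_mem (hf.1 n x hx), fun x => by
    simp only [LinearMap.neg_apply, map_neg, hf.2]; abel⟩

lemma IsHomotopy.comp_left {M N P : DGMod B} {f h : M →ₗ[Bᵐᵒᵖ] N} (hf : IsHomotopy f h)
    {g : N →ₗ[Bᵐᵒᵖ] P} (hg : g ∈ dgHom N P) : IsHomotopy (g ∘ₗ f) (g ∘ₗ h) :=
  ⟨fun n x hx => hg.1 _ _ (hf.1 n x hx), fun x => by
    simp only [LinearMap.comp_apply, hf.2, map_add, hg.2]⟩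

lemma IsHomotopy.comp_right {M N P : DGMod B} {f h : N →ₗ[Bᵐᵒᵖ] P} (hf : IsHomotopy f h)
    {g : M →ₗ[Bᵐᵒᵖ] N} (hg : g ∈ dgHom M N) : IsHomotopy (f ∘ₗ g) (h ∘ₗ g) :=
  ⟨fun n x hx => hf.1 _ _ (hg.1 n x hx), fun x => by
    simp only [LinearMap.comp_apply, hf.2, hg.2]⟩

lemma id_mem (M : DGMod B) : LinearMap.id ∈ dgHom M M := ⟨fun _ _ h => h, fun _ => rfl⟩

lemma comp_mem {M N P : DGMod B} {g : N →ₗ[Bᵐᵒᵖ] P} {f : M →ₗ[Bᵐᵒᵖ] N} (hg : g ∈ dgHom N P)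
    (hf : f ∈ dgHom M N) : g ∘ₗ f ∈ dgHom M P :=
  ⟨fun n x hx => hg.1 _ _ (hf.1 n x hx), fun x => by
    simp only [LinearMap.comp_apply, hf.2, hg.2]⟩

/-- The subgroup of null-homotopic DG module homomorphisms. -/
def nullHom (M N : DGMod B) : AddSubgroup (dgHom M N) where
  carrier := {f | ∃ h, IsHomotopy f.1 h}
  zero_mem' := ⟨0, .zero⟩
  add_mem' := fun ⟨_, hf⟩ ⟨_, hg⟩ => ⟨_, hf.add hg⟩
  neg_mem' := fun ⟨_, hf⟩ => ⟨_, hf.neg⟩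

/-- The group `Hom_{K(B)}(M, N)` of homotopy classes of DG module homomorphisms. -/
abbrev HomK (M N : DGMod B) : Type u := dgHom M N ⧸ nullHom M N

/-- The ring `End_{C(B)}(N)` of DG module endomorphisms. -/
def dgEnd (N : DGMod B) : Subring (Module.End Bᵐᵒᵖ N) :=
  { dgHom N N with
    mul_mem' := fun hf hg => comp_mem hf hg
    one_mem' := id_mem N }

/-- The homotopy relation on the ring of DG module endomorphisms. -/
def htpyCon (N : DGMod B) : RingCon (dgEnd N) where
  r f g := ∃ h, IsHomotopy (f.1 - g.1) h
  iseqv :=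
    { refl := fun f => ⟨0, by rw [sub_self]; exact .zero⟩
      symm := fun ⟨h, hh⟩ => ⟨-h, by rw [← neg_sub]; exact hh.neg⟩
      trans := fun ⟨h, hh⟩ ⟨k, hk⟩ => ⟨h + k, by rw [← sub_add_sub_cancel]; exact hh.add hk⟩ }
  add' := fun {a b c d} ⟨h, hh⟩ ⟨k, hk⟩ => ⟨h + k, by
    have := hh.add hk
    rwa [sub_add_sub_comm] at this⟩
  mul' := fun {a b c d} ⟨h, hh⟩ ⟨k, hk⟩ => ⟨h ∘ₗ c.1 + b.1 ∘ₗ k, by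
    have := (hh.comp_right c.2).add (hk.comp_left b.2)
    have e : (a * c).1 - (b * d).1 = (a.1 - b.1) ∘ₗ c.1 + b.1 ∘ₗ (c.1 - d.1) := by
      change a.1 * c.1 - b.1 * d.1 = (a.1 - b.1) * c.1 + b.1 * (c.1 - d.1)
      noncomm_ring
    rw [e]
    exact this⟩

/-- The endomorphism ring `End_{K(B)}(N)` in the homotopy category. -/
abbrev EndK (N : DGMod B) : Type u := (htpyCon N).Quotient

/-- The kernel of a DG module homomorphism. -/
def ker {M N : DGMod B} (f : dgHom M N) : DGMod B where
  carrier := LinearMap.ker f.1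
  deg n := (M.deg n).comap (LinearMap.ker f.1).subtype.toAddMonoidHom
  graded :=
    have hp : ∀ n x, f.1 (proj M.deg n x) = proj N.deg n (f.1 x) := fun n x => by
      induction x using induct M.deg with
      | hom i x hx =>
        by_cases h : i = n
        · subst h; rw [proj_same _ hx, proj_same _ (f.2.1 _ _ hx)]
        · rw [proj_ne _ hx h, proj_ne _ (f.2.1 _ _ hx) h, map_zero]
      | add x y hx hy => simp only [map_add, hx, hy]
    ofProj _ (fun n => ((proj M.deg n).comp (LinearMap.ker f.1).subtype.toAddMonoidHom).codRestrict
        (LinearMap.ker f.1) (fun x => by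
          change f.1 (proj M.deg n x.1) = 0
          rw [hp, show f.1 x.1 = 0 from x.2, map_zero]))
      (fun n x hx => Subtype.ext (proj_same M.deg hx))
      (fun n m x hx h => Subtype.ext (proj_ne M.deg hx h))
      (fun x => by
        classical
        have hx : x = ∑ i ∈ (DirectSum.decompose M.deg x.1).support,
            (⟨proj M.deg i x.1, by
              change f.1 (proj M.deg i x.1) = 0
              rw [hp, show f.1 x.1 = 0 from x.2, map_zero]⟩ : LinearMap.ker f.1) := by
          apply Subtype.ext
          rw [AddSubmonoidClass.coe_finsetSum]
          exact (DirectSum.sum_support_decompose M.deg x.1).symm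
        rw [hx]
        exact sum_mem fun i _ => AddSubgroup.mem_iSup_of_mem i (proj_mem M.deg i x.1))
  smul_mem i j x b hx hb := M.smul_mem i j x.1 b hx hb
  d := (M.d.comp (LinearMap.ker f.1).subtype.toAddMonoidHom).codRestrict (LinearMap.ker f.1)
    (fun x => by
      change f.1 (M.d x.1) = 0
      rw [f.2.2, show f.1 x.1 = 0 from x.2, map_zero])
  d_mem n x hx := M.d_mem n x.1 hx
  d_d x := Subtype.ext (M.d_d x.1)
  leibniz n x b hx := Subtype.ext (M.leibniz n x.1 b hx)

/-- The additive map underlying `f ⊗ id : M ⊗_A L → M' ⊗_A L`. -/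
def tensorMapAux {M M' : DGMod A} (f : M →ₗ[Aᵐᵒᵖ] M') (L : DGBimod A B) :
    M.tensor L →+ M'.tensor L :=
  BTensor.map (S := A) (L := L) (L' := L) f.toAddMonoidHom (AddMonoidHom.id L)
    (fun s m => f.map_smul (op s) m) (fun _ _ => rfl)

/-- The map `f ⊗ id : M ⊗_A L → M' ⊗_A L` for an `A`-linear map `f`. -/
def tensorMap {M M' : DGMod A} (f : M →ₗ[Aᵐᵒᵖ] M') (L : DGBimod A B) :
    M.tensor L →ₗ[Bᵐᵒᵖ] M'.tensor L :=
  { tensorMapAux f L with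
    map_smul' := fun b x => by
      change tensorMapAux f L (b • x) = b • tensorMapAux f L x
      induction x using induct_tmul with
      | tmul m l => rfl
      | add x y hx hy => rw [smul_add, map_add, map_add, hx, hy, smul_add] }

@[simp] lemma tensorMap_tmul {M M' : DGMod A} (f : M →ₗ[Aᵐᵒᵖ] M') (L : DGBimod A B) (m : M)
    (l : L) : tensorMap f L (tmul m l) = tmul (f m) l := rfl

lemma tensor_hom_ext {M : DGMod A} {L : DGBimod A B} {P : DGMod B}
    {f g : M.tensor L →ₗ[Bᵐᵒᵖ] P} (h : ∀ m l, f (tmul m l) = g (tmul m l)) : f = g := by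
  ext x
  induction x using induct_tmul with
  | tmul m l => exact h m l
  | add x y hx hy => rw [map_add, map_add, hx, hy]

lemma tensorMap_degree {M M' : DGMod A} {f : M →ₗ[Aᵐᵒᵖ] M'} (L : DGBimod A B) {k : ℤ}
    (hf : ∀ n x, x ∈ M.deg n → f x ∈ M'.deg (n + k)) (n : ℤ) (x : M.tensor L)
    (hx : x ∈ (M.tensor L).deg n) : tensorMap f L x ∈ (M'.tensor L).deg (n + k) := by
  change x ∈ tensorDeg M L n at hx
  induction hx using AddSubgroup.closure_induction with
  | mem x hx =>
    obtain ⟨i, j, m, l, hm, hl, rfl, rfl⟩ := hx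
    rw [show i + j + k = i + k + j by omega]
    exact tmul_mem_deg (hf i m hm) hl
  | zero => exact (map_zero (tensorMap f L)).symm ▸ zero_mem _
  | add x y _ _ hx hy => exact (map_add (tensorMap f L) x y).symm ▸ add_mem hx hy
  | neg x _ hx => exact (map_neg (tensorMap f L) x).symm ▸ neg_mem hx

lemma map_sgn {M N : DGMod B} (f : M →ₗ[Bᵐᵒᵖ] N) {k : ℤ}
    (hf : ∀ n x, x ∈ M.deg n → f x ∈ N.deg (n + k)) (x : M) :
    sgn N.deg (f x) = k.negOnePow • f (sgn M.deg x) := by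
  induction x using induct M.deg with
  | hom n x hx =>
    rw [sgn_of_mem _ hx, sgn_of_mem _ (hf n x hx), Int.negOnePow_add]
    rcases Int.even_or_odd n with h | h <;> rcases Int.even_or_odd k with h' | h' <;>
        simp [Int.negOnePow_even _, Int.negOnePow_odd _, h, h']
  | add x y hx hy => simp only [map_add, hx, hy, smul_add]

lemma tensorMap_mem {M M' : DGMod A} {f : M →ₗ[Aᵐᵒᵖ] M'} (L : DGBimod A B)
    (hf : f ∈ dgHom M M') : tensorMap f L ∈ dgHom (M.tensor L) (M'.tensor L) := by
  have h0 : ∀ n x, x ∈ M.deg n → f x ∈ M'.deg (n + 0) := by simpa using hf.1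
  refine ⟨fun n x hx => by simpa using tensorMap_degree L h0 n x hx, fun x => ?_⟩
  induction x using induct_tmul with
  | tmul m l =>
    rw [d_tmul, map_add, tensorMap_tmul, tensorMap_tmul, tensorMap_tmul, d_tmul, hf.2,
      map_sgn f h0, Int.negOnePow_zero, one_smul]
  | add x y hx hy => simp only [map_add, hx, hy]

lemma tensorMap_htpy {M M' : DGMod A} {f h : M →ₗ[Aᵐᵒᵖ] M'} (L : DGBimod A B)
    (hf : IsHomotopy f h) : IsHomotopy (tensorMap f L) (tensorMap h L) := by
  refine ⟨tensorMap_degree L hf.1, fun x => ?_⟩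
  induction x using induct_tmul with
  | tmul m l =>
    rw [d_tmul, map_add, tensorMap_tmul, tensorMap_tmul, tensorMap_tmul, tensorMap_tmul, d_tmul,
      hf.2, map_sgn h hf.1, Int.negOnePow_one, Units.neg_smul, one_smul, add_tmul, neg_tmul]
    abel
  | add x y hx hy => simp only [map_add, hx, hy]; abel

end DGMod

namespace DGBimod

open DGMod

variable {A B C : DGAlg.{u} R}

lemma sgn_left_smul (M : DGBimod A B) (a : A) (x : M) :
    sgn M.deg (a • x) = A.twist a • sgn M.deg x := by
  change _ = sgn A.deg a • sgn M.deg x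
  induction x using induct M.deg with
  | hom n x hx =>
    induction a using induct A.deg with
    | hom m a ha =>
      rw [sgn_of_mem M.deg hx, sgn_of_mem M.deg (M.left_smul_mem _ _ _ _ ha hx),
        sgn_of_mem A.deg ha, Int.negOnePow_add]
      rcases Int.even_or_odd n with h | h <;> rcases Int.even_or_odd m with h' | h' <;>
        simp [Int.negOnePow_even _, Int.negOnePow_odd _, h, h']
    | add b c hb hc => simp only [add_smul, map_add, hb, hc]
  | add x y hx hy => simp only [smul_add, map_add, hx, hy]

/-- Left multiplication by `c` on `M ⊗_A L`. -/
def leftMul (M : DGBimod C A) (L : DGBimod A B) (c : C) :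
    M.toDGMod.tensor L →ₗ[Bᵐᵒᵖ] M.toDGMod.tensor L :=
  tensorMap
    { toFun := fun x => c • x
      map_add' := smul_add c
      map_smul' := fun a x => smul_comm c a x } L

lemma leftMul_tmul (M : DGBimod C A) (L : DGBimod A B) (c : C) (m : M) (l : L) :
    leftMul M L c (tmul m l) = tmul (M := M.toDGMod) (c • m) l := rfl

/-- The tensor product of bimodules, with `c (m ⊗ l) = c m ⊗ l`. -/
def tensor (M : DGBimod C A) (L : DGBimod A B) : DGBimod C B :=
  letI : Module C (M.toDGMod.tensor L) :=
    { smul := fun c x => leftMul M L c x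
      one_smul := fun x => by
        change leftMul M L 1 x = x
        induction x using induct_tmul with
        | tmul m l => rw [leftMul_tmul, one_smul]
        | add x y hx hy => rw [map_add, hx, hy]
      mul_smul := fun a b x => by
        change leftMul M L (a * b) x = leftMul M L a (leftMul M L b x)
        induction x using induct_tmul with
        | tmul m l => rw [leftMul_tmul, leftMul_tmul, leftMul_tmul, mul_smul]
        | add x y hx hy => simp only [map_add, hx, hy]
      smul_zero := fun a => map_zero (leftMul M L a)
      smul_add := fun a => map_add (leftMul M L a)
      add_smul := fun a b x => by
        change leftMul M L (a + b) x = leftMul M L a x + leftMul M L b x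
        induction x using induct_tmul with
        | tmul m l => rw [leftMul_tmul, leftMul_tmul, leftMul_tmul, add_smul, add_tmul]
        | add x y hx hy => simp only [map_add, hx, hy]; abel
      zero_smul := fun x => by
        change leftMul M L 0 x = 0
        induction x using induct_tmul with
        | tmul m l => rw [leftMul_tmul, zero_smul, zero_tmul]
        | add x y hx hy => rw [map_add, hx, hy, add_zero] }
  { toDGMod := M.toDGMod.tensor L
    smulComm := ⟨fun a b x => (leftMul M L a).map_smul b x⟩
    left_smul_mem := fun i j a x ha hx => by
      change leftMul M L a x ∈ _
      rw [add_comm]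
      exact tensorMap_degree L
        (fun n x hx => by rw [add_comm]; exact M.left_smul_mem i n a x ha hx) j x hx
    left_leibniz := fun n a x ha => by
      change (M.toDGMod.tensor L).d (leftMul M L a x) = leftMul M L (A := A) (C.d a) x +
        n.negOnePow • leftMul M L a ((M.toDGMod.tensor L).d x)
      induction x using induct_tmul with
      | tmul m l =>
        rw [leftMul_tmul, leftMul_tmul, d_tmul, d_tmul, map_add, leftMul_tmul, leftMul_tmul,
          left_leibniz', sgn_left_smul]
        have h : C.twist a = n.negOnePow • a := sgn_of_mem C.deg ha
        rw [h, add_tmul]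
        rcases Int.even_or_odd n with hn | hn
        · simp [Int.negOnePow_even _ hn, add_assoc]
        · simp [Int.negOnePow_odd _ hn, neg_tmul, add_assoc]
      | add x y hx hy => simp only [map_add, hx, hy, smul_add]; abel }

/-- Restriction of the right action along a homomorphism of DG algebras. -/
def restrictRight (φ : DGAlg.Hom A B) (M : DGBimod C B) : DGBimod C A :=
  letI : Module C (M.toDGMod.restrict φ) := M.leftModule
  { toDGMod := M.toDGMod.restrict φ
    smulComm := ⟨fun c a (x : M) => smul_comm c (op (φ.toAlgHom a.unop)) x⟩
    left_smul_mem := M.left_smul_mem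
    left_leibniz := M.left_leibniz }

/-- `B` as a bimodule over itself. -/
def self (B : DGAlg.{u} R) : DGBimod B B :=
  ofHom ⟨AlgHom.id R B, fun _ _ h => h, fun _ => rfl⟩

end DGBimod

/-! ## The diagonal ideal -/

section Diagonal

open DGMod

variable {A B : DGAlg.{u} R} (φ : DGAlg.Hom A B)

/-- The DG `B`-module `N|_A ⊗_A B`. -/
def baseChange (N : DGMod B) : DGMod B := (restrict φ N).tensor (DGBimod.ofHom φ)

/-- The element `x ⊗ b` of `N|_A ⊗_A B`. -/
def bmul {N : DGMod B} (x : N) (b : B) : baseChange φ N :=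
  tmul (M := restrict φ N) (L := DGBimod.ofHom φ) x b

variable {φ} in
lemma baseChange_induct {N : DGMod B} {p : baseChange φ N → Prop} (bmul : ∀ x b, p (bmul φ x b))
    (add : ∀ x y, p x → p y → p (x + y)) (x : baseChange φ N) : p x :=
  induct_tmul (p := p) bmul add x

/-- The biadditive map `(x, b) ↦ x b`. -/
def actHom (N : DGMod B) : N →+ B →+ N :=
  AddMonoidHom.mk' (fun x : N => AddMonoidHom.mk' (fun b : B => op b • x)
    (fun a b => by rw [MulOpposite.op_add, add_smul]))
    (fun x y => by ext b; exact smul_add _ _ _)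

/-- The additive map underlying `π_N`. -/
def piAux (N : DGMod B) : baseChange φ N →+ N :=
  BTensor.lift (S := A) (M := restrict φ N) (L := DGBimod.ofHom φ) (actHom N)
    (fun (m : N) a (l : B) => by
      change op l • op (φ.toAlgHom a) • m = op (φ.toAlgHom a * l) • m
      rw [MulOpposite.op_mul, mul_smul])

lemma piAux_bmul {N : DGMod B} (x : N) (b : B) : piAux φ N (bmul φ x b) = op b • x := rfl

/-- The DG module homomorphism `π_N : N|_A ⊗_A B → N`, `n ⊗ b ↦ n b`. -/
def piMap (N : DGMod B) : dgHom (baseChange φ N) N :=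
  ⟨{ piAux φ N with
      map_smul' := fun b x => by
        change piAux φ N (b • x) = b • piAux φ N x
        induction x using baseChange_induct with
        | bmul m l =>
          have h : b • bmul φ m l = bmul φ m (l * b.unop) := rfl
          rw [h, piAux_bmul, piAux_bmul, MulOpposite.op_mul, mul_smul, MulOpposite.op_unop]
        | add x y hx hy => rw [smul_add, map_add, map_add, hx, hy, smul_add] },
    fun n x hx => by
      change x ∈ tensorDeg _ _ n at hx
      change piAux φ N x ∈ N.deg n
      induction hx using AddSubgroup.closure_induction with
      | mem x hx =>
        obtain ⟨i, j, m, l, hm, hl, rfl, rfl⟩ := hx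
        exact N.smul_mem i j m l hm hl
      | zero => exact (map_zero (piAux φ N)).symm ▸ zero_mem _
      | add x y _ _ hx hy => exact (map_add (piAux φ N) x y).symm ▸ add_mem hx hy
      | neg x _ hx => exact (map_neg (piAux φ N) x).symm ▸ neg_mem hx,
    fun x => by
      change piAux φ N ((baseChange φ N).d x) = N.d (piAux φ N x)
      induction x using baseChange_induct with
      | bmul m l =>
        have h : (baseChange φ N).d (bmul φ m l) =
          bmul φ (N.d m) l + bmul φ (sgn N.deg m) (B.d l) := rfl
        rw [h, map_add, piAux_bmul, piAux_bmul, piAux_bmul, N.leibniz']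
      | add x y hx hy => simp only [map_add, hx, hy]⟩

/-- `N` is naively liftable to `A`: `π_N` is a split epimorphism of DG `B`-modules. -/
def NaivelyLiftable (N : DGMod B) : Prop :=
  ∃ ρ : dgHom N (baseChange φ N), (piMap φ N).1 ∘ₗ ρ.1 = LinearMap.id

/-- The DG `B`-bimodule `B^e = B ⊗_A B`. -/
def envBimod : DGBimod B B :=
  ((DGBimod.self B).restrictRight φ).tensor (DGBimod.ofHom φ)

/-- The multiplication map `π_B : B^e → B`. -/
def mulMap : dgHom (envBimod φ).toDGMod (DGMod.self B) := piMap φ (DGMod.self B)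

/-- The element `x ⊗ y` of `B ⊗_A B`. -/
def emul (x y : B) : envBimod φ := bmul φ (N := DGMod.self B) x y

lemma smul_emul (b x y : B) : b • emul φ x y = emul φ (b * x) y := rfl

lemma op_smul_emul (b x y : B) : op b • emul φ x y = emul φ x (y * b) := rfl

lemma mulMap_emul (x y : B) : (mulMap φ).1 (emul φ x y) = (x * y : B) := rfl

variable {φ} in
lemma env_induct {p : envBimod φ → Prop} (emul : ∀ x y, p (emul φ x y))
    (add : ∀ x y, p x → p y → p (x + y)) (x : envBimod φ) : p x :=
  induct_tmul (p := p) emul add x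

lemma mulMap_smul (b : B) (x : envBimod φ) :
    (mulMap φ).1 (b • x) = AddMonoidHom.mulLeft b ((mulMap φ).1 x) := by
  induction x using env_induct with
  | emul m l => rw [smul_emul]; exact mul_assoc b m l
  | add x y hx hy =>
    rw [smul_add]
    refine (map_add (mulMap φ).1 _ _).trans ?_
    rw [hx, hy]
    refine Eq.trans ?_ (congrArg (AddMonoidHom.mulLeft b) (map_add (mulMap φ).1 x y)).symm
    exact (map_add (AddMonoidHom.mulLeft b) _ _).symm

/-- The diagonal ideal `J = ker (π_B : B ⊗_A B → B)` as a DG `B`-bimodule. -/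
def diagonal : DGBimod B B :=
  have hk : ∀ (b : B) (x : envBimod φ), (mulMap φ).1 x = 0 → (mulMap φ).1 (b • x) = 0 :=
    fun b x h => by
      rw [mulMap_smul]
      exact (congrArg (AddMonoidHom.mulLeft b) h).trans (mul_zero b)
  letI : Module B (DGMod.ker (mulMap φ)) :=
    { smul := fun b x => ⟨b • (x.1 : envBimod φ), hk b x.1 x.2⟩
      one_smul := fun x => Subtype.ext (one_smul B (x.1 : envBimod φ))
      mul_smul := fun a b x => Subtype.ext (mul_smul a b (x.1 : envBimod φ))
      smul_zero := fun a => Subtype.ext (smul_zero (A := envBimod φ) a)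
      smul_add := fun a x y => Subtype.ext (smul_add a (x.1 : envBimod φ) y.1)
      add_smul := fun a b x => Subtype.ext (add_smul a b (x.1 : envBimod φ))
      zero_smul := fun x => Subtype.ext (zero_smul B (x.1 : envBimod φ)) }
  { toDGMod := DGMod.ker (mulMap φ)
    smulComm := ⟨fun a b x => Subtype.ext (smul_comm a b (x.1 : envBimod φ))⟩
    left_smul_mem := fun i j a x ha hx => (envBimod φ).left_smul_mem i j a x.1 ha hx
    left_leibniz := fun n a x ha => Subtype.ext ((envBimod φ).left_leibniz n a x.1 ha) }

/-- The shift `Σ J` of the diagonal ideal. -/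
abbrev suspDiagonal : DGBimod B B := (diagonal φ).susp

/-- The universal derivation `δ : B → J`, `δ b = b ⊗ 1 - 1 ⊗ b`. -/
def univDer (b : B) : diagonal φ :=
  ⟨emul φ b 1 - emul φ 1 b, by
    refine (map_sub (mulMap φ).1 _ _).trans ?_
    rw [mulMap_emul, mulMap_emul, mul_one, one_mul]
    exact sub_self b⟩

/-- The element `Σ (δ b)` of `Σ J`. -/
def sder (b : B) : suspDiagonal φ := univDer φ b

end Diagonal

/-! ## Tensor graded DG modules over the diagonal tensor algebra -/

section TensorGraded

open DGMod

variable {A B : DGAlg.{u} R}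

/-- A tensor graded DG module over the tensor algebra `T` of `Σ J` over `B`: a DG `B`-module with a
second (tensor) grading by DG submodules, and an action of `Σ J` of tensor degree one. -/
structure TGMod (φ : DGAlg.Hom A B) extends DGMod B where
  tdeg : ℤ → AddSubgroup carrier
  [tgraded : DirectSum.Decomposition tdeg]
  tdeg_smul : ∀ i (b : B) x, x ∈ tdeg i → op b • x ∈ tdeg i
  tdeg_d : ∀ i x, x ∈ tdeg i → d x ∈ tdeg i
  tdeg_proj : ∀ i n x, x ∈ tdeg i → proj deg n x ∈ tdeg i
  act : dgHom (toDGMod.tensor (suspDiagonal φ)) toDGMod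
  tdeg_act : ∀ i x (c : suspDiagonal φ), x ∈ tdeg i → act.1 (tmul x c) ∈ tdeg (i + 1)

namespace TGMod

attribute [instance] TGMod.tgraded

variable {φ : DGAlg.Hom A B}

instance : CoeSort (TGMod φ) (Type u) := ⟨fun M => M.carrier⟩

/-- A `B`-linear map which is `T`-linear and homogeneous of tensor degree `n`. -/
structure IsTLinear {M N : TGMod φ} (n : ℤ) (f : M.toDGMod →ₗ[Bᵐᵒᵖ] N.toDGMod) : Prop where
  map_act : ∀ x (c : suspDiagonal φ), f (M.act.1 (tmul x c)) = N.act.1 (tmul (f x) c)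
  map_tdeg : ∀ i x, x ∈ M.tdeg i → f x ∈ N.tdeg (i + n)

section

variable {M N P : TGMod φ} {n m : ℤ}

lemma IsTLinear.zero : IsTLinear n (0 : M.toDGMod →ₗ[Bᵐᵒᵖ] N.toDGMod) :=
  ⟨fun x c => by simp [zero_tmul], fun _ _ _ => zero_mem _⟩

lemma IsTLinear.add {f g : M.toDGMod →ₗ[Bᵐᵒᵖ] N.toDGMod} (hf : IsTLinear n f)
    (hg : IsTLinear n g) : IsTLinear n (f + g) :=
  ⟨fun x c => by
    rw [LinearMap.add_apply, LinearMap.add_apply, add_tmul, map_add, hf.1, hg.1],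
    fun i x hx => add_mem (hf.2 i x hx) (hg.2 i x hx)⟩

lemma IsTLinear.neg {f : M.toDGMod →ₗ[Bᵐᵒᵖ] N.toDGMod} (hf : IsTLinear n f) :
    IsTLinear n (-f) :=
  ⟨fun x c => by rw [LinearMap.neg_apply, LinearMap.neg_apply, neg_tmul, map_neg, hf.1],
    fun i x hx => neg_mem (hf.2 i x hx)⟩

lemma IsTLinear.comp {g : N.toDGMod →ₗ[Bᵐᵒᵖ] P.toDGMod} {f : M.toDGMod →ₗ[Bᵐᵒᵖ] N.toDGMod}
    (hg : IsTLinear m g) (hf : IsTLinear n f) : IsTLinear (n + m) (g ∘ₗ f) :=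
  ⟨fun x c => by rw [LinearMap.comp_apply, LinearMap.comp_apply, hf.1, hg.1],
    fun i x hx => by rw [← add_assoc]; exact hg.2 _ _ (hf.2 i x hx)⟩

end

/-- The group `Hom_{C^gr(T)}(M, N[n])`. -/
def tgHom (M N : TGMod φ) (n : ℤ) : AddSubgroup (M.toDGMod →ₗ[Bᵐᵒᵖ] N.toDGMod) where
  carrier := {f | f ∈ dgHom M.toDGMod N.toDGMod ∧ IsTLinear n f}
  zero_mem' := ⟨zero_mem _, .zero⟩
  add_mem' := fun hf hg => ⟨add_mem hf.1 hg.1, hf.2.add hg.2⟩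
  neg_mem' := fun hf => ⟨neg_mem hf.1, hf.2.neg⟩

/-- The subgroup of those elements of `Hom_{C^gr(T)}(M, N[n])` which are null-homotopic through a
`T`-linear homotopy preserving the tensor grading. -/
def tgNull (M N : TGMod φ) (n : ℤ) : AddSubgroup (M.toDGMod →ₗ[Bᵐᵒᵖ] N.toDGMod) where
  carrier := {f | f ∈ tgHom M N n ∧
    ∃ h : M.toDGMod →ₗ[Bᵐᵒᵖ] N.toDGMod, IsHomotopy f h ∧ IsTLinear n h}
  zero_mem' := ⟨zero_mem _, 0, .zero, .zero⟩
  add_mem' := fun ⟨a, _, hf, hf'⟩ ⟨b, _, hg, hg'⟩ => ⟨add_mem a b, _, hf.add hg, hf'.add hg'⟩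
  neg_mem' := fun ⟨a, _, hf, hf'⟩ => ⟨neg_mem a, _, hf.neg, hf'.neg⟩

lemma tgHom_comp {M N P : TGMod φ} {n m : ℤ} {g : N.toDGMod →ₗ[Bᵐᵒᵖ] P.toDGMod}
    {f : M.toDGMod →ₗ[Bᵐᵒᵖ] N.toDGMod} (hg : g ∈ tgHom N P m) (hf : f ∈ tgHom M N n) :
    g ∘ₗ f ∈ tgHom M P (n + m) := ⟨comp_mem hg.1 hf.1, hg.2.comp hf.2⟩

lemma tgNull_comp_left {M N P : TGMod φ} {n m : ℤ} {g : N.toDGMod →ₗ[Bᵐᵒᵖ] P.toDGMod}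
    {f : M.toDGMod →ₗ[Bᵐᵒᵖ] N.toDGMod} (hg : g ∈ tgHom N P m) (hf : f ∈ tgNull M N n) :
    g ∘ₗ f ∈ tgNull M P (n + m) :=
  ⟨tgHom_comp hg hf.1, by
    obtain ⟨-, h, h1, h2⟩ := hf
    exact ⟨_, h1.comp_left hg.1, hg.2.comp h2⟩⟩

lemma tgNull_comp_right {M N P : TGMod φ} {n m : ℤ} {g : N.toDGMod →ₗ[Bᵐᵒᵖ] P.toDGMod}
    {f : M.toDGMod →ₗ[Bᵐᵒᵖ] N.toDGMod} (hg : g ∈ tgNull N P m) (hf : f ∈ tgHom M N n) :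
    g ∘ₗ f ∈ tgNull M P (n + m) :=
  ⟨tgHom_comp hg.1 hf, by
    obtain ⟨-, h, h1, h2⟩ := hg
    exact ⟨_, h1.comp_right hf.1, h2.comp hf.2⟩⟩

/-- The product of two sums of graded pieces lies in a sum of graded pieces. -/
lemma mul_mem_iSup {E : Type*} [Ring E] {P Q S : ℤ → AddSubgroup E}
    (h : ∀ n m f g, f ∈ P n → g ∈ Q m → f * g ∈ S (m + n)) {f g : E} (hf : f ∈ ⨆ n, P n)
    (hg : g ∈ ⨆ n, Q n) : f * g ∈ ⨆ n, S n := by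
  induction hf using AddSubgroup.iSup_induction' with
  | hp n f hf =>
    induction hg using AddSubgroup.iSup_induction' with
    | hp m g hg => exact AddSubgroup.mem_iSup_of_mem _ (h n m f g hf hg)
    | h1 => rw [mul_zero]; exact zero_mem _
    | hadd x y _ _ hx hy => rw [mul_add]; exact add_mem hx hy
  | h1 => rw [zero_mul]; exact zero_mem _
  | hadd x y _ _ hx hy => rw [add_mul]; exact add_mem hx hy

/-- The endomorphisms of tensor degree `n`, inside the ring of all `B`-linear endomorphisms. -/
def endDeg (M : TGMod φ) (n : ℤ) : AddSubgroup (Module.End Bᵐᵒᵖ M.toDGMod) := tgHom M M n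

/-- The null-homotopic endomorphisms of tensor degree `n`. -/
def endNull (M : TGMod φ) (n : ℤ) : AddSubgroup (Module.End Bᵐᵒᵖ M.toDGMod) := tgNull M M n

lemma deg_mul (M : TGMod φ) (n m : ℤ) (f g : Module.End Bᵐᵒᵖ M.toDGMod) (hf : f ∈ endDeg M n)
    (hg : g ∈ endDeg M m) : f * g ∈ endDeg M (m + n) := tgHom_comp hf hg

lemma null_mul (M : TGMod φ) (n m : ℤ) (f g : Module.End Bᵐᵒᵖ M.toDGMod) (hf : f ∈ endNull M n)
    (hg : g ∈ endDeg M m) : f * g ∈ endNull M (m + n) := tgNull_comp_right hf hg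

lemma mul_null (M : TGMod φ) (n m : ℤ) (f g : Module.End Bᵐᵒᵖ M.toDGMod) (hf : f ∈ endDeg M n)
    (hg : g ∈ endNull M m) : f * g ∈ endNull M (m + n) := tgNull_comp_left hf hg

/-- The ring `⊕_n Hom_{C^gr(T)}(M, M[n])`: the finite sums of tensor graded endomorphisms of
arbitrary tensor degrees. -/
def endRing (M : TGMod φ) : Subring (Module.End Bᵐᵒᵖ M.toDGMod) where
  carrier := (⨆ n, endDeg M n : AddSubgroup (Module.End Bᵐᵒᵖ M.toDGMod))
  add_mem' := add_mem
  zero_mem' := zero_mem _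
  neg_mem' := neg_mem
  mul_mem' hf hg := mul_mem_iSup (S := endDeg M) (deg_mul M) hf hg
  one_mem' := AddSubgroup.mem_iSup_of_mem 0
    ⟨id_mem _, fun _ _ => rfl, fun i x hx => by rw [add_zero]; exact hx⟩

/-- The homotopy relation: two elements are identified if they differ by an element of
`⊕_n endNull M n`. -/
def htpyCon (M : TGMod φ) : RingCon (endRing M) where
  r f g := f.1 - g.1 ∈ (⨆ n, endNull M n : AddSubgroup (Module.End Bᵐᵒᵖ M.toDGMod))
  iseqv :=
    { refl := fun f => by rw [sub_self]; exact zero_mem _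
      symm := fun h => by rw [← neg_sub]; exact neg_mem h
      trans := fun h k => by rw [← sub_add_sub_cancel]; exact add_mem h k }
  add' := fun {a b c d} h k => by
    have := add_mem h k
    rwa [sub_add_sub_comm] at this
  mul' := fun {a b c d} h k => by
    have e : (a * c).1 - (b * d).1 = (a.1 - b.1) * c.1 + b.1 * (c.1 - d.1) := by
      change a.1 * c.1 - b.1 * d.1 = _
      rw [sub_mul, mul_sub, sub_add_sub_cancel]
    rw [e]
    exact add_mem (mul_mem_iSup (S := endNull M) (null_mul M) h c.2)
      (mul_mem_iSup (S := endNull M) (mul_null M) b.2 k)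

/-- The graded endomorphism ring `Γ_M = ⊕_n Hom_{K^gr(T)}(M, M[n])`. -/
abbrev Gam (M : TGMod φ) : Type u := (htpyCon M).Quotient

/-- The class in `Γ_M` of a tensor graded endomorphism of tensor degree `n`. -/
def toGam (M : TGMod φ) (n : ℤ) : endDeg M n →+ Gam M :=
  (htpyCon M).mk'.toAddMonoidHom.comp
    (AddMonoidHom.mk' (fun f => (⟨f.1, AddSubgroup.mem_iSup_of_mem n f.2⟩ : endRing M))
      (fun _ _ => rfl))

/-- The component `Γ_M^n = Hom_{K^gr(T)}(M, M[n])` of `Γ_M`. -/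
def gamDeg (M : TGMod φ) (n : ℤ) : AddSubgroup (Gam M) := (toGam M n).range

end TGMod

/-! ### The tensor graded DG module `N ⊗_B T` -/

variable (φ : DGAlg.Hom A B) (N : DGMod B)

/-- `N ⊗_B T^i = N ⊗_B (Σ J)^{⊗ i}`, bracketed from the left. -/
def tensorPow : ℕ → DGMod B
  | 0 => N
  | i + 1 => (tensorPow i).tensor (suspDiagonal φ)

lemma directSum_deg_induct {ι : Type} [DecidableEq ι] {X : ι → DGMod B} {n : ℤ}
    {p : directSum X → Prop} (zero : p 0)
    (of : ∀ i x, x ∈ (X i).deg n → p (DirectSum.of (fun i => (X i).carrier) i x))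
    (add : ∀ x y, p x → p y → p (x + y)) {x : directSum X} (hx : x ∈ (directSum X).deg n) :
    p x := by
  classical
  have e := DirectSum.sum_support_of (β := fun i => (X i).carrier) x
  rw [← e]
  exact Finset.sum_induction _ p add zero fun i _ => of i _ (hx i)

/-- The inclusion of `N ⊗_B T^i`. -/
def tensorTOf (i : ℕ) : tensorPow φ N i →ₗ[Bᵐᵒᵖ] directSum (tensorPow φ N) :=
  DirectSum.lof Bᵐᵒᵖ ℕ (fun i => tensorPow φ N i) i

variable {φ N} in
lemma tensorT_induct {p : directSum (tensorPow φ N) → Prop} (of : ∀ i x, p (tensorTOf φ N i x))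
    (add : ∀ x y, p x → p y → p (x + y)) (x : directSum (tensorPow φ N)) : p x := by
  refine DirectSum.induction_on (motive := p) x ?_ of add
  have := of 0 0
  rwa [map_zero] at this

lemma tensorTOf_mem (i : ℕ) : tensorTOf φ N i ∈ dgHom (tensorPow φ N i)
    (directSum (tensorPow φ N)) := by
  refine ⟨fun n x hx j => ?_, fun x => ?_⟩
  · change (DirectSum.of (fun i => tensorPow φ N i) i x) j ∈ _
    by_cases h : i = j
    · subst h; rwa [DirectSum.of_eq_same]
    · rw [DirectSum.of_eq_of_ne _ _ _ (Ne.symm h)]; exact zero_mem _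
  · exact (DirectSum.map_of (fun i => (tensorPow φ N i).d) i x).symm

/-- The inclusion of `(N ⊗_B T^i) ⊗_B Σ J = N ⊗_B T^{i+1}`. -/
def tensorTNext (i : ℕ) :
    (tensorPow φ N i).tensor (suspDiagonal φ) →ₗ[Bᵐᵒᵖ] directSum (tensorPow φ N) :=
  tensorTOf φ N (i + 1)

lemma tensorTNext_mem (i : ℕ) : tensorTNext φ N i ∈
    dgHom ((tensorPow φ N i).tensor (suspDiagonal φ)) (directSum (tensorPow φ N)) :=
  tensorTOf_mem φ N (i + 1)

/-- The action of `Σ J` on `⊕_i N ⊗_B T^i` as a biadditive map. -/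
def tensorTBi : directSum (tensorPow φ N) →+ suspDiagonal φ →+ directSum (tensorPow φ N) :=
  DirectSum.toAddMonoid (β := fun i => (tensorPow φ N i).carrier) fun i =>
    AddMonoidHom.mk' (fun x => AddMonoidHom.mk'
        (fun c : suspDiagonal φ => tensorTNext φ N i (tmul x c))
        (fun c c' => by rw [tmul_add, map_add]))
      (fun x y => by
        ext c
        simp only [AddMonoidHom.mk'_apply, AddMonoidHom.add_apply, add_tmul, map_add])

lemma tensorTBi_of (i : ℕ) (x : tensorPow φ N i) (c : suspDiagonal φ) :
    tensorTBi φ N (tensorTOf φ N i x) c = tensorTNext φ N i (tmul x c) :=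
  DFunLike.congr_fun (DirectSum.toAddMonoid_of
    (β := fun i => (tensorPow φ N i).carrier) _ i x) c

/-- The additive map underlying the action of `Σ J` on `⊕_i N ⊗_B T^i`. -/
def tensorTActAux :
    (directSum (tensorPow φ N)).tensor (suspDiagonal φ) →+ directSum (tensorPow φ N) :=
  BTensor.lift (S := B) (M := directSum (tensorPow φ N)) (L := suspDiagonal φ)
    (tensorTBi φ N) (fun m b l => by
      induction m using tensorT_induct with
      | of i x => rw [← map_smul, tensorTBi_of, tensorTBi_of, smul_tmul]
      | add x y hx hy =>
        simp only [smul_add, map_add, AddMonoidHom.add_apply, hx, hy])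

lemma tensorTActAux_of (i : ℕ) (x : tensorPow φ N i) (c : suspDiagonal φ) :
    tensorTActAux φ N (tmul (tensorTOf φ N i x) c) = tensorTNext φ N i (tmul x c) :=
  tensorTBi_of φ N i x c

/-- The sum of the components of `⊕_i N ⊗_B T^i` with index `n`, as a projection. -/
def tensorTProj (n : ℤ) : directSum (tensorPow φ N) →+ directSum (tensorPow φ N) :=
  DFinsupp.filterAddMonoidHom (fun i => (tensorPow φ N i).carrier) fun i => (i : ℤ) = n

/-- The component of tensor degree `n` of `N ⊗_B T`: it is `N ⊗_B T^n` for `n ≥ 0` and zero for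
`n < 0`. -/
def tensorTDeg (n : ℤ) : AddSubgroup (directSum (tensorPow φ N)) where
  carrier := {x : ⨁ i, tensorPow φ N i | ∀ i : ℕ, (i : ℤ) ≠ n → x i = 0}
  zero_mem' := fun _ _ => rfl
  add_mem' := fun {x y} hx hy i hi => by
    refine (DirectSum.add_apply (β := fun i => (tensorPow φ N i).carrier) x y i).trans ?_
    rw [hx i hi, hy i hi, add_zero]
  neg_mem' := fun {x} hx i hi => by
    exact (congrArg (- ·) (hx i hi)).trans neg_zero

lemma tensorTOf_tdeg (i : ℕ) (x : tensorPow φ N i) : tensorTOf φ N i x ∈ tensorTDeg φ N i :=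
  fun j hj => DirectSum.of_eq_of_ne (β := fun i => (tensorPow φ N i).carrier) i j x
    (fun h => hj (by rw [h]))

lemma tensorTDeg_induct {n : ℤ} {p : directSum (tensorPow φ N) → Prop} (zero : p 0)
    (of : ∀ (i : ℕ) x, (i : ℤ) = n → p (tensorTOf φ N i x))
    (add : ∀ x y, p x → p y → p (x + y)) {x : directSum (tensorPow φ N)}
    (hx : x ∈ tensorTDeg φ N n) : p x := by
  have h : ∀ y, p (tensorTProj φ N n y) := fun y => by
    induction y using tensorT_induct with
    | of i x =>
      by_cases h : (i : ℤ) = n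
      · have e : tensorTProj φ N n (tensorTOf φ N i x) = tensorTOf φ N i x :=
          DFinsupp.filter_single_pos (β := fun i => (tensorPow φ N i).carrier) _ x h
        rw [e]
        exact of i x h
      · have e : tensorTProj φ N n (tensorTOf φ N i x) = 0 :=
          DFinsupp.filter_single_neg (β := fun i => (tensorPow φ N i).carrier) _ x h
        rw [e]
        exact zero
    | add x y hx hy => rw [map_add]; exact add _ _ hx hy
  have e : tensorTProj φ N n x = x := by
    refine DFinsupp.ext fun i => ?_
    refine (DFinsupp.filter_apply (β := fun i => (tensorPow φ N i).carrier)
      (fun i : ℕ => (i : ℤ) = n) i x).trans ?_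
    split_ifs with hi
    · rfl
    · exact (hx i hi).symm
  rw [← e]
  exact h x

/-- The tensor graded DG `T`-module `N ⊗_B T = ⊕_{i ≥ 0} N ⊗_B T^i`, where
`(N ⊗_B T^i) ⊗_B Σ J → N ⊗_B T^{i+1}` is the identity. -/
def tensorT : TGMod φ where
  toDGMod := directSum (tensorPow φ N)
  tdeg := tensorTDeg φ N
  tgraded := ofProj _ (tensorTProj φ N)
    (fun n x hx => by
      refine DFinsupp.ext fun i => ?_
      refine (DFinsupp.filter_apply (β := fun i => (tensorPow φ N i).carrier)
        (fun i : ℕ => (i : ℤ) = n) i x).trans ?_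
      split_ifs with hi
      · rfl
      · exact (hx i hi).symm)
    (fun n m x hx h => by
      refine DFinsupp.ext fun i => ?_
      refine (DFinsupp.filter_apply (β := fun i => (tensorPow φ N i).carrier)
        (fun i : ℕ => (i : ℤ) = m) i x).trans ?_
      split_ifs with hi
      · exact hx i (by omega)
      · rfl)
    (fun x => by
      induction x using tensorT_induct with
      | of i x => exact AddSubgroup.mem_iSup_of_mem (i : ℤ) (tensorTOf_tdeg φ N i x)
      | add x y hx hy => exact add_mem hx hy)
  tdeg_smul n b x hx i hi := (congrArg (op b • ·) (hx i hi)).trans (smul_zero _)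
  tdeg_d n x hx i hi := (congrArg (tensorPow φ N i).d (hx i hi)).trans (map_zero _)
  tdeg_proj n m x hx := by
    refine tensorTDeg_induct φ N (p := fun x => proj (directSum (tensorPow φ N)).deg m x ∈
      tensorTDeg φ N n) ?_ (fun i x hi => ?_) (fun x y hx hy => ?_) hx
    · rw [map_zero]; exact zero_mem _
    · induction x using induct (tensorPow φ N i).deg with
      | hom k x hx =>
        have h := (tensorTOf_mem φ N i).1 k x hx
        by_cases hk : k = m
        · subst hk
          rw [proj_same _ h, ← hi]
          exact tensorTOf_tdeg φ N i x
        · rw [proj_ne _ h hk]; exact zero_mem _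
      | add x y hx hy => rw [map_add, map_add]; exact add_mem hx hy
    · rw [map_add]; exact add_mem hx hy
  act :=
    ⟨{ tensorTActAux φ N with
        map_smul' := fun b x => by
          change tensorTActAux φ N (b • x) = b • tensorTActAux φ N x
          induction x using induct_tmul with
          | tmul m c =>
            induction m using tensorT_induct with
            | of i x =>
              rw [op_smul_tmul, tensorTActAux_of, tensorTActAux_of, ← op_smul_tmul, map_smul]
            | add x y hx hy => simp only [add_tmul, smul_add, map_add, hx, hy]
          | add x y hx hy => simp only [smul_add, map_add, hx, hy] },
      fun n x hx => by
        change x ∈ tensorDeg _ _ n at hx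
        change tensorTActAux φ N x ∈ (directSum (tensorPow φ N)).deg n
        induction hx using AddSubgroup.closure_induction with
        | mem x hx =>
          obtain ⟨i, j, m, c, hm, hc, rfl, rfl⟩ := hx
          change tensorTActAux φ N (tmul m c) ∈ (directSum (tensorPow φ N)).deg (i + j)
          refine directSum_deg_induct (p := fun m => tensorTActAux φ N (tmul m c) ∈
            (directSum (tensorPow φ N)).deg (i + j)) ?_ (fun k y hy => ?_) (fun x y hx hy => ?_) hm
          · rw [zero_tmul, map_zero]; exact zero_mem _
          · have e := tensorTActAux_of φ N k y c
            change tensorTActAux φ N (tmul (tensorTOf φ N k y) c) ∈ _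
            rw [e]
            exact (tensorTNext_mem φ N k).1 _ _ (tmul_mem_deg hy hc)
          · rw [add_tmul, map_add]; exact add_mem hx hy
        | zero => exact (map_zero (tensorTActAux φ N)).symm ▸ zero_mem _
        | add x y _ _ hx hy => exact (map_add (tensorTActAux φ N) x y).symm ▸ add_mem hx hy
        | neg x _ hx => exact (map_neg (tensorTActAux φ N) x).symm ▸ neg_mem hx,
      fun x => by
        change tensorTActAux φ N _ = (directSum (tensorPow φ N)).d (tensorTActAux φ N x)
        induction x using induct_tmul with
        | tmul m c =>
          induction m using tensorT_induct with
          | of i x =>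
            have h := (tensorTOf_mem φ N i)
            rw [d_tmul, map_add, ← h.2, map_sgn (k := 0) _ (by simpa using h.1),
              Int.negOnePow_zero, one_smul, tensorTActAux_of, tensorTActAux_of, tensorTActAux_of,
              ← (tensorTNext_mem φ N i).2, ← map_add, d_tmul]
          | add x y hx hy => simp only [add_tmul, map_add] at hx hy ⊢; rw [hx, hy]
        | add x y hx hy => simp only [map_add, hx, hy]⟩
  tdeg_act n x c hx := by
    change tensorTActAux φ N (tmul x c) ∈ tensorTDeg φ N (n + 1)
    refine tensorTDeg_induct φ N (p := fun x => tensorTActAux φ N (tmul x c) ∈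
      tensorTDeg φ N (n + 1)) ?_ (fun i x hi => ?_) (fun x y hx hy => ?_) hx
    · rw [zero_tmul, map_zero]; exact zero_mem _
    · rw [tensorTActAux_of, ← hi]
      exact_mod_cast tensorTOf_tdeg φ N (i + 1) (tmul x c : (tensorPow φ N i).tensor _)
    · rw [add_tmul, map_add]; exact add_mem hx hy

end TensorGraded

/-! ### The ring homomorphism `End_{K(B)}(N) → Γ_{N ⊗_B T}` -/

section Extension

open DGMod

variable {A B : DGAlg.{u} R} (φ : DGAlg.Hom A B) {N : DGMod B}

/-- The map induced on `N ⊗_B T^i` by an endomorphism of `N`. -/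
def endPow (f : Module.End Bᵐᵒᵖ N) : ∀ i, Module.End Bᵐᵒᵖ (tensorPow φ N i)
  | 0 => f
  | i + 1 => tensorMap (endPow f i) (suspDiagonal φ)

/-- The map `f ⊗ id_T` on `N ⊗_B T`. -/
def endT (f : Module.End Bᵐᵒᵖ N) : Module.End Bᵐᵒᵖ (tensorT φ N).toDGMod :=
  DirectSum.lmap (R := Bᵐᵒᵖ) (fun i => endPow φ f i)

lemma endT_of (f : Module.End Bᵐᵒᵖ N) (i : ℕ) (x : tensorPow φ N i) :
    endT φ f (tensorTOf φ N i x) = tensorTOf φ N i (endPow φ f i x) :=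
  DirectSum.lmap_lof (R := Bᵐᵒᵖ) (M := fun i => (tensorPow φ N i).carrier)
    (N := fun i => (tensorPow φ N i).carrier) (fun i => endPow φ f i) i x

lemma tensorT_hom_ext {P : DGMod B} {f g : (tensorT φ N).toDGMod →ₗ[Bᵐᵒᵖ] P}
    (h : ∀ i x, f (tensorTOf φ N i x) = g (tensorTOf φ N i x)) : f = g := by
  ext x
  induction x using tensorT_induct with
  | of i x => exact h i x
  | add x y hx hy => exact (map_add f x y).trans ((congrArg₂ _ hx hy).trans (map_add g x y).symm)

lemma endPow_one (i : ℕ) : endPow φ (1 : Module.End Bᵐᵒᵖ N) i = 1 := by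
  induction i with
  | zero => rfl
  | succ i ih =>
    refine tensor_hom_ext fun m l => ?_
    change tmul (endPow φ 1 i m) l = tmul m l
    rw [ih]; rfl

lemma endPow_mul (f g : Module.End Bᵐᵒᵖ N) (i : ℕ) :
    endPow φ (f * g) i = endPow φ f i * endPow φ g i := by
  induction i with
  | zero => rfl
  | succ i ih =>
    refine tensor_hom_ext fun m l => ?_
    change tmul (endPow φ (f * g) i m) l = tmul (endPow φ f i (endPow φ g i m)) l
    rw [ih]; rfl

lemma endPow_add (f g : Module.End Bᵐᵒᵖ N) (i : ℕ) :
    endPow φ (f + g) i = endPow φ f i + endPow φ g i := by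
  induction i with
  | zero => rfl
  | succ i ih =>
    refine tensor_hom_ext fun m l => ?_
    change tmul (endPow φ (f + g) i m) l = tmul (endPow φ f i m) l + tmul (endPow φ g i m) l
    rw [ih, ← add_tmul]; rfl

/-- `f ↦ f ⊗ id_T` as a ring homomorphism on `B`-linear endomorphisms. -/
def endTHom : Module.End Bᵐᵒᵖ N →+* Module.End Bᵐᵒᵖ (tensorT φ N).toDGMod :=
  RingHom.mk' ⟨⟨endT φ, tensorT_hom_ext φ fun i x => by rw [endT_of, endPow_one]; rfl⟩,
    fun f g => tensorT_hom_ext φ fun i x => by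
      change _ = endT φ f (endT φ g (tensorTOf φ N i x))
      rw [endT_of, endT_of, endT_of, endPow_mul]; rfl⟩
    (fun f g => tensorT_hom_ext φ fun i x => by
      change endT φ (f + g) _ = endT φ f (tensorTOf φ N i x) + endT φ g (tensorTOf φ N i x)
      rw [endT_of, endT_of, endT_of, endPow_add]
      exact map_add (tensorTOf φ N i) _ _)

lemma endT_degree {f : Module.End Bᵐᵒᵖ N} {k : ℤ} (hf : ∀ n x, x ∈ N.deg n → f x ∈ N.deg (n + k))
    (n : ℤ) (x : (tensorT φ N).toDGMod) (hx : x ∈ (tensorT φ N).deg n) :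
    endT φ f x ∈ (tensorT φ N).deg (n + k) := by
  have h : ∀ i n x, x ∈ (tensorPow φ N i).deg n → endPow φ f i x ∈ (tensorPow φ N i).deg (n + k) := by
    intro i
    induction i with
    | zero => exact hf
    | succ i ih => exact tensorMap_degree (suspDiagonal φ) ih
  exact fun i => h i n _ (hx i)

lemma endT_tlinear (f : Module.End Bᵐᵒᵖ N) :
    TGMod.IsTLinear (M := tensorT φ N) (N := tensorT φ N) 0 (endT φ f) := by
  refine ⟨fun x c => ?_, fun n x hx i hi => ?_⟩
  · induction x using tensorT_induct with
    | of i x =>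
      change endT φ f (tensorTActAux φ N (tmul (tensorTOf φ N i x) c)) =
        tensorTActAux φ N (tmul (endT φ f (tensorTOf φ N i x)) c)
      rw [endT_of, tensorTActAux_of, tensorTActAux_of]
      exact endT_of φ f (i + 1) _
    | add x y hx hy =>
      have e := add_tmul (M := (tensorT φ N).toDGMod) x y c
      refine (congrArg (fun t => endT φ f ((tensorT φ N).act.1 t)) e).trans ?_
      simp only [map_add]
      rw [hx, hy, ← map_add, ← add_tmul]
      exact congrArg (fun t => (tensorT φ N).act.1 (tmul t c)) (map_add (endT φ f) x y).symm
  · exact (congrArg (endPow φ f i) (hx i (by omega))).trans (map_zero _)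

lemma endPow_mem {f : Module.End Bᵐᵒᵖ N} (hf : f ∈ dgHom N N) (i : ℕ) :
    endPow φ f i ∈ dgHom (tensorPow φ N i) (tensorPow φ N i) := by
  induction i with
  | zero => exact hf
  | succ i ih => exact tensorMap_mem (suspDiagonal φ) ih

lemma endPow_htpy {f h : Module.End Bᵐᵒᵖ N} (hf : IsHomotopy f h) (i : ℕ) :
    IsHomotopy (endPow φ f i) (endPow φ h i) := by
  induction i with
  | zero => exact hf
  | succ i ih => exact tensorMap_htpy (suspDiagonal φ) ih

lemma endT_mem {f : Module.End Bᵐᵒᵖ N} (hf : f ∈ dgHom N N) :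
    endT φ f ∈ TGMod.endDeg (tensorT φ N) 0 := by
  refine ⟨⟨fun n x hx i => (endPow_mem φ hf i).1 n _ (hx i), fun x => ?_⟩, endT_tlinear φ f⟩
  refine DFinsupp.ext fun i => ?_
  exact (endPow_mem φ hf i).2 _

lemma endT_null {f h : Module.End Bᵐᵒᵖ N} (hf : f ∈ dgHom N N) (hh : IsHomotopy f h) :
    endT φ f ∈ TGMod.endNull (tensorT φ N) 0 := by
  refine ⟨endT_mem φ hf, endT φ h, ⟨endT_degree φ hh.1, fun x => ?_⟩, endT_tlinear φ h⟩
  refine DFinsupp.ext fun i => ?_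
  exact (endPow_htpy φ hh i).2 _

/-- The natural ring homomorphism `End_{K(B)}(N) → Γ_{N ⊗_B T}`, `[f] ↦ [f ⊗ id_T]`. -/
def endToGam (N : DGMod B) : EndK N →+* TGMod.Gam (tensorT φ N) :=
  (DGMod.htpyCon N).lift
    ((TGMod.htpyCon (tensorT φ N)).mk'.comp
      (((endTHom φ).comp (dgEnd N).subtype).codRestrict (TGMod.endRing (tensorT φ N))
        (fun f => AddSubgroup.mem_iSup_of_mem 0 (endT_mem φ f.2))))
    (fun f g h => by
      obtain ⟨h, hh⟩ := h
      refine (RingCon.eq _).2 ?_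
      change endT φ f.1 - endT φ g.1 ∈ _
      have e : endT φ f.1 - endT φ g.1 = endT φ (f.1 - g.1) :=
        (map_sub (endTHom φ) f.1 g.1).symm
      rw [e]
      exact AddSubgroup.mem_iSup_of_mem 0 (endT_null φ (sub_mem (H := dgHom N N) f.2 g.2) hh))

end Extension

/-! ## Semifree and perfect DG modules -/

section Semifree

open DGMod

variable {A B : DGAlg.{u} R}

/-- A semifree basis of a DG module: a well-ordered homogeneous basis `e` of the underlying graded
module such that `d (e i)` is a combination of the `e j` with `j < i`. -/
structure SemifreeBasis (P : DGMod B) where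
  ι : Type u
  [order : LinearOrder ι]
  [wf : WellFoundedLT ι]
  basis : Module.Basis ι Bᵐᵒᵖ P
  degree : ι → ℤ
  mem_deg : ∀ i, basis i ∈ P.deg (degree i)
  d_lt : ∀ i j, basis.repr (P.d (basis i)) j ≠ 0 → j < i

attribute [instance] SemifreeBasis.order SemifreeBasis.wf

/-- The subgroup of cycles of degree `n`. -/
def DGMod.cycles (M : DGMod B) (n : ℤ) : AddSubgroup M := M.deg n ⊓ M.d.ker

/-- The subgroup of boundaries of degree `n`. -/
def DGMod.boundaries (M : DGMod B) (n : ℤ) : AddSubgroup M := (M.deg (n + 1)).map M.d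

/-- The homology group `H_n(M)`. -/
abbrev DGMod.homology (M : DGMod B) (n : ℤ) : Type u :=
  M.cycles n ⧸ (M.boundaries n).addSubgroupOf (M.cycles n)

/-- The map induced on cycles by a DG module homomorphism. -/
def DGMod.cyclesMap {M N : DGMod B} (f : dgHom M N) (n : ℤ) : M.cycles n →+ N.cycles n :=
  (f.1.toAddMonoidHom.comp (M.cycles n).subtype).codRestrict (N.cycles n) (fun x =>
    ⟨f.2.1 n _ x.2.1, by
      change N.d (f.1 x.1) = 0
      rw [← f.2.2, show M.d x.1 = 0 from x.2.2, map_zero]⟩)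

/-- The map induced on homology by a DG module homomorphism. -/
def DGMod.homologyMap {M N : DGMod B} (f : dgHom M N) (n : ℤ) : M.homology n →+ N.homology n :=
  QuotientAddGroup.map _ _ (cyclesMap f n) (by
    rintro x ⟨y, hy, hx⟩
    refine ⟨f.1 y, f.2.1 _ _ hy, ?_⟩
    rw [← f.2.2, hx]
    rfl)

/-- Quasi-isomorphisms: homomorphisms inducing bijections on all homology groups. -/
def DGMod.IsQuasiIso {M N : DGMod B} (f : dgHom M N) : Prop :=
  ∀ n, Function.Bijective (homologyMap f n)

/-- A DG module is perfect if it is quasi-isomorphic to a semifree one with a finite semifree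
basis. Semifree modules being K-projective, the quasi-isomorphism may be taken out of it. -/
def DGMod.IsPerfect (M : DGMod B) : Prop :=
  ∃ (F : DGMod B) (E : SemifreeBasis F) (f : dgHom F M), Finite E.ι ∧ IsQuasiIso f

/-- The category `C(B)` of DG modules. -/
instance : Category (DGMod B) where
  Hom M N := dgHom M N
  id M := ⟨LinearMap.id, id_mem M⟩
  comp f g := ⟨g.1 ∘ₗ f.1, comp_mem g.2 f.2⟩

/-- The class of quasi-isomorphisms. -/
def quasiIso (B : DGAlg.{u} R) : MorphismProperty (DGMod B) := fun _ _ f => IsQuasiIso f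

/-- The derived category `D(B)`: the localization of the category of DG modules at the
quasi-isomorphisms. -/
abbrev DerivedCat (B : DGAlg.{u} R) := (quasiIso B).Localization

/-- `N` is a direct summand in `D(B)` of a finite direct sum of copies of `B`. -/
def IsSummandOfFree (N : DGMod B) : Prop :=
  ∃ (n : ℕ) (N' : DGMod B), Nonempty ((quasiIso B).Q.obj (directSum ![N, N']) ≅
    (quasiIso B).Q.obj (directSum fun _ : Fin n => DGMod.self B))

end Semifree

/-! ## The morphism `ω_N` -/

section Omega

open DGMod

variable {A B : DGAlg.{u} R} (φ : DGAlg.Hom A B)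

lemma DGAlg.d_one (B : DGAlg.{u} R) : B.d 1 = 0 := by
  have h := B.leibniz 0 1 1 SetLike.GradedOne.one_mem
  simpa using h

lemma emul_d (x y : B) : (envBimod φ).d (emul φ x y) =
    emul φ (B.d x) y + emul φ (B.twist x) (B.d y) := by
  have h : ∀ x : DGMod.self B, sgn (DGMod.self B).deg x = (B.twist x : B) := fun x => by
    change _ = sgn (M := B) B.deg x
    induction x using induct (DGMod.self B).deg with
    | hom n x hx =>
      rw [sgn_of_mem (DGMod.self B).deg hx]
      exact (sgn_of_mem (M := B) B.deg (n := n) hx).symm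
    | add x y hx hy =>
      exact (map_add _ x y).trans ((congrArg₂ (· + ·) hx hy).trans (map_add (sgn (M := B) B.deg) x y).symm)
  exact congrArg (fun t : DGMod.self B => emul φ (B.d x) y + emul φ t (B.d y)) (h x)

lemma emul_add (x y y' : B) : emul φ x (y + y') = emul φ x y + emul φ x y' :=
  tmul_add (M := restrict φ (DGMod.self B)) (L := DGBimod.ofHom φ) x y y'

lemma add_emul (x x' y : B) : emul φ (x + x') y = emul φ x y + emul φ x' y :=
  add_tmul (M := restrict φ (DGMod.self B)) (L := DGBimod.ofHom φ) x x' y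

lemma emul_zero (x : B) : emul φ x 0 = 0 :=
  tmul_zero (M := restrict φ (DGMod.self B)) (L := DGBimod.ofHom φ) x

lemma zero_emul (x : B) : emul φ 0 x = 0 :=
  zero_tmul (M := restrict φ (DGMod.self B)) (L := DGBimod.ofHom φ) x

lemma sder_add (a b : B) : sder φ (a + b) = sder φ a + sder φ b := by
  refine Subtype.ext ?_
  change emul φ (a + b) 1 - emul φ 1 (a + b) =
    (emul φ a 1 - emul φ 1 a) + (emul φ b 1 - emul φ 1 b)
  rw [emul_add, add_emul]
  abel

lemma univDer_mul (a b : B) : univDer φ (a * b) = op b • univDer φ a + a • univDer φ b := by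
  refine Subtype.ext ?_
  change emul φ (a * b) 1 - emul φ 1 (a * b) =
    op b • (emul φ a 1 - emul φ 1 a) + a • (emul φ b 1 - emul φ 1 b)
  rw [smul_sub, smul_sub, op_smul_emul, op_smul_emul, smul_emul, smul_emul, one_mul, mul_one]
  abel

lemma sder_mul (a b : B) : sder φ (a * b) = op b • sder φ a + B.twist a • sder φ b := by
  have h : B.twist a • sder φ b = (B.twist (B.twist a) • univDer φ b : diagonal φ) := rfl
  rw [h, show B.twist (B.twist a) = a from sgn_sgn B.deg a]
  exact univDer_mul φ a b

lemma sder_d (b : B) : (suspDiagonal φ).d (sder φ b) = - sder φ (B.d b) := by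
  have h : (diagonal φ).d (univDer φ b) = univDer φ (B.d b) := by
    refine Subtype.ext ?_
    change (envBimod φ).d (emul φ b 1 - emul φ 1 b) = emul φ (B.d b) 1 - emul φ 1 (B.d b)
    rw [map_sub, emul_d, emul_d, B.d_one, map_one, emul_zero, zero_emul, add_zero, zero_add]
  change (Int.negOnePow 1) • (diagonal φ).d (univDer φ b) = - (univDer φ (B.d b) : diagonal φ)
  rw [h, Int.negOnePow_one, Units.neg_smul, one_smul]

lemma sder_mem {n : ℤ} {b : B} (hb : b ∈ B.deg n) : sder φ b ∈ (suspDiagonal φ).deg (n + 1) := by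
  change (emul φ b 1 - emul φ 1 b : envBimod φ) ∈ (envBimod φ).deg (n + 1 - 1)
  rw [add_sub_cancel_right]
  have h1 : (1 : B) ∈ B.deg 0 := SetLike.GradedOne.one_mem
  refine sub_mem ?_ ?_
  · have := tmul_mem_deg (M := restrict φ (DGMod.self B)) (L := DGBimod.ofHom φ) hb h1
    rwa [add_zero] at this
  · have := tmul_mem_deg (M := restrict φ (DGMod.self B)) (L := DGBimod.ofHom φ) h1 hb
    rwa [zero_add] at this

variable {N : DGMod B} (E : SemifreeBasis N)

/-- The additive map `∑ e_μ b_μ ↦ ∑ (-1)^|e_μ| e_μ ⊗ Σ (δ b_μ)`. -/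
def omegaPre : N →+ N.tensor (suspDiagonal φ) :=
  (Finsupp.liftAddHom fun μ => AddMonoidHom.mk'
    (fun b : Bᵐᵒᵖ => (E.degree μ).negOnePow • tmul (E.basis μ) (sder φ b.unop))
    (fun a b => by rw [MulOpposite.unop_add, sder_add, tmul_add, smul_add])).comp
  E.basis.repr.toLinearMap.toAddMonoidHom

lemma omegaPre_smul (μ : E.ι) (b : B) : omegaPre φ E (op b • E.basis μ) =
    (E.degree μ).negOnePow • tmul (E.basis μ) (sder φ b) := by
  have h : sder φ 0 = 0 := by simpa using sder_add φ 0 0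
  simp only [omegaPre, AddMonoidHom.comp_apply]
  change Finsupp.liftAddHom _ (E.basis.repr (op b • E.basis μ)) = _
  rw [map_smul, Module.Basis.repr_self, Finsupp.smul_single, smul_eq_mul, mul_one,
    Finsupp.liftAddHom_apply_single]
  rfl

variable {E} in
lemma SemifreeBasis.induct {p : N → Prop} (zero : p 0) (smul : ∀ μ (b : B), p (op b • E.basis μ))
    (add : ∀ x y, p x → p y → p (x + y)) (x : N) : p x := by
  rw [← E.basis.linearCombination_repr x]
  induction E.basis.repr x using Finsupp.induction_linear with
  | zero => simpa using zero
  | add f g hf hg => rw [map_add]; exact add _ _ hf hg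
  | single i b => simpa using smul i b.unop

lemma omegaPre_mul (x : N) (b : B) : omegaPre φ E (op b • x) =
    op b • omegaPre φ E x + tmul (sgn N.deg x) (sder φ b) := by
  induction x using SemifreeBasis.induct (E := E) with
  | zero => simp [zero_tmul]
  | smul μ a =>
    rw [smul_smul, ← MulOpposite.op_mul, omegaPre_smul, omegaPre_smul, sder_mul, tmul_add,
      ← smul_tmul, N.sgn_smul, sgn_of_mem _ (E.mem_deg μ), smul_add, smul_comm (op b),
      op_smul_tmul]
    rcases Int.even_or_odd (E.degree μ) with h | h
    · simp [Int.negOnePow_even _ h]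
    · simp [Int.negOnePow_odd _ h, neg_tmul]
  | add x y hx hy => simp only [smul_add, map_add, hx, hy, add_tmul]; abel

lemma omegaPre_proj (n : ℤ) (x : N) : omegaPre φ E (proj N.deg n x) =
    proj (N.tensor (suspDiagonal φ)).deg (n + 1) (omegaPre φ E x) := by
  induction x using SemifreeBasis.induct (E := E) with
  | zero => simp
  | smul μ a =>
    induction a using induct B.deg with
    | hom k a ha =>
      have h1 := N.smul_mem _ _ _ a (E.mem_deg μ) ha
      have h2 : omegaPre φ E (op a • E.basis μ) ∈
          (N.tensor (suspDiagonal φ)).deg (E.degree μ + (k + 1)) := by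
        have h := tmul_mem_deg (E.mem_deg μ) (sder_mem φ ha)
        rw [omegaPre_smul]
        rcases Int.even_or_odd (E.degree μ) with h' | h'
        · simpa [Int.negOnePow_even _ h'] using h
        · simpa [Int.negOnePow_odd _ h'] using h
      by_cases h : E.degree μ + k = n
      · subst h
        rw [proj_same _ h1, proj_same _ (by rwa [add_assoc])]
      · rw [proj_ne _ h1 h, proj_ne _ h2 (by omega), map_zero]
    | add a b ha hb => simp only [MulOpposite.op_add, add_smul, map_add, ha, hb]
  | add x y hx hy => simp only [map_add, hx, hy]

lemma omegaPre_mem {n : ℤ} {x : N} (hx : x ∈ N.deg n) :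
    omegaPre φ E x ∈ (N.tensor (suspDiagonal φ)).deg (n + 1) := by
  rw [← proj_same _ hx, omegaPre_proj]
  exact proj_mem _ _ _

/-- The `B`-linear map `N → N ⊗_B Σ J` which sends a basis element `e` with `d e = ∑ e_μ b_μ` to
`∑ (-1)^|e_μ| e_μ ⊗ Σ (δ b_μ)`. -/
def omegaZero : N →ₗ[Bᵐᵒᵖ] N.tensor (suspDiagonal φ) :=
  E.basis.constr ℕ fun i => omegaPre φ E (N.d (E.basis i))

lemma omegaZero_eq (x : N) : omegaZero φ E x =
    (N.tensor (suspDiagonal φ)).d (omegaPre φ E x) + omegaPre φ E (N.d x) := by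
  induction x using SemifreeBasis.induct (E := E) with
  | zero => simp
  | smul μ b =>
    have h0 : omegaPre φ E (E.basis μ) = 0 := by
      have h := omegaPre_smul φ E μ 1
      have h1 : sder φ (1 : B) = 0 := by
        have := sder_mul φ (1 : B) 1
        rw [map_one, one_smul, MulOpposite.op_one, one_smul, mul_one] at this
        simpa using this
      rwa [MulOpposite.op_one, one_smul, h1, tmul_zero, smul_zero] at h
    have h2 : omegaZero φ E (E.basis μ) = omegaPre φ E (N.d (E.basis μ)) :=
      E.basis.constr_basis ℕ _ _
    rw [map_smul, h2, N.leibniz', map_add, omegaPre_mul, omegaPre_mul, N.sgn_d, h0, smul_zero,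
      zero_add, sgn_of_mem _ (E.mem_deg μ)]
    rcases Int.even_or_odd (E.degree μ) with h | h
    · rw [Int.negOnePow_even _ h, one_smul, omegaPre_smul, Int.negOnePow_even _ h, one_smul, d_tmul,
        sgn_of_mem _ (E.mem_deg μ), Int.negOnePow_even _ h, one_smul, sder_d, tmul_neg, neg_tmul]
      abel
    · rw [Int.negOnePow_odd _ h, Units.neg_smul, one_smul, smul_neg, map_neg (omegaPre φ E),
        omegaPre_smul, Int.negOnePow_odd _ h, Units.neg_smul, one_smul, map_neg N.d, neg_neg,
        neg_neg, d_tmul, map_neg N.d, map_neg (sgn N.deg), sgn_of_mem _ (E.mem_deg μ),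
        Int.negOnePow_odd _ h, Units.neg_smul, one_smul, neg_neg, sder_d, tmul_neg, neg_tmul]
      abel
  | add x y hx hy => simp only [map_add, hx, hy]; abel

lemma omegaZero_mem : omegaZero φ E ∈ dgHom N (N.tensor (suspDiagonal φ)) := by
  refine ⟨fun n x hx => ?_, fun x => ?_⟩
  · rw [omegaZero_eq]
    refine add_mem ?_ ?_
    · simpa using (N.tensor (suspDiagonal φ)).d_mem _ _ (omegaPre_mem φ E hx)
    · simpa using omegaPre_mem φ E (N.d_mem n x hx)
  · rw [omegaZero_eq, omegaZero_eq, map_add, N.d_d, (N.tensor (suspDiagonal φ)).d_d, map_zero,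
      add_zero, zero_add]

/-- The map `N ⊗_B T^i → N ⊗_B T^{i+1}` induced by `omegaZero`. -/
def omegaPow : ∀ i, tensorPow φ N i →ₗ[Bᵐᵒᵖ] tensorPow φ N (i + 1)
  | 0 => omegaZero φ E
  | i + 1 => tensorMap (omegaPow i) (suspDiagonal φ)

lemma omegaPow_mem (i : ℕ) :
    omegaPow φ E i ∈ dgHom (tensorPow φ N i) (tensorPow φ N (i + 1)) := by
  induction i with
  | zero => exact omegaZero_mem φ E
  | succ i ih => exact tensorMap_mem (suspDiagonal φ) ih

/-- The map `w_N : N ⊗_B T → (N ⊗_B T)[1]`, given by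
`e ⊗ t ↦ ∑ (-1)^|e_μ| e_μ ⊗ Σ (δ b_μ) ⊗ t` for a basis element `e` with `d e = ∑ e_μ b_μ`. -/
def omegaMap : Module.End Bᵐᵒᵖ (tensorT φ N).toDGMod :=
  DirectSum.toModule (M := fun i => (tensorPow φ N i).carrier) Bᵐᵒᵖ ℕ (tensorT φ N).toDGMod
    fun i => (tensorTOf φ N (i + 1)) ∘ₗ omegaPow φ E i

lemma omegaMap_of (i : ℕ) (x : tensorPow φ N i) :
    omegaMap φ E (tensorTOf φ N i x) = tensorTOf φ N (i + 1) (omegaPow φ E i x) :=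
  DirectSum.toModule_lof (M := fun i => (tensorPow φ N i).carrier) Bᵐᵒᵖ i x

lemma omegaMap_mem : omegaMap φ E ∈ TGMod.endDeg (tensorT φ N) 1 := by
  refine ⟨⟨fun n x hx => ?_, fun x => ?_⟩, ⟨fun x c => ?_, fun n x hx => ?_⟩⟩
  · refine directSum_deg_induct (p := fun x => omegaMap φ E x ∈ (tensorT φ N).deg n) ?_
      (fun i y hy => ?_) (fun x y hx hy => ?_) hx
    · exact (map_zero (omegaMap φ E)).symm ▸ zero_mem _
    · change omegaMap φ E (tensorTOf φ N i y) ∈ (directSum (tensorPow φ N)).deg n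
      rw [omegaMap_of]
      exact (tensorTOf_mem φ N (i + 1)).1 _ _ ((omegaPow_mem φ E i).1 _ _ hy)
    · exact (map_add (omegaMap φ E) x y).symm ▸ add_mem hx hy
  · induction x using tensorT_induct with
    | of i x =>
      have h1 : (tensorT φ N).d (tensorTOf φ N i x) = tensorTOf φ N i ((tensorPow φ N i).d x) :=
        ((tensorTOf_mem φ N i).2 x).symm
      rw [h1, omegaMap_of, omegaMap_of, (omegaPow_mem φ E i).2]
      exact (tensorTOf_mem φ N (i + 1)).2 _
    | add x y hx hy =>
      refine (congrArg (omegaMap φ E) (map_add (tensorT φ N).d x y)).trans ?_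
      refine (map_add (omegaMap φ E) _ _).trans ((congrArg₂ (· + ·) hx hy).trans ?_)
      refine (map_add (tensorT φ N).d _ _).symm.trans ?_
      exact congrArg (tensorT φ N).d (map_add (omegaMap φ E) x y).symm
  · induction x using tensorT_induct with
    | of i x =>
      change omegaMap φ E (tensorTActAux φ N (tmul (tensorTOf φ N i x) c)) =
        tensorTActAux φ N (tmul (omegaMap φ E (tensorTOf φ N i x)) c)
      rw [omegaMap_of, tensorTActAux_of, tensorTActAux_of]
      exact omegaMap_of φ E (i + 1) _
    | add x y hx hy =>
      have e := add_tmul (M := (tensorT φ N).toDGMod) x y c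
      refine (congrArg (fun t => omegaMap φ E ((tensorT φ N).act.1 t)) e).trans ?_
      simp only [map_add]
      rw [hx, hy, ← map_add, ← add_tmul]
      exact congrArg (fun t => (tensorT φ N).act.1 (tmul t c)) (map_add (omegaMap φ E) x y).symm
  · refine tensorTDeg_induct φ N (p := fun x => omegaMap φ E x ∈ tensorTDeg φ N (n + 1)) ?_
      (fun i x hi => ?_) (fun x y hx hy => ?_) hx
    · exact (map_zero (omegaMap φ E)).symm ▸ zero_mem _
    · rw [omegaMap_of, ← hi]
      exact_mod_cast tensorTOf_tdeg φ N (i + 1) (omegaPow φ E i x)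
    · exact (map_add (omegaMap φ E) x y).symm ▸ add_mem hx hy

/-- The class `ω_N` of `w_N` in `Γ_{N ⊗_B T}^1 ⊆ Γ_{N ⊗_B T}`. -/
def omega : TGMod.Gam (tensorT φ N) :=
  TGMod.toGam (tensorT φ N) 1 ⟨omegaMap φ E, omegaMap_mem φ E⟩

end Omega

/-! ## The standing assumptions -/

section Setting

open DGMod

variable {A B : DGAlg.{u} R} (φ : DGAlg.Hom A B)

/-- The standing assumptions on `φ : A → B`: it identifies `A` with a DG subalgebra of `B`, the
DG `A`-module `B` is semifree, and `B / A` is concentrated in positive degrees. -/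
structure StandingAssumptions : Prop where
  injective : Function.Injective φ.toAlgHom
  semifree : Nonempty (SemifreeBasis (restrict φ (DGMod.self B)))
  pos : ∀ n ≤ 0, ∀ b ∈ B.deg n, ∃ a : A, φ.toAlgHom a = b

/-- The condition (AR1) on a DG `B`-module `N`. -/
structure AR1 (N : DGMod B) : Prop where
  semifree : Nonempty (SemifreeBasis N)
  nonneg : ∀ n < 0, N.deg n = ⊥
  perfect_algebra : IsPerfect (restrict φ (DGMod.self B))
  perfect : IsPerfect (restrict φ N)
  vanishing : ∀ n : ℤ, 1 ≤ n → Subsingleton (HomK N ((DGMod.self B).shift n))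

end Setting

/-! ## Finite generation of `Γ_{N ⊗_B T}` -/

/-- `Γ_{N ⊗_B T}` as a right module over `End_{K(B)}(N)`, along the natural ring homomorphism. -/
@[reducible]
def gamRightModule {A B : DGAlg.{u} R} (φ : DGAlg.Hom A B) (N : DGMod B) :
    Module (DGMod.EndK N)ᵐᵒᵖ (TGMod.Gam (tensorT φ N)) :=
  Module.compHom _ (RingHom.op (endToGam φ N))

/-- `Γ_{N ⊗_B T}` is finitely generated as a right `End_{K(B)}(N)`-module. -/
def GamFinite {A B : DGAlg.{u} R} (φ : DGAlg.Hom A B) (N : DGMod B) : Prop :=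
  letI := gamRightModule φ N
  Module.Finite (DGMod.EndK N)ᵐᵒᵖ (TGMod.Gam (tensorT φ N))

end

/-! Everything turns on one property, `HFinite`: the identity is homotopic to an endomorphism whose
image lies in a finitely generated submodule.

Behind ω_N is the sequence N ⊗_B J → N|_A ⊗_A B → N. The B-linear map e ↦ e ⊗ 1 (`basisSection`) is
a section of π_N. It need not commute with the differentials, and its differential is κ ∘ ω_N, where
κ : N ⊗_B ΣJ → N|_A ⊗_A B is the degree -1 map induced by the inclusion of J
(`isComm_basisSection`). So ω_N is the connecting morphism of the sequence. A null-homotopy of it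
corrects the section to a chain map, which is a naïve lift (`naivelyLiftable_of_htpy`).

Since B and N are perfect over A, all middle terms (N|_A ⊗_A B) ⊗_B T^i are homotopically finite
(`AR1.hFinite_pow_baseChange`). Modulo maps of finite rank these terms disappear, so ω becomes left
invertible: for every n the identity of N factors through the iterate N → N ⊗_B T^n of ω, up to
homotopy and finite rank (`exists_factor_omegaIter`). Hence N is homotopically finite as soon as ω_N
is nilpotent or Hom_K(N, N ⊗_B T^n) = 0 for a single n ≥ 1. A naïve lift gives the same conclusion
directly, because N is then a retract of a middle term.

Conversely, let f be an endomorphism of finite rank homotopic to the identity. It is supported on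
finitely many basis elements spanning a DG submodule. Those of positive degree are removed from the
top downwards by means of Hom_K(N, Σ^n B) = 0 (`SemifreeBasis.exists_htpy_support_nonpos`). The
remaining ones of degree 0 are cycles because N_n = 0 for n < 0, so f factors through some B^n and N
is a summand of B^n in D(B) (`SemifreeBasis.isSummandOfFree`). A class in Hom_K(N, X) then factors
through B^n, and it vanishes when X_0 = 0 (`IsSummandOfFree.subsingleton_homK`). This applies to X =
N ⊗_B T^i for i ≥ 1: as B/A is concentrated in positive degrees, J is too, so X starts in degree 2
or higher.

The conditions on Γ are translated by extending maps N → N ⊗_B T^i to T-linear endomorphisms. This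
shows that Γ^i = 0 if and only if Hom_K(N, N ⊗_B T^i) = 0 (`gamDeg_eq_bot_iff`), and finite
generation of Γ forces this vanishing for some i ≥ 1 (`exists_subsingleton_of_gamFinite`). -/

noncomputable section

open GradedGroup

variable {R : Type v} [CommRing R]

/-! ### The complex of graded homomorphisms and finiteness up to homotopy. -/

section Commutators

open DGMod

variable {A B : DGAlg.{u} R}

namespace DGMod

/-- `f` is linear and homogeneous of degree `k`, and `g` is its differential `[d, f]` in the
complex of graded homomorphisms. -/
structure IsComm {M N : DGMod B} (k : ℤ) (f g : M →ₗ[Bᵐᵒᵖ] N) : Prop where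
  map_mem : ∀ n x, x ∈ M.deg n → f x ∈ N.deg (n + k)
  d_apply : ∀ x, N.d (f x) = g x + k.negOnePow • f (M.d x)

variable {M N P : DGMod B} {k l : ℤ}

/-- Chain maps are the degree 0 elements of the Hom complex with zero differential, and a homotopy
is a degree 1 element bounding a map. With this dictionary the later constructions reduce to
computing differentials [d, f]. -/
lemma mem_dgHom_iff {f : M →ₗ[Bᵐᵒᵖ] N} : f ∈ dgHom M N ↔ IsComm 0 f 0 :=
  ⟨fun h => ⟨by simpa using h.1, fun x => by simp [h.2 x]⟩,
    fun h => ⟨by simpa using h.1, fun x => by simp [h.2 x]⟩⟩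

lemma isHomotopy_iff {f h : M →ₗ[Bᵐᵒᵖ] N} : IsHomotopy f h ↔ IsComm 1 h f :=
  ⟨fun h => ⟨h.1, fun x => by simp [h.2 x]⟩, fun h => ⟨h.1, fun x => by simp [h.2 x]⟩⟩

lemma negOnePow_smul_mem (M : DGMod B) {n : ℤ} (e : ℤˣ) {x : M} (hx : x ∈ M.deg n) :
    e • x ∈ M.deg n := by
  rcases Int.units_eq_one_or e with h | h
  · simpa [h] using hx
  · simpa [h] using hx

namespace IsComm

lemma zero : IsComm k (0 : M →ₗ[Bᵐᵒᵖ] N) 0 :=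
  ⟨fun _ _ _ => zero_mem _, fun x => by simp⟩

lemma id (M : DGMod B) : IsComm 0 (LinearMap.id : M →ₗ[Bᵐᵒᵖ] M) 0 :=
  mem_dgHom_iff.1 (id_mem M)

lemma add {f g f' g' : M →ₗ[Bᵐᵒᵖ] N} (h : IsComm k f g) (h' : IsComm k f' g') :
    IsComm k (f + f') (g + g') :=
  ⟨fun n x hx => add_mem (h.1 n x hx) (h'.1 n x hx), fun x => by
    simp only [LinearMap.add_apply, map_add, h.2, h'.2, smul_add]; abel⟩

lemma neg {f g : M →ₗ[Bᵐᵒᵖ] N} (h : IsComm k f g) : IsComm k (-f) (-g) :=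
  ⟨fun n x hx => neg_mem (h.1 n x hx), fun x => by
    simp only [LinearMap.neg_apply, map_neg, h.2, smul_neg]; abel⟩

lemma sub {f g f' g' : M →ₗ[Bᵐᵒᵖ] N} (h : IsComm k f g) (h' : IsComm k f' g') :
    IsComm k (f - f') (g - g') := by
  simpa only [sub_eq_add_neg] using h.add h'.neg

lemma units_smul {f g : M →ₗ[Bᵐᵒᵖ] N} (h : IsComm k f g) (e : ℤˣ) :
    IsComm k (e • f) (e • g) := by
  rcases Int.units_eq_one_or e with he | he
  · simpa [he] using h
  · simpa [he] using h.neg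

lemma sum {ι : Type*} (s : Finset ι) {f g : ι → (M →ₗ[Bᵐᵒᵖ] N)}
    (h : ∀ i, IsComm k (f i) (g i)) : IsComm k (∑ i ∈ s, f i) (∑ i ∈ s, g i) := by
  classical
  induction s using Finset.induction_on with
  | empty => simpa using zero
  | insert a s ha ih => rw [Finset.sum_insert ha, Finset.sum_insert ha]; exact (h a).add ih

/-- The Leibniz rule of the Hom complex: moving d past the outer map, of degree l, costs the sign
(-1)^l. -/
lemma comp {f g : M →ₗ[Bᵐᵒᵖ] N} {f' g' : N →ₗ[Bᵐᵒᵖ] P} (h' : IsComm l f' g')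
    (h : IsComm k f g) : IsComm (k + l) (f' ∘ₗ f) (g' ∘ₗ f + l.negOnePow • (f' ∘ₗ g)) :=
  ⟨fun n x hx => by rw [← add_assoc]; exact h'.1 _ _ (h.1 n x hx), fun x => by
    simp only [LinearMap.comp_apply, LinearMap.add_apply, LinearMap.smul_apply, h'.2, h.2, map_add,
      smul_add, Int.negOnePow_add, add_assoc]
    congr 2
    rcases Int.even_or_odd k with h | h <;> rcases Int.even_or_odd l with h' | h' <;>
      simp [Int.negOnePow_even _, Int.negOnePow_odd _, h, h']⟩

/-- Composition with a chain map on the right. -/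
lemma comp_chain {f : M →ₗ[Bᵐᵒᵖ] N} {f' g' : N →ₗ[Bᵐᵒᵖ] P} (h' : IsComm l f' g')
    (h : IsComm k f 0) : IsComm (k + l) (f' ∘ₗ f) (g' ∘ₗ f) := by
  simpa using h'.comp h

/-- Composition with a chain map on the left. -/
lemma chain_comp {f g : M →ₗ[Bᵐᵒᵖ] N} {f' : N →ₗ[Bᵐᵒᵖ] P} (h' : IsComm l f' 0)
    (h : IsComm k f g) : IsComm (k + l) (f' ∘ₗ f) (l.negOnePow • (f' ∘ₗ g)) := by
  simpa using h'.comp h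

lemma congr_deg {f g : M →ₗ[Bᵐᵒᵖ] N} (h : IsComm k f g) (e : k = l) : IsComm l f g := e ▸ h

lemma congr_comm {f g g' : M →ₗ[Bᵐᵒᵖ] N} (h : IsComm k f g) (e : g = g') : IsComm k f g' := e ▸ h

/-- The defining equation can be solved for g, so [d, f] is determined by f. Computing it in two
ways yields identities between maps. -/
lemma unique {f g g' : M →ₗ[Bᵐᵒᵖ] N} (h : IsComm k f g) (h' : IsComm k f g') : g = g' := by
  ext x
  have := h.2 x
  rw [h'.2 x] at this
  exact (add_right_cancel this).symm

/-- The differential of the complex of homomorphisms squares to zero. -/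
lemma comm_comm {f g : M →ₗ[Bᵐᵒᵖ] N} (h : IsComm k f g) : IsComm (k - 1) g 0 := by
  refine ⟨fun n x hx => ?_, fun x => ?_⟩
  · have e : g x = N.d (f x) - k.negOnePow • f (M.d x) := by rw [h.2]; abel
    rw [e]
    refine sub_mem ?_ (negOnePow_smul_mem _ _ ?_)
    · have := N.d_mem _ _ (h.1 n x hx)
      rwa [show n + (k - 1) = n + k - 1 by omega]
    · have := h.1 _ _ (M.d_mem n x hx)
      rwa [show n + (k - 1) = n - 1 + k by omega]
  · have e : ∀ x, g x = N.d (f x) - k.negOnePow • f (M.d x) := fun x => by rw [h.2]; abel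
    rw [e, e, M.d_d, map_sub, N.d_d]
    have : ∀ y, N.d (k.negOnePow • y) = k.negOnePow • N.d y := fun y => by
      rcases Int.units_eq_one_or k.negOnePow with h | h <;> simp [h]
    rw [this, Int.negOnePow_sub]
    simp

end IsComm

/-- A homogeneous linear map has a differential in the complex of homomorphisms. -/
lemma exists_isComm (f : M →ₗ[Bᵐᵒᵖ] N) (hf : ∀ n x, x ∈ M.deg n → f x ∈ N.deg (n + k)) :
    ∃ g, IsComm k f g := by
  refine ⟨{ toFun := fun x => N.d (f x) - k.negOnePow • f (M.d x)
            map_add' := fun x y => by simp only [map_add, smul_add]; abel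
            map_smul' := fun b x => ?_ }, hf, fun x => ?_⟩
  -- The two terms containing d b cancel, because f commutes with the sign involutions up to (-1)^k.
  · obtain ⟨b, rfl⟩ := MulOpposite.op_surjective b
    simp only [map_smul, N.leibniz', M.leibniz', map_add, map_sgn f hf, RingHom.id_apply, smul_add,
      smul_sub]
    rw [smul_comm (k.negOnePow) (op b), smul_comm (k.negOnePow) (op (B.d b))]
    abel
  · change N.d (f x) = N.d (f x) - k.negOnePow • f (M.d x) + _
    abel

/-! ### Functoriality of tensor products -/

section TensorMap

variable {X Y Z : DGMod A} (L : DGBimod A B)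

lemma tensorMap_id : tensorMap (LinearMap.id : X →ₗ[Aᵐᵒᵖ] X) L = LinearMap.id :=
  tensor_hom_ext fun _ _ => rfl

lemma tensorMap_comp (g : Y →ₗ[Aᵐᵒᵖ] Z) (f : X →ₗ[Aᵐᵒᵖ] Y) :
    tensorMap (g ∘ₗ f) L = tensorMap g L ∘ₗ tensorMap f L :=
  tensor_hom_ext fun _ _ => rfl

lemma tensorMap_add (f g : X →ₗ[Aᵐᵒᵖ] Y) :
    tensorMap (f + g) L = tensorMap f L + tensorMap g L :=
  tensor_hom_ext fun m l => by
    rw [LinearMap.add_apply, tensorMap_tmul, tensorMap_tmul, tensorMap_tmul, LinearMap.add_apply,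
      add_tmul]

lemma tensorMap_zero : tensorMap (0 : X →ₗ[Aᵐᵒᵖ] Y) L = 0 :=
  tensor_hom_ext fun m l => by rw [tensorMap_tmul]; exact zero_tmul l

lemma tensorMap_neg (f : X →ₗ[Aᵐᵒᵖ] Y) : tensorMap (-f) L = - tensorMap f L :=
  tensor_hom_ext fun m l => by
    rw [LinearMap.neg_apply, tensorMap_tmul, tensorMap_tmul, LinearMap.neg_apply, neg_tmul]

lemma units_smul_tmul (e : ℤˣ) (m : X) (l : L) : tmul (e • m) l = e • tmul m l :=
  BTensor.units_smul_tmul e m l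

lemma IsComm.tensorMap {f g : X →ₗ[Aᵐᵒᵖ] Y} (h : IsComm k f g) :
    IsComm k (tensorMap f L) (tensorMap g L) := by
  refine ⟨tensorMap_degree L h.1, fun x => ?_⟩
  induction x using induct_tmul with
  | tmul m l =>
    rw [d_tmul, map_add, tensorMap_tmul, tensorMap_tmul, tensorMap_tmul, tensorMap_tmul, d_tmul,
      h.2, map_sgn f h.1, add_tmul, units_smul_tmul, units_smul_tmul, smul_add, add_assoc]
  | add x y hx hy => simp only [map_add, hx, hy, smul_add]; abel

end TensorMap

/-! ### Maps of finite rank and homotopical finiteness -/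

/-- The image of `f` lies in a finitely generated submodule. -/
def FiniteRank (f : M →ₗ[Bᵐᵒᵖ] N) : Prop :=
  ∃ V : Submodule Bᵐᵒᵖ N, V.FG ∧ ∀ x, f x ∈ V

namespace FiniteRank

lemma zero : FiniteRank (0 : M →ₗ[Bᵐᵒᵖ] N) := ⟨⊥, Submodule.fg_bot, fun _ => zero_mem _⟩

lemma add {f g : M →ₗ[Bᵐᵒᵖ] N} (hf : FiniteRank f) (hg : FiniteRank g) : FiniteRank (f + g) := by
  obtain ⟨V, hV, hf⟩ := hf
  obtain ⟨W, hW, hg⟩ := hg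
  exact ⟨V ⊔ W, hV.sup hW, fun x => add_mem (Submodule.mem_sup_left (hf x))
    (Submodule.mem_sup_right (hg x))⟩

lemma neg {f : M →ₗ[Bᵐᵒᵖ] N} (hf : FiniteRank f) : FiniteRank (-f) := by
  obtain ⟨V, hV, hf⟩ := hf
  exact ⟨V, hV, fun x => neg_mem (hf x)⟩

lemma sub {f g : M →ₗ[Bᵐᵒᵖ] N} (hf : FiniteRank f) (hg : FiniteRank g) : FiniteRank (f - g) := by
  simpa only [sub_eq_add_neg] using hf.add hg.neg

lemma units_smul {f : M →ₗ[Bᵐᵒᵖ] N} (hf : FiniteRank f) (e : ℤˣ) : FiniteRank (e • f) := by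
  rcases Int.units_eq_one_or e with he | he
  · simpa [he] using hf
  · simpa [he] using hf.neg

lemma comp_right {f : N →ₗ[Bᵐᵒᵖ] P} (hf : FiniteRank f) (g : M →ₗ[Bᵐᵒᵖ] N) :
    FiniteRank (f ∘ₗ g) := by
  obtain ⟨V, hV, hf⟩ := hf
  exact ⟨V, hV, fun x => hf _⟩

lemma comp_left {f : M →ₗ[Bᵐᵒᵖ] N} (hf : FiniteRank f) (g : N →ₗ[Bᵐᵒᵖ] P) :
    FiniteRank (g ∘ₗ f) := by
  obtain ⟨V, hV, hf⟩ := hf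
  exact ⟨V.map g, hV.map g, fun x => Submodule.mem_map_of_mem (hf x)⟩

end FiniteRank

/-- The identity of `M` is homotopic to a map of finite rank. -/
def HFinite (M : DGMod B) : Prop :=
  ∃ h g : M →ₗ[Bᵐᵒᵖ] M, IsComm 1 h g ∧ FiniteRank (LinearMap.id - g)

/-- A map out of a homotopically finite module which is a chain map up to finite rank is
null-homotopic up to finite rank. -/
lemma HFinite.exists_htpy (hM : HFinite M) {f g : M →ₗ[Bᵐᵒᵖ] N} (h : IsComm k f g)
    (hg : FiniteRank g) : ∃ a b, IsComm (1 + k) a b ∧ FiniteRank (f - b) := by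
  obtain ⟨s, t, hs, ht⟩ := hM
  -- Here s contracts M up to finite rank, with [d, s] = t. The differential of f ∘ s is g ∘ s +
  -- (-1)^k f ∘ t, so after rescaling by (-1)^k it differs from f only by f ∘ (id - t) and ± g ∘ s,
  -- both of finite rank.
  refine ⟨k.negOnePow • (f ∘ₗ s), _, (h.comp hs).units_smul _, ?_⟩
  have e : f - k.negOnePow • (g ∘ₗ s + k.negOnePow • (f ∘ₗ t)) =
      f ∘ₗ (LinearMap.id - t) - k.negOnePow • (g ∘ₗ s) := by
    rw [smul_add, smul_smul, Int.units_mul_self, one_smul, LinearMap.comp_sub, LinearMap.comp_id]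
    abel
  rw [e]
  exact (ht.comp_left f).sub ((hg.comp_right s).units_smul _)

/-- A homotopy retract of a homotopically finite module is homotopically finite. -/
lemma HFinite.of_retract (hN : HFinite N) {s : M →ₗ[Bᵐᵒᵖ] N} {r : N →ₗ[Bᵐᵒᵖ] M}
    (hs : IsComm k s 0) (hr : IsComm (-k) r 0) {h : M →ₗ[Bᵐᵒᵖ] M}
    (hh : IsComm 1 h (LinearMap.id - r ∘ₗ s)) : HFinite M := by
  obtain ⟨a, b, hab, hb⟩ := hN
  have h1 := (hr.chain_comp hab).comp_chain hs
  have h2 := h1.units_smul (-k).negOnePow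
  -- The contraction of M is h + (-1)^k r a s: its first term accounts for id - r s, and its second
  -- replaces r s by the finite-rank map r (id - b) s.
  refine ⟨_, _, hh.add (h2.congr_deg (by omega)), ?_⟩
  have e : LinearMap.id - (LinearMap.id - r ∘ₗ s +
      (-k).negOnePow • (((-k).negOnePow • (r ∘ₗ b)) ∘ₗ s)) = r ∘ₗ (LinearMap.id - b) ∘ₗ s := by
    rw [LinearMap.smul_comp, smul_smul, Int.units_mul_self, one_smul]
    simp only [LinearMap.sub_comp, LinearMap.comp_sub, LinearMap.id_comp, LinearMap.comp_assoc]
    abel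
  rw [e]
  exact (hb.comp_right s).comp_left r

lemma HFinite.of_strict_retract (hN : HFinite N) {s : M →ₗ[Bᵐᵒᵖ] N} {r : N →ₗ[Bᵐᵒᵖ] M}
    (hs : IsComm k s 0) (hr : IsComm (-k) r 0) (h : r ∘ₗ s = LinearMap.id) : HFinite M :=
  hN.of_retract hs hr (h := 0) (by rw [h, sub_self]; exact .zero)

end DGMod

end Commutators

/-! ### Finite triangular decompositions, coordinates of a semifree basis, and the functors - ⊗_B
T^i. -/

section Triangular

open DGMod

variable {A B : DGAlg.{u} R}

namespace DGMod

lemma sum_comp {M N P : DGMod B} {ι : Type*} (s : Finset ι) (f : ι → (N →ₗ[Bᵐᵒᵖ] P))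
    (g : M →ₗ[Bᵐᵒᵖ] N) : (∑ e ∈ s, f e) ∘ₗ g = ∑ e ∈ s, f e ∘ₗ g := by
  ext x
  simp

lemma comp_sum {M N P : DGMod B} {ι : Type*} (s : Finset ι) (f : ι → (M →ₗ[Bᵐᵒᵖ] N))
    (g : N →ₗ[Bᵐᵒᵖ] P) : g ∘ₗ (∑ e ∈ s, f e) = ∑ e ∈ s, g ∘ₗ f e := by
  ext x
  simp

/-- A module with a finite triangular decomposition into homotopically finite pieces is
homotopically finite. -/
lemma HFinite.of_triangular {Q G : DGMod B} (hQ : HFinite Q) {ι : Type*} [Fintype ι]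
    [LinearOrder ι] (n : ι → ℤ) (i i' : ι → (Q →ₗ[Bᵐᵒᵖ] G)) (c c' : ι → (G →ₗ[Bᵐᵒᵖ] Q))
    (hi : ∀ e, IsComm (n e) (i e) (i' e)) (hc : ∀ e, IsComm (-n e) (c e) (c' e))
    (same : ∀ e, c e ∘ₗ i e = LinearMap.id) (ne : ∀ e e', e ≠ e' → c e ∘ₗ i e' = 0)
    (total : ∑ e, i e ∘ₗ c e = LinearMap.id) (tri : ∀ e e', ¬ e < e' → c e ∘ₗ i' e' = 0) :
    HFinite G := by
  -- The composite c e ∘ i e' is the identity or zero, so its differential vanishes. Comparing with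
  -- the Leibniz rule shows that c' ∘ i is triangular because c ∘ i' is.
  have ci : ∀ e e', ¬ e < e' → c' e ∘ₗ i e' = 0 := fun e e' h => by
    have h1 := (hc e).comp (hi e')
    have h2 : IsComm (n e' + -n e) (c e ∘ₗ i e') 0 := by
      by_cases he : e = e'
      · subst he
        rw [same]
        exact (IsComm.id Q).congr_deg (by omega)
      · rw [ne _ _ he]; exact .zero
    have h3 := h1.unique h2
    rwa [tri _ _ h, smul_zero, add_zero] at h3
  -- Induction over initial segments S of ι: the differential g of h agrees with the identity, up to
  -- finite rank, on the part of G spanned by the pieces in S.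
  have key : ∀ S : Finset ι, (∀ e ∈ S, ∀ e' < e, e' ∈ S) →
      ∃ h g : G →ₗ[Bᵐᵒᵖ] G, IsComm 1 h g ∧
        FiniteRank ((LinearMap.id - g) ∘ₗ ∑ e ∈ S, i e ∘ₗ c e) := by
    intro S
    induction S using Finset.induction_on_max with
    | empty => exact fun _ => ⟨0, 0, .zero, by simpa using FiniteRank.zero⟩
    | insert a S ha ih =>
      intro hS
      have haS : a ∉ S := fun h => (ha a h).false
      obtain ⟨h, g, hg, hf⟩ := ih fun e he e' he' => by
        rcases Finset.mem_insert.1 (hS e (Finset.mem_insert_of_mem he) e' he') with h | h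
        · exact absurd (he'.trans (ha e he)) (by rw [h]; exact lt_irrefl _)
        · exact h
      have h0 : IsComm 0 (LinearMap.id - g) 0 := by
        simpa using (IsComm.id G).sub (hg.comm_comm.congr_deg (by omega))
      have h1 := (h0.chain_comp (hi a)).congr_deg (add_zero _)
      -- By triangularity, and since S contains everything below a, the differential of i a lands in
      -- the part already treated. Hence (id - g) ∘ i a has differential (id - g) ∘ i' a of finite
      -- rank, and `HFinite.exists_htpy` contracts it up to finite rank.
      have h2 : i' a = (∑ e ∈ S, i e ∘ₗ c e) ∘ₗ i' a := by
        conv_lhs => rw [← LinearMap.id_comp (i' a), ← total]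
        rw [sum_comp, sum_comp]
        refine (Finset.sum_subset (Finset.subset_univ S) fun e _ he => ?_).symm
        rw [LinearMap.comp_assoc, tri, LinearMap.comp_zero]
        intro hlt
        rcases Finset.mem_insert.1 (hS a (Finset.mem_insert_self _ _) e hlt) with h | h
        · exact hlt.ne h
        · exact he h
      obtain ⟨k, b, hk, hb⟩ := hQ.exists_htpy h1 (by
        rw [h2, ← LinearMap.comp_assoc]
        exact (hf.comp_right _).units_smul _)
      -- The new homotopy is h + k ∘ c a. The unwanted term k ∘ c' a in its differential is
      -- invisible on the enlarged segment, since c' a kills i e for all e ≤ a.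
      refine ⟨_, _, hg.add ((hk.comp (hc a)).congr_deg (by omega)), ?_⟩
      rw [Finset.sum_insert haS]
      have e1 : c a ∘ₗ (∑ e ∈ S, i e ∘ₗ c e) = 0 := by
        rw [comp_sum]
        refine Finset.sum_eq_zero fun e he => ?_
        rw [← LinearMap.comp_assoc, ne _ _ (ha e he).ne', LinearMap.zero_comp]
      have e2 : c' a ∘ₗ (i a ∘ₗ c a + ∑ e ∈ S, i e ∘ₗ c e) = 0 := by
        rw [LinearMap.comp_add, comp_sum, ← LinearMap.comp_assoc, ci _ _ (lt_irrefl _),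
          LinearMap.zero_comp, zero_add]
        refine Finset.sum_eq_zero fun e he => ?_
        rw [← LinearMap.comp_assoc, ci _ _ (ha e he).not_gt, LinearMap.zero_comp]
      have e3 : c a ∘ₗ (i a ∘ₗ c a + ∑ e ∈ S, i e ∘ₗ c e) = c a := by
        rw [LinearMap.comp_add, e1, ← LinearMap.comp_assoc, same, LinearMap.id_comp, add_zero]
      have e4 : (LinearMap.id - (g + (b ∘ₗ c a + (1 + n a).negOnePow • (k ∘ₗ c' a)))) ∘ₗ
          (i a ∘ₗ c a + ∑ e ∈ S, i e ∘ₗ c e) =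
          (LinearMap.id - g) ∘ₗ (∑ e ∈ S, i e ∘ₗ c e) +
            ((LinearMap.id - g) ∘ₗ i a - b) ∘ₗ c a := by
        have e5 : LinearMap.id - (g + (b ∘ₗ c a + (1 + n a).negOnePow • (k ∘ₗ c' a))) =
            (LinearMap.id - g) - b ∘ₗ c a - (1 + n a).negOnePow • (k ∘ₗ c' a) := by abel
        have e6 : ((LinearMap.id - g) ∘ₗ i a - b) ∘ₗ c a =
            (LinearMap.id - g) ∘ₗ i a ∘ₗ c a - b ∘ₗ c a := rfl
        rw [e5, e6, LinearMap.sub_comp, LinearMap.sub_comp, LinearMap.smul_comp, LinearMap.comp_assoc,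
          LinearMap.comp_assoc, e2, e3, LinearMap.comp_zero, smul_zero, LinearMap.comp_add]
        abel
      rw [e4]
      exact hf.add (hb.comp_right _)
  obtain ⟨h, g, hg, hf⟩ := key Finset.univ fun _ _ _ _ => Finset.mem_univ _
  rw [total, LinearMap.comp_id] at hf
  exact ⟨h, g, hg, hf⟩

end DGMod

namespace DGMod

/-- The map `B → N`, `b ↦ x b`. -/
def ofElem {N : DGMod B} (x : N) : DGMod.self B →ₗ[Bᵐᵒᵖ] N where
  toFun := fun b : B => op b • x
  map_add' := fun a b : B => add_smul (op a) (op b) x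
  map_smul' := fun (b : Bᵐᵒᵖ) (a : B) => mul_smul b (op a) x

lemma ofElem_apply {N : DGMod B} (x : N) (b : B) : ofElem x b = op b • x := rfl

lemma self_hom_ext {P : DGMod B} {f g : DGMod.self B →ₗ[Bᵐᵒᵖ] P} (h : ∀ b : B, f b = g b) :
    f = g := LinearMap.ext h

end DGMod

namespace SemifreeBasis

variable {N : DGMod B} (E : SemifreeBasis N)

/-- The map `B → N`, `b ↦ e b`, for a basis element `e`. -/
def incl (j : E.ι) : DGMod.self B →ₗ[Bᵐᵒᵖ] N := ofElem (E.basis j)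

/-- The coordinate function of a basis element. -/
def coord (j : E.ι) : N →ₗ[Bᵐᵒᵖ] DGMod.self B where
  toFun x := ((E.basis.repr x j).unop : B)
  map_add' x y := by rw [map_add]; rfl
  map_smul' b x := by rw [map_smul]; rfl

lemma incl_apply (j : E.ι) (b : B) : E.incl j b = op b • E.basis j := rfl

lemma coord_apply (j : E.ι) (x : N) : E.coord j x = ((E.basis.repr x j).unop : B) := rfl

lemma coord_eq_zero_iff (j : E.ι) (x : N) : E.coord j x = 0 ↔ E.basis.repr x j = 0 :=
  MulOpposite.unop_eq_zero_iff _

lemma coord_smul (j : E.ι) (x : N) (b : B) :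
    E.coord j (op b • x) = op b • E.coord j x := map_smul _ _ _

lemma coord_basis_same (j : E.ι) : E.coord j (E.basis j) = (1 : B) := by
  rw [coord_apply, Module.Basis.repr_self, Finsupp.single_eq_same]; rfl

lemma coord_basis_ne {j j' : E.ι} (h : j ≠ j') : E.coord j (E.basis j') = 0 := by
  rw [coord_eq_zero_iff, Module.Basis.repr_self, Finsupp.single_eq_of_ne h]

lemma incl_degree (j : E.ι) (n : ℤ) (b : DGMod.self B) (hb : b ∈ (DGMod.self B).deg n) :
    E.incl j b ∈ N.deg (n + E.degree j) := by
  rw [add_comm]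
  exact N.smul_mem _ _ _ b (E.mem_deg j) hb

/-- Stated through projections, the homogeneity of a coordinate is additive in x and can be checked
on multiples of basis elements. -/
lemma coord_proj (j : E.ι) (n : ℤ) (x : N) : E.coord j (proj N.deg n x) =
    proj (DGMod.self B).deg (n - E.degree j) (E.coord j x) := by
  induction x using SemifreeBasis.induct (E := E) with
  | zero => simp
  | smul i b =>
    induction b using GradedGroup.induct B.deg with
    | hom m b hb =>
      have hx := N.smul_mem _ _ _ b (E.mem_deg i) hb
      by_cases hij : j = i
      · subst hij
        have hb' : E.coord j (op b • E.basis j) = (b : DGMod.self B) := by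
          rw [coord_smul, coord_basis_same]; exact one_mul b
        have hb2 : (b : DGMod.self B) ∈ (DGMod.self B).deg m := hb
        by_cases h : E.degree j + m = n
        · rw [← h, proj_same _ hx, hb', add_sub_cancel_left, proj_same (M := DGMod.self B) (DGMod.self B).deg hb2]
        · rw [proj_ne _ hx h, hb', proj_ne (M := DGMod.self B) (DGMod.self B).deg hb2 (by omega), map_zero]
      · have h0 : ∀ b : B, E.coord j (op b • E.basis i) = 0 := fun b => by
          rw [coord_smul, coord_basis_ne E hij, smul_zero]
        rw [h0, map_zero]
        by_cases h : E.degree i + m = n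
        · rw [← h, proj_same _ hx, h0]
        · rw [proj_ne _ hx h, map_zero]
    | add b c hb hc => simp only [MulOpposite.op_add, add_smul, map_add, hb, hc]
  | add x y hx hy => simp only [map_add, hx, hy]

lemma coord_mem (j : E.ι) {n : ℤ} {x : N} (hx : x ∈ N.deg n) :
    E.coord j x ∈ (DGMod.self B).deg (n - E.degree j) := by
  rw [← proj_same _ hx, coord_proj]
  exact proj_mem _ _ _

lemma coord_degree (j : E.ι) (n : ℤ) (x : N) (hx : x ∈ N.deg n) :
    E.coord j x ∈ (DGMod.self B).deg (n + -E.degree j) := E.coord_mem j hx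

/-- The map `b ↦ d(e) b`. -/
def dIncl (j : E.ι) : DGMod.self B →ₗ[Bᵐᵒᵖ] N := ofElem (N.d (E.basis j))

lemma dIncl_apply (j : E.ι) (b : B) : E.dIncl j b = op b • N.d (E.basis j) := rfl

lemma isComm_incl (j : E.ι) : IsComm (E.degree j) (E.incl j) (E.dIncl j) :=
  ⟨E.incl_degree j, fun b => N.leibniz _ _ b (E.mem_deg j)⟩

lemma coord_comp_incl_same (j : E.ι) : E.coord j ∘ₗ E.incl j = LinearMap.id := by
  refine self_hom_ext fun b => ?_
  change E.coord j (op b • E.basis j) = b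
  rw [coord_smul, coord_basis_same]
  exact one_mul b

lemma coord_comp_incl_ne {j j' : E.ι} (h : j ≠ j') : E.coord j ∘ₗ E.incl j' = 0 := by
  refine self_hom_ext fun b => ?_
  change E.coord j (op b • E.basis j') = 0
  rw [coord_smul, coord_basis_ne E h, smul_zero]

lemma coord_comp_dIncl {j j' : E.ι} (h : ¬ j < j') : E.coord j ∘ₗ E.dIncl j' = 0 := by
  refine self_hom_ext fun b => ?_
  change E.coord j (op b • N.d (E.basis j')) = 0
  rw [coord_smul, (E.coord_eq_zero_iff j _).2 (not_not.1 fun h' => h (E.d_lt j' j h')), smul_zero]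

lemma hom_ext {P : DGMod B} {f g : N →ₗ[Bᵐᵒᵖ] P} (h : ∀ j, f (E.basis j) = g (E.basis j)) :
    f = g := E.basis.ext h

lemma sum_incl_coord [Fintype E.ι] : ∑ j, E.incl j ∘ₗ E.coord j = LinearMap.id := by
  classical
  refine E.hom_ext fun i => ?_
  rw [LinearMap.sum_apply, Finset.sum_eq_single i]
  · rw [LinearMap.comp_apply, coord_basis_same, incl_apply]; exact one_smul _ _
  · intro j _ hj
    rw [LinearMap.comp_apply, coord_basis_ne E hj, map_zero]
  · exact fun h => absurd (Finset.mem_univ i) h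

end SemifreeBasis

/-! ### Functoriality of `N ⊗_B T^i` -/

section PowMap

variable (φ : DGAlg.Hom A B) {M N P : DGMod B}

namespace DGMod

/-- The map `M ⊗_B T^i → N ⊗_B T^i` induced by a map `M → N`. -/
def powMap (f : M →ₗ[Bᵐᵒᵖ] N) : ∀ i, tensorPow φ M i →ₗ[Bᵐᵒᵖ] tensorPow φ N i
  | 0 => f
  | i + 1 => tensorMap (powMap f i) (suspDiagonal φ)

/-- The map `M ⊗_B T^i → N ⊗_B T^{i+1}` induced by a map `M → N ⊗_B Σ J`. -/
def powUp (f : M →ₗ[Bᵐᵒᵖ] N.tensor (suspDiagonal φ)) :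
    ∀ i, tensorPow φ M i →ₗ[Bᵐᵒᵖ] tensorPow φ N (i + 1)
  | 0 => f
  | i + 1 => tensorMap (powUp f i) (suspDiagonal φ)

/-- The map `M ⊗_B T^{i+1} → N ⊗_B T^i` induced by a map `M ⊗_B Σ J → N`. -/
def powDown (f : M.tensor (suspDiagonal φ) →ₗ[Bᵐᵒᵖ] N) :
    ∀ i, tensorPow φ M (i + 1) →ₗ[Bᵐᵒᵖ] tensorPow φ N i
  | 0 => f
  | i + 1 => tensorMap (powDown f i) (suspDiagonal φ)

lemma IsComm.powMap {k : ℤ} {f g : M →ₗ[Bᵐᵒᵖ] N} (h : IsComm k f g) (i : ℕ) :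
    IsComm k (powMap φ f i) (powMap φ g i) := by
  induction i with
  | zero => exact h
  | succ i ih => exact ih.tensorMap _

lemma IsComm.powUp {k : ℤ} {f g : M →ₗ[Bᵐᵒᵖ] N.tensor (suspDiagonal φ)} (h : IsComm k f g)
    (i : ℕ) : IsComm k (powUp φ f i) (powUp φ g i) := by
  induction i with
  | zero => exact h
  | succ i ih => exact ih.tensorMap _

lemma IsComm.powDown {k : ℤ} {f g : M.tensor (suspDiagonal φ) →ₗ[Bᵐᵒᵖ] N} (h : IsComm k f g)
    (i : ℕ) : IsComm k (powDown φ f i) (powDown φ g i) := by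
  induction i with
  | zero => exact h
  | succ i ih => exact ih.tensorMap _

lemma powMap_id (i : ℕ) : powMap φ (LinearMap.id : M →ₗ[Bᵐᵒᵖ] M) i = LinearMap.id := by
  induction i with
  | zero => rfl
  | succ i ih => exact (congrArg (tensorMap · _) ih).trans (tensorMap_id _)

lemma powMap_zero (i : ℕ) : powMap φ (0 : M →ₗ[Bᵐᵒᵖ] N) i = 0 := by
  induction i with
  | zero => rfl
  | succ i ih => exact (congrArg (tensorMap · _) ih).trans (tensorMap_zero _)

lemma powUp_zero (i : ℕ) :
    powUp φ (0 : M →ₗ[Bᵐᵒᵖ] N.tensor (suspDiagonal φ)) i = 0 := by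
  induction i with
  | zero => rfl
  | succ i ih => exact (congrArg (tensorMap · _) ih).trans (tensorMap_zero _)

lemma powDown_zero (i : ℕ) :
    powDown φ (0 : M.tensor (suspDiagonal φ) →ₗ[Bᵐᵒᵖ] N) i = 0 := by
  induction i with
  | zero => rfl
  | succ i ih => exact (congrArg (tensorMap · _) ih).trans (tensorMap_zero _)

lemma powMap_comp (g : N →ₗ[Bᵐᵒᵖ] P) (f : M →ₗ[Bᵐᵒᵖ] N) (i : ℕ) :
    powMap φ (g ∘ₗ f) i = powMap φ g i ∘ₗ powMap φ f i := by
  induction i with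
  | zero => rfl
  | succ i ih => exact (congrArg (tensorMap · _) ih).trans (tensorMap_comp _ _ _)

lemma powDown_comp (g : N →ₗ[Bᵐᵒᵖ] P) (f : M.tensor (suspDiagonal φ) →ₗ[Bᵐᵒᵖ] N) (i : ℕ) :
    powDown φ (g ∘ₗ f) i = powMap φ g i ∘ₗ powDown φ f i := by
  induction i with
  | zero => rfl
  | succ i ih => exact (congrArg (tensorMap · _) ih).trans (tensorMap_comp _ _ _)

lemma powMap_comp_down_up (g : N.tensor (suspDiagonal φ) →ₗ[Bᵐᵒᵖ] P)
    (f : M →ₗ[Bᵐᵒᵖ] N.tensor (suspDiagonal φ)) (i : ℕ) :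
    powMap φ (g ∘ₗ f) i = powDown φ g i ∘ₗ powUp φ f i := by
  induction i with
  | zero => rfl
  | succ i ih => exact (congrArg (tensorMap · _) ih).trans (tensorMap_comp _ _ _)

lemma powUp_comp_powDown (g : N →ₗ[Bᵐᵒᵖ] M.tensor (suspDiagonal φ))
    (f : M.tensor (suspDiagonal φ) →ₗ[Bᵐᵒᵖ] N) (h : g ∘ₗ f = LinearMap.id) (i : ℕ) :
    powUp φ g i ∘ₗ powDown φ f i = LinearMap.id := by
  induction i with
  | zero => exact h
  | succ i ih =>
    exact (tensorMap_comp _ _ _).symm.trans ((congrArg (tensorMap · _) ih).trans (tensorMap_id _))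

lemma powMap_add (f g : M →ₗ[Bᵐᵒᵖ] N) (i : ℕ) :
    powMap φ (f + g) i = powMap φ f i + powMap φ g i := by
  induction i with
  | zero => rfl
  | succ i ih => exact (congrArg (tensorMap · _) ih).trans (tensorMap_add _ _ _)

lemma powMap_neg (f : M →ₗ[Bᵐᵒᵖ] N) (i : ℕ) : powMap φ (-f) i = - powMap φ f i := by
  induction i with
  | zero => rfl
  | succ i ih => exact (congrArg (tensorMap · _) ih).trans (tensorMap_neg _ _)

lemma omegaPow_eq_powUp (E : SemifreeBasis N) (i : ℕ) :
    omegaPow φ E i = powUp φ (omegaZero φ E) i := by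
  induction i with
  | zero => rfl
  | succ i ih => exact congrArg (tensorMap · _) ih

end DGMod

end PowMap

end Triangular

/-! ### Recursion along semifree bases and lifting through quasi-isomorphisms. -/

section Lifting

open DGMod

variable {A B : DGAlg.{u} R}

namespace DGMod

/-- The equation [d, f] = g passes from x to x b by the Leibniz rule. Homogeneity of f is required
only at x, so the statement is usable while f is still being constructed. -/
lemma apply_d_smul {P Y : DGMod B} {f g : P →ₗ[Bᵐᵒᵖ] Y} {k n : ℤ} {x : P} (hx : x ∈ P.deg n)
    (hfx : f x ∈ Y.deg (n + k)) (h : Y.d (f x) = g x + k.negOnePow • f (P.d x)) (b : B) :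
    Y.d (f (op b • x)) = g (op b • x) + k.negOnePow • f (P.d (op b • x)) := by
  rw [map_smul, Y.leibniz', h, P.leibniz', map_add, map_smul, map_smul, map_smul,
    sgn_of_mem _ hx, sgn_of_mem _ hfx, Int.negOnePow_add, smul_add, smul_add, add_assoc]
  rcases Int.even_or_odd n with h | h <;> rcases Int.even_or_odd k with h' | h' <;>
    simp [Int.negOnePow_even _, Int.negOnePow_odd _, h, h']

end DGMod

namespace SemifreeBasis

variable {P : DGMod B} (E : SemifreeBasis P)

lemma sum_support (x : P) : ∑ j ∈ (E.basis.repr x).support, E.incl j (E.coord j x) = x :=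
  E.basis.linearCombination_repr x

/-- Only basis elements occurring in x matter. For x = d e these precede e, so in a recursion the
inductive hypothesis suffices; `apply_d` serves the same purpose for differentials. -/
lemma apply_mem_deg {Y : DGMod B} {f : P →ₗ[Bᵐᵒᵖ] Y} {k n : ℤ} {x : P} (hx : x ∈ P.deg n)
    (h : ∀ j, E.basis.repr x j ≠ 0 → f (E.basis j) ∈ Y.deg (E.degree j + k)) :
    f x ∈ Y.deg (n + k) := by
  rw [← E.sum_support x, map_sum]
  refine sum_mem fun j hj => ?_
  have h1 := Y.smul_mem _ _ _ _ (h j (Finsupp.mem_support_iff.1 hj)) (E.coord_mem j hx)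
  rw [show E.degree j + k + (n - E.degree j) = n + k by omega, ← map_smul] at h1
  exact h1

lemma apply_d {Y : DGMod B} {f g : P →ₗ[Bᵐᵒᵖ] Y} {k : ℤ} (x : P)
    (h : ∀ j, E.basis.repr x j ≠ 0 → f (E.basis j) ∈ Y.deg (E.degree j + k) ∧
      Y.d (f (E.basis j)) = g (E.basis j) + k.negOnePow • f (P.d (E.basis j))) :
    Y.d (f x) = g x + k.negOnePow • f (P.d x) := by
  conv_lhs => rw [← E.sum_support x]
  conv_rhs => rw [← E.sum_support x]
  simp only [map_sum, Finset.smul_sum, ← Finset.sum_add_distrib]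
  refine Finset.sum_congr rfl fun j hj => ?_
  obtain ⟨h1, h2⟩ := h j (Finsupp.mem_support_iff.1 hj)
  exact apply_d_smul (E.mem_deg j) h1 h2 _

lemma isComm_of_basis {Y : DGMod B} {f g : P →ₗ[Bᵐᵒᵖ] Y} {k : ℤ}
    (h1 : ∀ j, f (E.basis j) ∈ Y.deg (E.degree j + k))
    (h2 : ∀ j, Y.d (f (E.basis j)) = g (E.basis j) + k.negOnePow • f (P.d (E.basis j))) :
    IsComm k f g :=
  ⟨fun _ _ hx => E.apply_mem_deg hx fun j _ => h1 j, fun x => E.apply_d x fun j _ => ⟨h1 j, h2 j⟩⟩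

/-- Recursion along a semifree basis: a linear map can be constructed by choosing the image of each
basis element in dependence of the image of its boundary. -/
lemma exists_recursion {W : Type*} [AddCommGroup W] [Module Bᵐᵒᵖ W] (Q : E.ι → W → W → Prop) :
    ∃ f : P →ₗ[Bᵐᵒᵖ] W, ∀ e, (∃ w, Q e w (f (P.d (E.basis e)))) →
      Q e (f (E.basis e)) (f (P.d (E.basis e))) := by
  classical
  -- Both default values 0 are harmless: an index j not below e does not occur in d e, and where no
  -- admissible w exists the conclusion claims nothing.
  let F : ∀ e : E.ι, (∀ j, j < e → W) → W := fun e rec =>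
    let s := (E.basis.repr (P.d (E.basis e))).sum fun j c =>
      c • (if h : j < e then rec j h else 0)
    if h : ∃ w, Q e w s then h.choose else 0
  let w : E.ι → W := (wellFounded_lt (α := E.ι)).fix F
  have hs : ∀ e, (E.basis.repr (P.d (E.basis e))).sum (fun j c =>
      c • (if j < e then w j else 0)) = E.basis.constr ℕ w (P.d (E.basis e)) := fun e => by
    rw [Module.Basis.constr_apply]
    refine Finset.sum_congr rfl fun j hj => ?_
    dsimp only
    rw [if_pos (E.d_lt e j (Finsupp.mem_support_iff.1 hj))]
  refine ⟨E.basis.constr ℕ w, fun e he => ?_⟩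
  rw [Module.Basis.constr_basis]
  have hw : w e = F e fun j _ => w j := (wellFounded_lt (α := E.ι)).fix_eq F e
  have hF : (F e fun j _ => w j) = if h : ∃ v, Q e v (E.basis.constr ℕ w (P.d (E.basis e)))
      then h.choose else 0 := by
    rw [← hs]
    simp only [F, dite_eq_ite]
  rw [hw, hF, dif_pos he]
  exact he.choose_spec

end SemifreeBasis

namespace DGMod.IsQuasiIso

variable {X Y : DGMod B} {g : dgHom X Y}

/-- A cycle whose image under a quasi-isomorphism bounds is a boundary. -/
lemma exists_d_eq (hg : IsQuasiIso g) {n : ℤ} {z : X} (hz : z ∈ X.deg n) (hdz : X.d z = 0) {y : Y}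
    (hy : y ∈ Y.deg (n + 1)) (h : Y.d y = g.1 z) : ∃ x ∈ X.deg (n + 1), X.d x = z := by
  have h1 : homologyMap g n (QuotientAddGroup.mk ⟨z, hz, hdz⟩) = 0 := by
    refine (QuotientAddGroup.eq_zero_iff _).2 ⟨y, hy, h⟩
  have h2 := (injective_iff_map_eq_zero _).1 (hg n).1 _ h1
  obtain ⟨x, hx, h⟩ := (QuotientAddGroup.eq_zero_iff _).1 h2
  exact ⟨x, hx, h⟩

/-- Every cycle is homologous to the image of a cycle under a quasi-isomorphism. -/
lemma exists_cycle (hg : IsQuasiIso g) {n : ℤ} {w : Y} (hw : w ∈ Y.deg n) (hdw : Y.d w = 0) :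
    ∃ x ∈ X.deg n, X.d x = 0 ∧ ∃ y ∈ Y.deg (n + 1), Y.d y = w - g.1 x := by
  obtain ⟨q, hq⟩ := (hg n).2 (QuotientAddGroup.mk ⟨w, hw, hdw⟩)
  obtain ⟨⟨x, hx, hdx⟩, rfl⟩ := QuotientAddGroup.mk_surjective q
  obtain ⟨y, hy, h⟩ := QuotientAddGroup.eq.1 hq
  refine ⟨x, hx, hdx, y, hy, h.trans ?_⟩
  change -(g.1 x) + w = w - g.1 x
  abel

end DGMod.IsQuasiIso

namespace SemifreeBasis

variable {P : DGMod B}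

/-- Maps out of a semifree module into the cone of a quasi-isomorphism are null-homotopic. -/
lemma exists_lift (E : SemifreeBasis P) {X Y : DGMod B} {g : dgHom X Y} (hg : IsQuasiIso g) {k : ℤ}
    {a : P →ₗ[Bᵐᵒᵖ] X} {b : P →ₗ[Bᵐᵒᵖ] Y} (ha : IsComm k a 0) (hb : IsComm (k + 1) b (g.1 ∘ₗ a)) :
    ∃ a' b', IsComm (k + 1) a' a ∧ IsComm (k + 2) b' (b - g.1 ∘ₗ a') := by
  -- The two components are built simultaneously, with values in X × Y. The conditions say that (a',
  -- b') contracts the map (a, b) into the cone of g, and s stands for the value already determined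
  -- on d e.
  obtain ⟨f, hf⟩ := E.exists_recursion (W := X × Y) fun e p s =>
    p.1 ∈ X.deg (E.degree e + (k + 1)) ∧ p.2 ∈ Y.deg (E.degree e + (k + 2)) ∧
      X.d p.1 = a (E.basis e) + (k + 1).negOnePow • s.1 ∧
      Y.d p.2 = b (E.basis e) - g.1 p.1 + (k + 2).negOnePow • s.2
  set a' : P →ₗ[Bᵐᵒᵖ] X := LinearMap.fst _ _ _ ∘ₗ f with ha'
  set b' : P →ₗ[Bᵐᵒᵖ] Y := LinearMap.snd _ _ _ ∘ₗ f with hb'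
  have dsm : ∀ (M : DGMod B) (e : ℤˣ) (x : M), M.d (e • x) = e • M.d x := fun M e x => by
    rcases Int.units_eq_one_or e with he | he <;> simp [he]
  have key : ∀ e, a' (E.basis e) ∈ X.deg (E.degree e + (k + 1)) ∧
      b' (E.basis e) ∈ Y.deg (E.degree e + (k + 2)) ∧
      X.d (a' (E.basis e)) = a (E.basis e) + (k + 1).negOnePow • a' (P.d (E.basis e)) ∧
      Y.d (b' (E.basis e)) = (b - g.1 ∘ₗ a') (E.basis e) +
        (k + 2).negOnePow • b' (P.d (E.basis e)) := by
    intro e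
    induction e using WellFoundedLT.induction with
    | ind e ih =>
      refine hf e ?_
      have hde := P.d_mem _ _ (E.mem_deg e)
      have m1 : a' (P.d (E.basis e)) ∈ X.deg (E.degree e - 1 + (k + 1)) :=
        E.apply_mem_deg hde fun j hj => (ih j (E.d_lt e j hj)).1
      have m2 : b' (P.d (E.basis e)) ∈ Y.deg (E.degree e - 1 + (k + 2)) :=
        E.apply_mem_deg hde fun j hj => (ih j (E.d_lt e j hj)).2.1
      have d1 := E.apply_d (f := a') (g := a) (k := k + 1) (P.d (E.basis e)) fun j hj =>
        ⟨(ih j (E.d_lt e j hj)).1, (ih j (E.d_lt e j hj)).2.2.1⟩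
      have d2 := E.apply_d (f := b') (g := b - g.1 ∘ₗ a') (k := k + 2) (P.d (E.basis e))
        fun j hj => ⟨(ih j (E.d_lt e j hj)).2.1, (ih j (E.d_lt e j hj)).2.2.2⟩
      rw [P.d_d, map_zero, smul_zero, add_zero] at d1 d2
      change ∃ w : X × Y, w.1 ∈ _ ∧ w.2 ∈ _ ∧
        X.d w.1 = a (E.basis e) + (k + 1).negOnePow • a' (P.d (E.basis e)) ∧
        Y.d w.2 = b (E.basis e) - g.1 w.1 + (k + 2).negOnePow • b' (P.d (E.basis e))
      have hz : a (E.basis e) + (k + 1).negOnePow • a' (P.d (E.basis e)) ∈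
          X.deg (E.degree e + k) := by
        refine add_mem (ha.1 _ _ (E.mem_deg e)) (negOnePow_smul_mem _ _ ?_)
        rwa [show E.degree e - 1 + (k + 1) = E.degree e + k by omega] at m1
      have hdz : X.d (a (E.basis e) + (k + 1).negOnePow • a' (P.d (E.basis e))) = 0 := by
        rw [map_add, dsm, d1, ha.2, LinearMap.zero_apply, zero_add, Int.negOnePow_succ,
          Units.neg_smul, add_neg_cancel]
      have hy : b (E.basis e) + (k + 2).negOnePow • b' (P.d (E.basis e)) ∈
          Y.deg (E.degree e + k + 1) := by
        refine add_mem ?_ (negOnePow_smul_mem _ _ ?_)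
        · rw [add_assoc]; exact hb.1 _ _ (E.mem_deg e)
        · rwa [show E.degree e - 1 + (k + 2) = E.degree e + k + 1 by omega] at m2
      have hdy : Y.d (b (E.basis e) + (k + 2).negOnePow • b' (P.d (E.basis e))) =
          g.1 (a (E.basis e) + (k + 1).negOnePow • a' (P.d (E.basis e))) := by
        rw [map_add, dsm, d2, hb.2, map_add]
        have h2 : Int.negOnePow 2 = 1 := rfl
        rcases Int.even_or_odd k with h | h
        · simp [Int.negOnePow_add, Int.negOnePow_even _ h, h2]; abel
        · simp [Int.negOnePow_add, Int.negOnePow_odd _ h, h2]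
      -- Injectivity on homology solves the equation in X: the right-hand side is a cycle, and its
      -- image under g is a boundary by `hdy`.
      obtain ⟨x, hx, hdx⟩ := hg.exists_d_eq hz hdz hy hdy
      have hdw : Y.d (b (E.basis e) + (k + 2).negOnePow • b' (P.d (E.basis e)) - g.1 x) = 0 := by
        rw [map_sub, hdy, ← g.2.2, hdx, sub_self]
      -- The equation in Y may still fail by a cycle. Surjectivity on homology writes this cycle as
      -- g x' plus a boundary with x' a cycle, and passing from x to x + x' leaves the equation in X
      -- intact.
      obtain ⟨x', hx', hdx', y, hy', hdy'⟩ :=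
        hg.exists_cycle (sub_mem hy (g.2.1 _ _ hx)) hdw
      refine ⟨(x + x', y), ?_, ?_, ?_, ?_⟩
      · rw [← add_assoc]; exact add_mem hx hx'
      · rwa [show E.degree e + (k + 2) = E.degree e + k + 1 + 1 by omega]
      · rw [map_add, hdx, hdx', add_zero]
      · rw [hdy', map_add]; abel
  exact ⟨a', b', E.isComm_of_basis (fun j => (key j).1) fun j => (key j).2.2.1,
    E.isComm_of_basis (fun j => (key j).2.1) fun j => (key j).2.2.2⟩

/-- Lifting along a quasi-isomorphism, up to homotopy. -/
lemma exists_htpy_lift (E : SemifreeBasis P) {X Y : DGMod B} {g : dgHom X Y} (hg : IsQuasiIso g) {f : P →ₗ[Bᵐᵒᵖ] Y}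
    (hf : f ∈ dgHom P Y) : ∃ a ∈ dgHom P X, ∃ h, IsHomotopy (f - g.1 ∘ₗ a) h := by
  -- With k = -1 and the zero map to X the datum is just the chain map f, and a contraction consists
  -- of a lift and a homotopy.
  obtain ⟨a, b, ha, hb⟩ := E.exists_lift hg (k := -1) (a := 0) (b := f) .zero
    (by rw [LinearMap.comp_zero]; exact mem_dgHom_iff.1 hf)
  exact ⟨a, mem_dgHom_iff.2 ha, b, isHomotopy_iff.2 hb⟩

/-- A map which becomes null-homotopic after a quasi-isomorphism is null-homotopic. -/
lemma exists_htpy_of_comp (E : SemifreeBasis P) {X Y : DGMod B} {g : dgHom X Y} (hg : IsQuasiIso g)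
    {f : P →ₗ[Bᵐᵒᵖ] X} (hf : f ∈ dgHom P X) {h : P →ₗ[Bᵐᵒᵖ] Y} (hh : IsHomotopy (g.1 ∘ₗ f) h) :
    ∃ h', IsHomotopy f h' := by
  -- With k = 0 the datum is f with a null-homotopy of g f, and the first component of a contraction
  -- is a null-homotopy of f.
  obtain ⟨a, b, ha, -⟩ := E.exists_lift hg (k := 0) (mem_dgHom_iff.1 hf) (isHomotopy_iff.1 hh)
  exact ⟨a, isHomotopy_iff.2 ha⟩

end SemifreeBasis

/-! ### Semifree modules over `B` are semifree over `A` -/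

section Restrict

variable (φ : DGAlg.Hom A B)

/-- If `B` is semifree over `A`, then semifree modules over `B` are semifree over `A`. -/
def SemifreeBasis.restrict (F : SemifreeBasis (DGMod.restrict φ (DGMod.self B))) {N : DGMod B}
    (E : SemifreeBasis N) : SemifreeBasis (DGMod.restrict φ N) :=
  letI m1 : Module Aᵐᵒᵖ Bᵐᵒᵖ := Module.compHom Bᵐᵒᵖ (RingHom.op φ.toAlgHom.toRingHom)
  letI m2 : Module Aᵐᵒᵖ N := Module.compHom N (RingHom.op φ.toAlgHom.toRingHom)
  haveI : IsScalarTower Aᵐᵒᵖ Bᵐᵒᵖ N := ⟨fun a b x => mul_smul (op (φ.toAlgHom a.unop)) b x⟩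
  let b : Module.Basis F.ι Aᵐᵒᵖ Bᵐᵒᵖ := F.basis.map
    { MulOpposite.opAddEquiv with map_smul' := fun a (x : B) => rfl }
  -- Products e β of basis elements, ordered lexicographically with the index of e first. Then d(e
  -- β) = d(e) β ± e d(β) goes down: its first term in the index of e, its second in the index of β
  -- with e fixed.
  let c : Module.Basis (E.ι ×ₗ F.ι) Aᵐᵒᵖ N :=
    (b.smulTower E.basis).reindex ((Equiv.prodComm _ _).trans toLex)
  have hrepr : ∀ x p, c.repr x p = b.repr (E.basis.repr x (ofLex p).1) (ofLex p).2 :=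
    fun x p => by
      rw [Module.Basis.repr_reindex_apply, Module.Basis.smulTower_repr]; rfl
  have hbas : ∃ β : F.ι → B, (∀ i, β i ∈ B.deg (F.degree i)) ∧
      (∀ i j, b.repr (op (B.d (β i))) j ≠ 0 → j < i) ∧
      ∀ p, c p = op (β (ofLex p).2) • E.basis (ofLex p).1 :=
    ⟨F.basis, F.mem_deg, F.d_lt, fun p => by
      rw [Module.Basis.reindex_apply, Module.Basis.smulTower_apply]; rfl⟩
  { ι := E.ι ×ₗ F.ι
    basis := c
    degree := fun p => E.degree (ofLex p).1 + F.degree (ofLex p).2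
    mem_deg := fun p => by
      obtain ⟨β, hβ, -, h⟩ := hbas
      change c p ∈ N.deg _
      rw [h]
      exact N.smul_mem _ _ _ _ (E.mem_deg _) (hβ _)
    d_lt := fun p q h => by
      obtain ⟨β, -, hβ, hc⟩ := hbas
      have h1 : b.repr (E.basis.repr (N.d (c p)) (ofLex q).1) (ofLex q).2 ≠ 0 := by
        rw [← hrepr]; exact h
      rw [hc, N.leibniz', sgn_of_mem _ (E.mem_deg _)] at h1
      rw [Prod.Lex.lt_iff]
      by_cases hpq : (ofLex q).1 = (ofLex p).1
      · refine Or.inr ⟨hpq, hβ _ _ fun h2 => h1 ?_⟩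
        have h3 : E.basis.repr (N.d (E.basis (ofLex p).1)) (ofLex p).1 = 0 :=
          not_not.1 fun h => (E.d_lt _ _ h).false
        rw [hpq, map_add, Finsupp.add_apply, map_smul, Finsupp.smul_apply, h3, smul_zero, zero_add,
          map_smul, Finsupp.smul_apply]
        rcases Int.units_eq_one_or (E.degree (ofLex p).1).negOnePow with he | he
        · rw [he, one_smul, Module.Basis.repr_self, Finsupp.single_eq_same, smul_eq_mul, mul_one, h2]
        · rw [he, Units.neg_smul, one_smul, map_neg, Finsupp.neg_apply, Module.Basis.repr_self,
            Finsupp.single_eq_same, smul_neg, smul_eq_mul, mul_one, map_neg, Finsupp.neg_apply, h2,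
            neg_zero]
      · refine Or.inl (E.d_lt _ _ fun h3 => h1 ?_)
        have h4 : E.basis.repr ((E.degree (ofLex p).1).negOnePow • E.basis (ofLex p).1)
            (ofLex q).1 = 0 := by
          rcases Int.units_eq_one_or (E.degree (ofLex p).1).negOnePow with he | he
          · rw [he, one_smul, Module.Basis.repr_self, Finsupp.single_eq_of_ne hpq]
          · rw [he, Units.neg_smul, one_smul, map_neg, Finsupp.neg_apply, Module.Basis.repr_self,
              Finsupp.single_eq_of_ne hpq, neg_zero]
        rw [map_add, Finsupp.add_apply, map_smul, Finsupp.smul_apply, h3, smul_zero, zero_add,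
          map_smul, Finsupp.smul_apply, h4, smul_zero, map_zero, Finsupp.zero_apply] }

end Restrict

end Lifting

/-! ### Homotopical finiteness of (N|_A ⊗_A B) ⊗_B T^i for perfect N. -/

section BaseChange

open DGMod

variable {A B : DGAlg.{u} R}

namespace DGMod

/-- The additive map out of a tensor product defined by a balanced biadditive map. -/
def tensorLiftAux {M : DGMod A} {L : DGBimod A B} {P : DGMod B} (f : M →+ L →+ P)
    (h : ∀ m (a : A) l, f (op a • m) l = f m (a • l)) : M.tensor L →+ P :=
  BTensor.lift (S := A) (M := M) (L := L) f h

/-- The linear map out of a tensor product defined by a balanced biadditive map. -/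
def tensorLift {M : DGMod A} {L : DGBimod A B} {P : DGMod B} (f : M →+ L →+ P)
    (h : ∀ m (a : A) l, f (op a • m) l = f m (a • l))
    (hl : ∀ m (b : Bᵐᵒᵖ) l, f m (b • l) = b • f m l) : M.tensor L →ₗ[Bᵐᵒᵖ] P :=
  { tensorLiftAux f h with
    map_smul' := fun b x => by
      change tensorLiftAux f h (b • x) = b • tensorLiftAux f h x
      induction x using induct_tmul with
      | tmul m l => exact hl m b l
      | add x y hx hy => rw [smul_add, map_add, map_add, hx, hy, smul_add] }

lemma tensorLift_tmul {M : DGMod A} {L : DGBimod A B} {P : DGMod B} (f : M →+ L →+ P)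
    (h : ∀ m (a : A) l, f (op a • m) l = f m (a • l))
    (hl : ∀ m (b : Bᵐᵒᵖ) l, f m (b • l) = b • f m l) (m : M) (l : L) :
    tensorLift f h hl (tmul m l) = f m l := rfl

lemma isComm_of_tmul {M : DGMod A} {L : DGBimod A B} {P : DGMod B} {k : ℤ}
    {f g : M.tensor L →ₗ[Bᵐᵒᵖ] P}
    (h : ∀ i j m l, m ∈ M.deg i → l ∈ L.deg j → f (tmul m l) ∈ P.deg (i + j + k))
    (h' : ∀ m l, P.d (f (tmul m l)) = g (tmul m l) + k.negOnePow • f ((M.tensor L).d (tmul m l))) :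
    IsComm k f g := by
  refine ⟨fun n x hx => ?_, fun x => ?_⟩
  · change x ∈ tensorDeg M L n at hx
    induction hx using AddSubgroup.closure_induction with
    | mem x hx =>
      obtain ⟨i, j, m, l, hm, hl, rfl, rfl⟩ := hx
      exact h i j m l hm hl
    | zero => exact (map_zero f).symm ▸ zero_mem _
    | add x y _ _ hx hy => exact (map_add f x y).symm ▸ add_mem hx hy
    | neg x _ hx => exact (map_neg f x).symm ▸ neg_mem hx
  · induction x using induct_tmul with
    | tmul m l => exact h' m l
    | add x y hx hy => simp only [map_add, hx, hy, smul_add]; abel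

lemma isComm_ofElem {N : DGMod B} {x : N} {n : ℤ} (hx : x ∈ N.deg n) :
    IsComm n (ofElem x) (ofElem (N.d x)) :=
  ⟨fun k b hb => by rw [add_comm]; exact N.smul_mem _ _ _ b hx hb, fun b => N.leibniz _ _ b hx⟩

lemma one_mem_deg (B : DGAlg.{u} R) : (1 : B) ∈ B.deg 0 := SetLike.GradedOne.one_mem

/-- The image of the identity is generated by 1, so the zero homotopy works. -/
lemma hFinite_self : HFinite (DGMod.self B) := by
  refine ⟨0, 0, .zero, Submodule.span Bᵐᵒᵖ {(1 : B)}, Submodule.fg_span_singleton _, fun b => ?_⟩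
  refine Submodule.mem_span_singleton.2 ⟨op (α := B) b, ?_⟩
  rw [sub_zero]
  exact @one_mul B _ b

lemma sgn_self (x : B) : sgn (DGMod.self B).deg x = (B.twist x : B) := by
  change _ = sgn (M := B) B.deg x
  induction x using induct (DGMod.self B).deg with
  | hom n x hx =>
    rw [sgn_of_mem (DGMod.self B).deg hx]
    exact (sgn_of_mem (M := B) B.deg (n := n) hx).symm
  | add x y hx hy =>
    exact (map_add _ x y).trans ((congrArg₂ (· + ·) hx hy).trans
      (map_add (sgn (M := B) B.deg) x y).symm)

lemma leibniz_mul (a b : B) : B.d (a * b) = B.d a * b + B.twist a * B.d b :=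
  ((DGMod.self B).leibniz' a b).trans
    (congrArg (fun t : B => B.d a * b + t * B.d b) (sgn_self a))

variable (φ : DGAlg.Hom A B)

lemma map_twist (a : A) : φ.toAlgHom (A.twist a) = B.twist (φ.toAlgHom a) := by
  change φ.toAlgHom (sgn A.deg a) = sgn B.deg (φ.toAlgHom a)
  induction a using induct A.deg with
  | hom n a ha =>
    rw [sgn_of_mem _ ha, sgn_of_mem _ (φ.map_mem n a ha)]
    rcases Int.units_eq_one_or n.negOnePow with h | h <;> simp [h]
  | add a b ha hb => simp only [map_add, ha, hb]

/-- The pure tensors in `A ⊗_A B`. -/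
def atmul (a : A) (b : B) : (DGMod.self A).tensor (DGBimod.ofHom φ) :=
  tmul (M := DGMod.self A) (L := DGBimod.ofHom φ) a b

lemma atmul_eq (a : A) (b : B) : atmul φ a b = atmul φ 1 (φ.toAlgHom a * b) := by
  have h := smul_tmul (M := DGMod.self A) (L := DGBimod.ofHom φ) (1 : A) a b
  have h1 : atmul φ (1 * a) b = atmul φ 1 (φ.toAlgHom a * b) := h
  rwa [one_mul] at h1

lemma op_smul_atmul (a : A) (b c : B) : op c • atmul φ a b = atmul φ a (b * c) := rfl

lemma d_atmul (a : A) (b : B) : ((DGMod.self A).tensor (DGBimod.ofHom φ)).d (atmul φ a b) =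
    atmul φ (A.d a) b + atmul φ (A.twist a) (B.d b) :=
  congrArg (fun t : A => atmul φ (A.d a) b + atmul φ t (B.d b)) (sgn_self a)

lemma atmul_mem {a : A} {b : B} {i j : ℤ} (ha : a ∈ A.deg i) (hb : b ∈ B.deg j) :
    atmul φ a b ∈ ((DGMod.self A).tensor (DGBimod.ofHom φ)).deg (i + j) :=
  tmul_mem_deg (M := DGMod.self A) (L := DGBimod.ofHom φ) ha hb

lemma d_atmul_one : ((DGMod.self A).tensor (DGBimod.ofHom φ)).d (atmul φ 1 1) = 0 := by
  rw [d_atmul, A.d_one, B.d_one]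
  exact (congrArg₂ (· + ·) (zero_tmul (M := DGMod.self A) (L := DGBimod.ofHom φ) (1 : B))
    (tmul_zero (M := DGMod.self A) (L := DGBimod.ofHom φ) _)).trans (add_zero _)

/-- The biadditive map underlying `A ⊗_A B → B`. -/
def selfTensorBi : DGMod.self A →+ DGBimod.ofHom φ →+ DGMod.self B :=
  AddMonoidHom.mk' (fun a : A => AddMonoidHom.mk' (fun b : B => (φ.toAlgHom a * b : B))
      (fun x y : B => mul_add (φ.toAlgHom a) x y))
    (fun x y : A => by
      refine DFunLike.ext _ _ fun b : B => ?_
      exact (congrArg (fun t : B => t * b) (map_add φ.toAlgHom x y)).trans (add_mul _ _ _))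

/-- The map `A ⊗_A B → B`. -/
def selfTensorMap : (DGMod.self A).tensor (DGBimod.ofHom φ) →ₗ[Bᵐᵒᵖ] DGMod.self B :=
  tensorLift (M := DGMod.self A) (L := DGBimod.ofHom φ) (P := DGMod.self B) (selfTensorBi φ)
    (fun (m : A) (a : A) (l : B) => by
      change φ.toAlgHom (m * a) * l = φ.toAlgHom m * (φ.toAlgHom a * l)
      rw [map_mul, mul_assoc])
    (fun (m : A) (b : Bᵐᵒᵖ) (l : B) => (mul_assoc (φ.toAlgHom m) l b.unop).symm)

lemma selfTensorMap_atmul (a : A) (b : B) :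
    selfTensorMap φ (atmul φ a b) = (φ.toAlgHom a * b : B) := rfl

lemma isComm_selfTensorMap : IsComm 0 (selfTensorMap φ) 0 := by
  refine isComm_of_tmul (fun i j (m : A) (l : B) hm (hl : l ∈ B.deg j) => ?_)
    fun (m : A) (l : B) => ?_
  · rw [add_zero]
    have h : φ.toAlgHom m * l ∈ B.deg (i + j) := SetLike.GradedMul.mul_mem (φ.map_mem i m hm) hl
    exact h
  · rw [LinearMap.zero_apply, zero_add, Int.negOnePow_zero, one_smul]
    refine Eq.trans ?_ (congrArg (selfTensorMap φ) (d_atmul φ m l)).symm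
    rw [map_add, selfTensorMap_atmul, selfTensorMap_atmul, φ.map_d, map_twist]
    exact leibniz_mul (φ.toAlgHom m) l

/-- A ⊗_A B is isomorphic to B by multiplication and b ↦ 1 ⊗ b; only the composite on A ⊗_A B is
needed to get a retract. -/
lemma HFinite.pow_self_tensor {i : ℕ} (h : HFinite (tensorPow φ (DGMod.self B) i)) :
    HFinite (tensorPow φ ((DGMod.self A).tensor (DGBimod.ofHom φ)) i) := by
  have h1 : IsComm 0 (ofElem (atmul φ 1 1)) 0 := by
    refine (isComm_ofElem (atmul_mem φ (one_mem_deg A) (one_mem_deg B))).congr_comm ?_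
    rw [d_atmul_one]
    exact self_hom_ext fun b => smul_zero _
  refine h.of_strict_retract ((isComm_selfTensorMap φ).powMap φ i |>.congr_comm (powMap_zero φ i))
    ((h1.powMap φ i).congr_comm (powMap_zero φ i)) ?_
  rw [← powMap_comp]
  refine (congrArg (powMap φ · i) (tensor_hom_ext fun (a : A) (b : B) => ?_)).trans (powMap_id φ i)
  change ofElem (atmul φ 1 1) (selfTensorMap φ (atmul φ a b)) = atmul φ a b
  rw [selfTensorMap_atmul, ofElem_apply, op_smul_atmul, one_mul, ← atmul_eq]

/-- F is built from finitely many shifts of A, so the module in question is built from shifts of (A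
⊗_A B) ⊗_B T^i. The inclusions and coordinates of the basis, transported by this additive functor,
form the triangular system of `HFinite.of_triangular`. -/
lemma HFinite.pow_tensor_of_finite {i : ℕ} (h : HFinite (tensorPow φ (DGMod.self B) i))
    {F : DGMod A} (E : SemifreeBasis F) [Finite E.ι] :
    HFinite (tensorPow φ (F.tensor (DGBimod.ofHom φ)) i) := by
  have := Fintype.ofFinite E.ι
  let T : ∀ {X Y : DGMod A}, (X →ₗ[Aᵐᵒᵖ] Y) → (tensorPow φ (X.tensor (DGBimod.ofHom φ)) i →ₗ[Bᵐᵒᵖ]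
    tensorPow φ (Y.tensor (DGBimod.ofHom φ)) i) := fun f => powMap φ (tensorMap f _) i
  have T0 : ∀ {X Y : DGMod A}, T (0 : X →ₗ[Aᵐᵒᵖ] Y) = 0 := fun {X Y} =>
    (congrArg (powMap φ · i) (tensorMap_zero _)).trans (powMap_zero φ i)
  have T1 : ∀ {X : DGMod A}, T (LinearMap.id : X →ₗ[Aᵐᵒᵖ] X) = LinearMap.id := fun {X} =>
    (congrArg (powMap φ · i) (tensorMap_id _)).trans (powMap_id φ i)
  have Tc : ∀ {X Y Z : DGMod A} (g : Y →ₗ[Aᵐᵒᵖ] Z) (f : X →ₗ[Aᵐᵒᵖ] Y),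
      T g ∘ₗ T f = T (g ∘ₗ f) := fun g f => by
    simp only [T]
    rw [tensorMap_comp, powMap_comp]
  have Tadd : ∀ {X Y : DGMod A} (f g : X →ₗ[Aᵐᵒᵖ] Y), T (f + g) = T f + T g := fun f g => by
    simp only [T]
    rw [tensorMap_add, powMap_add]
  have Ts : ∀ {X Y : DGMod A} (f : E.ι → (X →ₗ[Aᵐᵒᵖ] Y)), T (∑ e, f e) = ∑ e, T (f e) :=
    fun {X Y} f => map_sum (AddMonoidHom.mk' (T (X := X) (Y := Y)) Tadd) f Finset.univ
  have hc := fun e => exists_isComm (E.coord e) (E.coord_degree e)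
  choose c' hc' using hc
  refine (HFinite.pow_self_tensor φ h).of_triangular E.degree (fun e => T (E.incl e))
    (fun e => T (E.dIncl e)) (fun e => T (E.coord e)) (fun e => T (c' e))
    (fun e => ((E.isComm_incl e).tensorMap _).powMap φ i)
    (fun e => ((hc' e).tensorMap _).powMap φ i) (fun e => ?_) (fun e e' he => ?_) ?_
    (fun e e' he => ?_)
  · rw [Tc, E.coord_comp_incl_same, T1]
  · rw [Tc, E.coord_comp_incl_ne he, T0]
  · rw [Finset.sum_congr rfl fun e _ => Tc _ _, ← Ts, E.sum_incl_coord, T1]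
  · rw [Tc, E.coord_comp_dIncl he, T0]

/-- A linear map over `B`, regarded as a linear map over `A`. -/
def restrictMap {M N : DGMod B} (f : M →ₗ[Bᵐᵒᵖ] N) : restrict φ M →ₗ[Aᵐᵒᵖ] restrict φ N :=
  { f.toAddMonoidHom with map_smul' := fun a x => f.map_smul (op (φ.toAlgHom a.unop)) x }

lemma IsComm.restrictMap {M N : DGMod B} {k : ℤ} {f g : M →ₗ[Bᵐᵒᵖ] N} (h : IsComm k f g) :
    IsComm k (restrictMap φ f) (restrictMap φ g) := ⟨h.1, h.2⟩

/-- `N|_A ⊗_A B ⊗_B T^i` is homotopically finite if `N` is perfect and semifree over `A`. -/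
lemma HFinite.pow_baseChange {i : ℕ} (h : HFinite (tensorPow φ (DGMod.self B) i)) {N : DGMod B}
    (E : SemifreeBasis (restrict φ N)) (hN : IsPerfect (restrict φ N)) :
    HFinite (tensorPow φ (baseChange φ N) i) := by
  obtain ⟨F, EF, f, hF, hf⟩ := hN
  -- Semifreeness over A lifts the identity of N|_A through f, making N|_A a homotopy retract of the
  -- finite semifree module F. Tensoring preserves this.
  obtain ⟨a, ha, k, hk⟩ := E.exists_htpy_lift hf (id_mem _)
  have h1 := HFinite.pow_tensor_of_finite φ h EF
  have ha' := (((mem_dgHom_iff.1 ha).tensorMap (DGBimod.ofHom φ)).powMap φ i).congr_comm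
    ((congrArg (powMap φ · i) (tensorMap_zero _)).trans (powMap_zero φ i))
  have hf' := (((mem_dgHom_iff.1 f.2).tensorMap (DGBimod.ofHom φ)).powMap φ i).congr_comm
    ((congrArg (powMap φ · i) (tensorMap_zero _)).trans (powMap_zero φ i))
  refine h1.of_retract ha' hf' ((((isHomotopy_iff.1 hk).tensorMap (DGBimod.ofHom φ)).powMap
    φ i).congr_comm ?_)
  rw [sub_eq_add_neg, tensorMap_add, tensorMap_neg, powMap_add, powMap_neg, tensorMap_comp,
    powMap_comp, tensorMap_id, powMap_id, sub_eq_add_neg]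
  rfl

end DGMod

end BaseChange

/-! ### The map κ : N ⊗_B ΣJ → N|_A ⊗_A B and finiteness of B ⊗_B T^i. -/

section DiagonalAction

open DGMod

variable {A B : DGAlg.{u} R}

namespace DGBimod

variable (M : DGBimod A B)

/-- The identification `x ↦ Σ x` of the underlying groups of `M` and `Σ M`. -/
def suspMk : M →+ M.susp := AddMonoidHom.id M.carrier

/-- The identification `Σ x ↦ x` of the underlying groups of `Σ M` and `M`. -/
def suspVal : M.susp →+ M := AddMonoidHom.id M.carrier

lemma suspMk_suspVal (x : M.susp) : M.suspMk (M.suspVal x) = x := rfl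

lemma op_smul_suspMk (b : Bᵐᵒᵖ) (x : M) : b • M.suspMk x = M.suspMk (b • x) := rfl

lemma smul_suspMk (a : A) (x : M) : a • M.suspMk x = M.suspMk (A.twist a • x) := rfl

lemma d_suspMk (x : M) : M.susp.d (M.suspMk x) = - M.suspMk (M.d x) := by
  change Int.negOnePow 1 • M.d x = - M.d x
  rw [Int.negOnePow_one, Units.neg_smul, one_smul]

lemma suspMk_mem {x : M} {n : ℤ} (hx : x ∈ M.deg n) : M.suspMk x ∈ M.susp.deg (n + 1) := by
  change x ∈ M.deg (n + 1 - 1)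
  rwa [add_sub_cancel_right]

lemma suspVal_mem {x : M.susp} {n : ℤ} (hx : x ∈ M.susp.deg n) :
    M.suspVal x ∈ M.deg (n - 1) := hx

end DGBimod

namespace DGMod

variable (φ : DGAlg.Hom A B)

/-! ### The action of the diagonal ideal -/

/-- The map `B ⊗_A B → N|_A ⊗_A B`, `b ⊗ b' ↦ x b ⊗ b'`. -/
def envAct {N : DGMod B} (x : N) : envBimod φ →ₗ[Bᵐᵒᵖ] baseChange φ N :=
  tensorMap (restrictMap φ (ofElem x)) (DGBimod.ofHom φ)

lemma envAct_emul {N : DGMod B} (x : N) (a b : B) :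
    envAct φ x (emul φ a b) = bmul φ (op a • x) b := rfl

lemma add_bmul {N : DGMod B} (x y : N) (b : B) : bmul φ (x + y) b = bmul φ x b + bmul φ y b :=
  add_tmul (M := restrict φ N) (L := DGBimod.ofHom φ) x y b

lemma neg_bmul {N : DGMod B} (x : N) (b : B) : bmul φ (-x) b = - bmul φ x b :=
  neg_tmul (M := restrict φ N) (L := DGBimod.ofHom φ) x b

lemma bmul_mem {N : DGMod B} {x : N} {b : B} {i j : ℤ} (hx : x ∈ N.deg i) (hb : b ∈ B.deg j) :
    bmul φ x b ∈ (baseChange φ N).deg (i + j) :=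
  tmul_mem_deg (M := restrict φ N) (L := DGBimod.ofHom φ) hx hb

lemma d_bmul {N : DGMod B} (x : N) (b : B) : (baseChange φ N).d (bmul φ x b) =
    bmul φ (N.d x) b + bmul φ (sgn N.deg x) (B.d b) := rfl

lemma op_smul_bmul {N : DGMod B} (x : N) (b c : B) :
    op c • bmul φ x b = bmul φ x (b * c) := rfl

lemma envAct_add {N : DGMod B} (x y : N) (z : envBimod φ) :
    envAct φ (x + y) z = envAct φ x z + envAct φ y z := by
  induction z using env_induct with
  | emul a b => rw [envAct_emul, envAct_emul, envAct_emul, smul_add, add_bmul]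
  | add z w hz hw =>
    rw [map_add, map_add, map_add, hz, hw]; abel

lemma envAct_neg {N : DGMod B} (x : N) (z : envBimod φ) :
    envAct φ (-x) z = - envAct φ x z := by
  induction z using env_induct with
  | emul a b => rw [envAct_emul, envAct_emul, smul_neg, neg_bmul]
  | add z w hz hw => rw [map_add, map_add, hz, hw]; abel

lemma envAct_smul {N : DGMod B} (x : N) (b : B) (z : envBimod φ) :
    envAct φ (op b • x) z = envAct φ x (b • z) := by
  induction z using env_induct with
  | emul a c => rw [smul_emul, envAct_emul, envAct_emul, MulOpposite.op_mul, mul_smul]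
  | add z w hz hw => rw [smul_add, map_add, map_add, hz, hw]

lemma d_envAct {N : DGMod B} (x : N) (z : envBimod φ) : (baseChange φ N).d (envAct φ x z) =
    envAct φ (N.d x) z + envAct φ (sgn N.deg x) ((envBimod φ).d z) := by
  induction z using env_induct with
  | emul a b =>
    rw [envAct_emul, d_bmul, emul_d, map_add, envAct_emul, envAct_emul, envAct_emul, N.leibniz',
      N.sgn_smul, add_bmul, add_assoc]
  | add z w hz hw => simp only [map_add, hz, hw]; abel

lemma envAct_mem {N : DGMod B} {x : N} {i j : ℤ} (hx : x ∈ N.deg i) {z : envBimod φ}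
    (hz : z ∈ (envBimod φ).deg j) : envAct φ x z ∈ (baseChange φ N).deg (i + j) := by
  rw [add_comm]
  exact (((isComm_ofElem hx).restrictMap φ).tensorMap (DGBimod.ofHom φ)).1 j z hz

lemma piMap_envAct {N : DGMod B} (x : N) (z : envBimod φ) :
    (piMap φ N).1 (envAct φ x z) = ofElem x ((mulMap φ).1 z) := by
  induction z using env_induct with
  | emul a b =>
    rw [mulMap_emul, envAct_emul]
    change op b • op a • x = op (a * b) • x
    rw [MulOpposite.op_mul, mul_smul]
  | add z w hz hw =>
    rw [map_add, map_add, hz, hw]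
    exact (map_add (ofElem x) _ _).symm.trans (congrArg _ (map_add (mulMap φ).1 z w).symm)

/-- The pure tensor `x ⊗ Σ z` in `N ⊗_B Σ J`. -/
def jtmul {N : DGMod B} (x : N) (z : diagonal φ) : N.tensor (suspDiagonal φ) :=
  tmul (L := suspDiagonal φ) x ((diagonal φ).suspMk z)

lemma jtmul_add {N : DGMod B} (x : N) (z w : diagonal φ) :
    jtmul φ x (z + w) = jtmul φ x z + jtmul φ x w := by
  rw [jtmul, map_add]
  exact tmul_add _ _ _

lemma zero_jtmul {N : DGMod B} (z : diagonal φ) :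
    jtmul φ (0 : N) z = 0 := zero_tmul _

lemma jtmul_smul {N : DGMod B} (x : N) (b : B) (z : diagonal φ) :
    jtmul φ (op b • x) z = jtmul φ x (B.twist b • z) := by
  rw [jtmul, jtmul, smul_tmul, DGBimod.smul_suspMk]

lemma op_smul_jtmul {N : DGMod B} (x : N) (b : Bᵐᵒᵖ) (z : diagonal φ) :
    b • jtmul φ x z = jtmul φ x (b • z) := by
  rw [jtmul, jtmul, ← DGBimod.op_smul_suspMk, op_smul_tmul]

lemma d_jtmul {N : DGMod B} (x : N) (z : diagonal φ) :
    (N.tensor (suspDiagonal φ)).d (jtmul φ x z) =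
      jtmul φ (N.d x) z - jtmul φ (sgn N.deg x) ((diagonal φ).d z) := by
  rw [jtmul, d_tmul, DGBimod.d_suspMk, tmul_neg, ← sub_eq_add_neg]
  rfl

lemma jtmul_mem {N : DGMod B} {x : N} {z : diagonal φ} {i j : ℤ} (hx : x ∈ N.deg i)
    (hz : z ∈ (diagonal φ).deg j) :
    jtmul φ x z ∈ (N.tensor (suspDiagonal φ)).deg (i + (j + 1)) :=
  tmul_mem_deg hx ((diagonal φ).suspMk_mem hz)

lemma jtmul_hom_ext {N P : DGMod B} {f g : N.tensor (suspDiagonal φ) →ₗ[Bᵐᵒᵖ] P}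
    (h : ∀ x z, f (jtmul φ x z) = g (jtmul φ x z)) : f = g := tensor_hom_ext fun x c => by
  have := h x ((diagonal φ).suspVal c)
  rwa [jtmul, DGBimod.suspMk_suspVal] at this

lemma isComm_of_jtmul {N P : DGMod B} {k : ℤ} {f g : N.tensor (suspDiagonal φ) →ₗ[Bᵐᵒᵖ] P}
    (h : ∀ i j x z, x ∈ N.deg i → z ∈ (diagonal φ).deg j → f (jtmul φ x z) ∈ P.deg (i + j + 1 + k))
    (h' : ∀ x z, P.d (f (jtmul φ x z)) =
      g (jtmul φ x z) + k.negOnePow • f ((N.tensor (suspDiagonal φ)).d (jtmul φ x z))) :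
    IsComm k f g := by
  refine isComm_of_tmul (fun i j x c hx hc => ?_) fun x c => ?_
  · have := h i (j - 1) x _ hx ((diagonal φ).suspVal_mem hc)
    rwa [jtmul, DGBimod.suspMk_suspVal, show i + (j - 1) + 1 + k = i + j + k by omega] at this
  · have := h' x ((diagonal φ).suspVal c)
    rwa [jtmul, DGBimod.suspMk_suspVal] at this

/-- The inclusion of the diagonal ideal. -/
def diagonalVal : diagonal φ →+ envBimod φ :=
  AddMonoidHom.mk' (fun z => z.1) fun _ _ => rfl

lemma diagonalVal_smul (b : B) (z : diagonal φ) :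
    diagonalVal φ (b • z) = b • diagonalVal φ z := rfl

lemma diagonalVal_op_smul (b : Bᵐᵒᵖ) (z : diagonal φ) :
    diagonalVal φ (b • z) = b • diagonalVal φ z := rfl

lemma diagonalVal_d (z : diagonal φ) :
    diagonalVal φ ((diagonal φ).d z) = (envBimod φ).d (diagonalVal φ z) := rfl

lemma diagonalVal_mem {z : diagonal φ} {n : ℤ} (hz : z ∈ (diagonal φ).deg n) :
    diagonalVal φ z ∈ (envBimod φ).deg n := hz

lemma mulMap_diagonalVal (z : diagonal φ) : (mulMap φ).1 (diagonalVal φ z) = 0 := z.2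

/-- The biadditive map underlying `kappa`. -/
def kappaBi (N : DGMod B) : N →+ suspDiagonal φ →+ baseChange φ N :=
  AddMonoidHom.mk' (fun x => (envAct φ (sgn N.deg x)).toAddMonoidHom.comp
      ((diagonalVal φ).comp (diagonal φ).suspVal))
    (fun x y => by
      ext z
      exact (congrArg (envAct φ · _) (map_add (sgn N.deg) x y)).trans (envAct_add φ _ _ _))

lemma kappaBi_suspMk {N : DGMod B} (x : N) (z : diagonal φ) :
    kappaBi φ N x ((diagonal φ).suspMk z) = envAct φ (sgn N.deg x) (diagonalVal φ z) := rfl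

/-- The map `N ⊗_B Σ J → N|_A ⊗_A B`, `x ⊗ Σ z ↦ (-1)^|x| x z`, of degree `-1`. -/
def kappa (N : DGMod B) : N.tensor (suspDiagonal φ) →ₗ[Bᵐᵒᵖ] baseChange φ N :=
  tensorLift (M := N) (L := suspDiagonal φ) (kappaBi φ N)
    (fun x b c => by
      rw [← DGBimod.suspMk_suspVal _ c, DGBimod.smul_suspMk, kappaBi_suspMk, kappaBi_suspMk,
        N.sgn_smul, envAct_smul, diagonalVal_smul])
    (fun x b c => by
      rw [← DGBimod.suspMk_suspVal _ c, DGBimod.op_smul_suspMk, kappaBi_suspMk, kappaBi_suspMk,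
        diagonalVal_op_smul]
      exact map_smul (envAct φ (sgn N.deg x)) b _)

lemma kappa_jtmul {N : DGMod B} (x : N) (z : diagonal φ) :
    kappa φ N (jtmul φ x z) = envAct φ (sgn N.deg x) (diagonalVal φ z) := by
  rw [jtmul, kappa, tensorLift_tmul, kappaBi_suspMk]

/-- The sign (-1)^|x| in κ, which makes it balanced for the twisted left action on ΣJ, also accounts
for the sign of the differential on ΣJ: d κ = -κ d, as befits a chain map of degree -1. -/
lemma isComm_kappa (N : DGMod B) : IsComm (-1) (kappa φ N) 0 := by
  refine isComm_of_jtmul φ (fun i j x z hx hz => ?_) fun x z => ?_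
  · rw [kappa_jtmul, show i + j + 1 + -1 = i + j by omega]
    exact envAct_mem φ (sgn_mem _ hx) (diagonalVal_mem φ hz)
  · rw [LinearMap.zero_apply, zero_add, d_jtmul, map_sub, kappa_jtmul, kappa_jtmul, kappa_jtmul,
      d_envAct, sgn_sgn, N.sgn_d, envAct_neg, Int.negOnePow_neg, Int.negOnePow_one, Units.neg_smul,
      one_smul, neg_sub, sub_neg_eq_add, add_comm, diagonalVal_d]

/-- π_N(x z) = x π_B(z), and J is the kernel of π_B. -/
lemma piMap_comp_kappa (N : DGMod B) : (piMap φ N).1 ∘ₗ kappa φ N = 0 :=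
  jtmul_hom_ext φ fun x z => by
    rw [LinearMap.comp_apply, kappa_jtmul, piMap_envAct, mulMap_diagonalVal, map_zero]
    rfl

/-- The map `B → B ⊗_A B`, `b ↦ 1 ⊗ b`. -/
def rightUnit : DGMod.self B →ₗ[Bᵐᵒᵖ] (envBimod φ).toDGMod :=
  ofElem (N := (envBimod φ).toDGMod) (emul φ 1 1)

lemma rightUnit_apply (b : B) : rightUnit φ b = emul φ 1 b := by
  refine (op_smul_emul φ b 1 1).trans ?_
  rw [one_mul]

lemma mulMap_rightUnit (b : DGMod.self B) : (mulMap φ).1 (rightUnit φ b) = b := by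
  refine (congrArg (mulMap φ).1 (rightUnit_apply φ b)).trans ?_
  exact (mulMap_emul φ 1 b).trans (@one_mul B _ b)

lemma isComm_rightUnit : IsComm 0 (rightUnit φ) 0 := by
  have h1 : emul φ 1 1 ∈ (envBimod φ).deg (0 + 0) :=
    bmul_mem φ (N := DGMod.self B) (one_mem_deg B) (one_mem_deg B)
  rw [add_zero] at h1
  have h2 : (envBimod φ).d (emul φ 1 1) = 0 := by
    rw [emul_d, B.d_one, emul_zero, zero_emul, add_zero]
  refine (isComm_ofElem (N := (envBimod φ).toDGMod) h1).congr_comm ?_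
  rw [h2]
  exact self_hom_ext fun b => smul_zero _

/-- The idempotent endomorphism `z ↦ z - 1 ⊗ π(z)` of `B ⊗_A B`. -/
def diagonalProj : (envBimod φ).toDGMod →ₗ[Bᵐᵒᵖ] (envBimod φ).toDGMod :=
  LinearMap.id - rightUnit φ ∘ₗ (mulMap φ).1

lemma mulMap_diagonalProj (z : envBimod φ) : (mulMap φ).1 (diagonalProj φ z) = 0 := by
  refine (map_sub (mulMap φ).1 z (rightUnit φ ((mulMap φ).1 z))).trans ?_
  rw [mulMap_rightUnit, sub_self]

lemma diagonalProj_of_mem {z : envBimod φ} (hz : (mulMap φ).1 z = 0) : diagonalProj φ z = z := by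
  change z - rightUnit φ ((mulMap φ).1 z) = z
  rw [hz, map_zero, sub_zero]

lemma diagonalProj_mem : diagonalProj φ ∈ dgHom (envBimod φ).toDGMod (envBimod φ).toDGMod :=
  sub_mem (id_mem _) (comp_mem (mem_dgHom_iff.2 (isComm_rightUnit φ)) (mulMap φ).2)

/-- The splitting `B ⊗_A B → J`, `z ↦ z - 1 ⊗ π(z)`. -/
def diagonalPart (z : envBimod φ) : diagonal φ := ⟨diagonalProj φ z, mulMap_diagonalProj φ z⟩

lemma diagonalPart_add (z w : envBimod φ) :
    diagonalPart φ (z + w) = diagonalPart φ z + diagonalPart φ w :=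
  Subtype.ext (map_add (diagonalProj φ) z w)

lemma diagonalPart_smul (b : Bᵐᵒᵖ) (z : envBimod φ) :
    diagonalPart φ (b • z) = b • diagonalPart φ z := Subtype.ext (map_smul (diagonalProj φ) b z)

lemma diagonalPart_d (z : envBimod φ) :
    diagonalPart φ ((envBimod φ).d z) = (diagonal φ).d (diagonalPart φ z) :=
  Subtype.ext ((diagonalProj_mem φ).2 z)

lemma diagonalPart_mem {z : envBimod φ} {n : ℤ} (hz : z ∈ (envBimod φ).deg n) :
    diagonalPart φ z ∈ (diagonal φ).deg n := (diagonalProj_mem φ).1 n z hz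

lemma diagonalPart_diagonalVal (z : diagonal φ) : diagonalPart φ (diagonalVal φ z) = z :=
  Subtype.ext (diagonalProj_of_mem φ z.2)

/-- The unit element of `B` as a module over itself. -/
def selfOne (B : DGAlg.{u} R) : DGMod.self B := (1 : B)

lemma selfOne_mem : selfOne B ∈ (DGMod.self B).deg 0 := one_mem_deg B

lemma d_selfOne : (DGMod.self B).d (selfOne B) = 0 := B.d_one

lemma op_smul_selfOne (b : B) : op b • selfOne B = b := one_mul b

/-- The map `B ⊗_A B → B ⊗_B Σ J`, `z ↦ 1 ⊗ Σ (z - 1 ⊗ π(z))`. -/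
def retraction : (envBimod φ).toDGMod →ₗ[Bᵐᵒᵖ] (DGMod.self B).tensor (suspDiagonal φ) where
  toFun z := jtmul φ (selfOne B) (diagonalPart φ z)
  map_add' z w := by rw [diagonalPart_add, jtmul_add]
  map_smul' b z := by
    rw [diagonalPart_smul, ← op_smul_jtmul]
    rfl

lemma retraction_apply (z : envBimod φ) :
    retraction φ z = jtmul φ (selfOne B) (diagonalPart φ z) := rfl

lemma isComm_retraction : IsComm 1 (retraction φ) 0 := by
  refine ⟨fun n z hz => ?_, fun z => ?_⟩
  · rw [retraction_apply, ← zero_add (n + 1)]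
    exact jtmul_mem φ selfOne_mem (diagonalPart_mem φ hz)
  · rw [retraction_apply, retraction_apply, d_jtmul, d_selfOne, zero_jtmul, zero_sub,
      sgn_of_mem _ selfOne_mem, Int.negOnePow_zero, one_smul, ← diagonalPart_d,
      LinearMap.zero_apply, zero_add, Int.negOnePow_one, Units.neg_smul, one_smul]

lemma kappa_self_jtmul (b : B) (z : diagonal φ) :
    kappa φ (DGMod.self B) (jtmul φ (N := DGMod.self B) b z) = diagonalVal φ (B.twist b • z) := by
  have h : ∀ (c : B) (w : envBimod φ), envAct φ (N := DGMod.self B) c w = c • w := fun c w => by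
    induction w using env_induct with
    | emul x y => rfl
    | add x y hx hy => exact (map_add _ x y).trans ((congrArg₂ _ hx hy).trans (smul_add c x y).symm)
  refine (kappa_jtmul φ (N := DGMod.self B) b z).trans ?_
  rw [sgn_self]
  exact h _ _

/-- For N = B the map π_B is split by the right linear chain map b ↦ 1 ⊗ b, so B ⊗_B ΣJ is, up to
shift, a direct summand of B ⊗_A B as a right DG module. The sign in κ is undone when the scalar
moves back across the tensor sign. -/
lemma retraction_comp_kappa : retraction φ ∘ₗ kappa φ (DGMod.self B) = LinearMap.id := by
  refine jtmul_hom_ext φ fun (b : B) z => ?_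
  have h := kappa_self_jtmul φ b z
  refine (congrArg (retraction φ) h).trans ?_
  rw [retraction_apply, diagonalPart_diagonalVal, ← jtmul_smul, op_smul_selfOne]
  rfl

/-- All `B ⊗_B T^i` are homotopically finite if `B` is perfect and semifree over `A`. -/
lemma hFinite_pow_self (F : SemifreeBasis (restrict φ (DGMod.self B)))
    (hB : IsPerfect (restrict φ (DGMod.self B))) (i : ℕ) :
    HFinite (tensorPow φ (DGMod.self B) i) := by
  induction i with
  | zero => exact hFinite_self
  | succ i ih =>
    -- (B ⊗_B ΣJ) ⊗_B T^i is a retract, up to shift, of (B|_A ⊗_A B) ⊗_B T^i. The latter is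
    -- homotopically finite by the inductive hypothesis and perfection of B over A.
    refine (ih.pow_baseChange φ F hB).of_strict_retract
      (((isComm_kappa φ (DGMod.self B)).powDown φ i).congr_comm (powDown_zero φ i))
      (((isComm_retraction φ).powUp φ i).congr_comm (powUp_zero φ i)) ?_
    exact powUp_comp_powDown φ _ _ (retraction_comp_kappa φ) i

end DGMod

end DiagonalAction

/-! ### ω_N as the obstruction to splitting π_N, and the factorization of the identity through its
iterates. -/

section UniversalSection

open DGMod

variable {A B : DGAlg.{u} R} (φ : DGAlg.Hom A B) {N : DGMod B}

namespace DGMod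

lemma sder_eq_suspMk (b : B) : sder φ b = (diagonal φ).suspMk (univDer φ b) := rfl

lemma envAct_univDer (x : N) (b : B) :
    envAct φ x (diagonalVal φ (univDer φ b)) = bmul φ (op b • x) 1 - bmul φ x b := by
  have h : diagonalVal φ (univDer φ b) = emul φ b 1 - emul φ 1 b := rfl
  rw [h, map_sub, envAct_emul, envAct_emul, MulOpposite.op_one, one_smul]

/-- The `B`-linear section of `π_N` with `e ↦ e ⊗ 1` for each basis element `e`. -/
def basisSection (E : SemifreeBasis N) : N →ₗ[Bᵐᵒᵖ] baseChange φ N :=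
  E.basis.constr ℕ fun j => bmul φ (E.basis j) 1

lemma basisSection_basis (E : SemifreeBasis N) (j : E.ι) :
    basisSection φ E (E.basis j) = bmul φ (E.basis j) 1 := E.basis.constr_basis ℕ _ _

lemma basisSection_smul (E : SemifreeBasis N) (j : E.ι) (b : B) :
    basisSection φ E (op b • E.basis j) = bmul φ (E.basis j) b := by
  rw [map_smul, basisSection_basis, op_smul_bmul, one_mul]

lemma piMap_comp_basisSection (E : SemifreeBasis N) :
    (piMap φ N).1 ∘ₗ basisSection φ E = LinearMap.id := E.hom_ext fun j => by
  rw [LinearMap.comp_apply, basisSection_basis]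
  exact one_smul _ (E.basis j)

/-- For x = e b the left side is e δ(b) = e b ⊗ 1 - e ⊗ b. It compares two additive sections of π_N:
x ↦ x ⊗ 1, which commutes with d but need not be B-linear, and `basisSection`, which is B-linear but
need not commute with d. -/
lemma kappa_omegaPre (E : SemifreeBasis N) (x : N) :
    kappa φ N (omegaPre φ E x) = bmul φ x 1 - basisSection φ E x := by
  induction x using SemifreeBasis.induct (E := E) with
  | zero =>
    have h : bmul φ (0 : N) 1 = 0 := zero_tmul (M := restrict φ N) (L := DGBimod.ofHom φ) _
    rw [map_zero, map_zero, map_zero, h, sub_zero]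
  | smul μ b =>
    have h : tmul (E.basis μ) (sder φ b) = jtmul φ (E.basis μ) (univDer φ b) := by
      rw [sder_eq_suspMk, jtmul]
    rw [omegaPre_smul, h, basisSection_smul]
    rcases Int.even_or_odd (E.degree μ) with h' | h'
    · rw [Int.negOnePow_even _ h', one_smul, kappa_jtmul, sgn_of_mem _ (E.mem_deg μ),
        Int.negOnePow_even _ h', one_smul, envAct_univDer]
    · rw [Int.negOnePow_odd _ h', Units.neg_smul, one_smul, map_neg, kappa_jtmul,
        sgn_of_mem _ (E.mem_deg μ), Int.negOnePow_odd _ h', Units.neg_smul, one_smul, envAct_neg,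
        neg_neg, envAct_univDer]
  | add x y hx hy => rw [map_add, map_add, map_add, hx, hy, add_bmul]; abel

/-- The differential of `basisSection` is `kappa ∘ omegaZero`. -/
lemma isComm_basisSection (E : SemifreeBasis N) :
    IsComm 0 (basisSection φ E) (kappa φ N ∘ₗ omegaZero φ E) := by
  refine E.isComm_of_basis (fun j => ?_) fun j => ?_
  · rw [basisSection_basis]
    exact bmul_mem φ (E.mem_deg j) (one_mem_deg B)
  -- Here d(e ⊗ 1) = d e ⊗ 1, and `kappa_omegaPre` at d e measures how far this is from the section
  -- applied to d e.
  · have h : omegaZero φ E (E.basis j) = omegaPre φ E (N.d (E.basis j)) :=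
      E.basis.constr_basis ℕ _ _
    have h0 : ∀ x : N, bmul φ x 0 = 0 := fun x =>
      tmul_zero (M := restrict φ N) (L := DGBimod.ofHom φ) x
    rw [LinearMap.comp_apply, h, kappa_omegaPre, basisSection_basis, d_bmul, B.d_one, h0,
      Int.negOnePow_zero, one_smul]
    abel

/-- As κ has degree -1, the differential of κ ∘ h is -κ ∘ ω, so `basisSection` + κ ∘ h is a chain
map. It remains a section because π_N κ = 0. -/
lemma naivelyLiftable_of_htpy (E : SemifreeBasis N) {h : N →ₗ[Bᵐᵒᵖ] N.tensor (suspDiagonal φ)}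
    (hh : IsHomotopy (omegaZero φ E) h) : NaivelyLiftable φ N := by
  have h1 := (isComm_kappa φ N).chain_comp (isHomotopy_iff.1 hh)
  have h2 := (isComm_basisSection φ E).add (h1.congr_deg (by norm_num))
  refine ⟨⟨_, mem_dgHom_iff.2 (h2.congr_comm ?_)⟩, ?_⟩
  · rw [Int.negOnePow_neg, Int.negOnePow_one, Units.neg_smul, one_smul, add_neg_cancel]
  · rw [LinearMap.comp_add, piMap_comp_basisSection, ← LinearMap.comp_assoc, piMap_comp_kappa,
      LinearMap.zero_comp, add_zero]

/-- The iterate `N → N ⊗_B T^n` of `omegaZero`. -/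
def omegaIter (E : SemifreeBasis N) : ∀ n, N →ₗ[Bᵐᵒᵖ] tensorPow φ N n
  | 0 => LinearMap.id
  | n + 1 => omegaPow φ E n ∘ₗ omegaIter E n

lemma omegaIter_mem (E : SemifreeBasis N) (n : ℕ) :
    omegaIter φ E n ∈ dgHom N (tensorPow φ N n) := by
  induction n with
  | zero => exact id_mem N
  | succ n ih => exact comp_mem (omegaPow_mem φ E n) ih

/-- Up to homotopy and maps of finite rank, the identity of `N` factors through `omegaIter n`. -/
lemma exists_factor_omegaIter (E : SemifreeBasis N)
    (hf : ∀ i, HFinite (tensorPow φ (baseChange φ N) i)) (i : ℕ) :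
    ∃ g c : tensorPow φ N i →ₗ[Bᵐᵒᵖ] N, IsComm 0 g c ∧ FiniteRank c ∧
      ∃ k b, IsComm 1 k b ∧ FiniteRank (LinearMap.id - g ∘ₗ omegaIter φ E i - b) := by
  induction i with
  | zero =>
    refine ⟨LinearMap.id, 0, .id N, .zero, 0, 0, .zero, ?_⟩
    exact (sub_self (LinearMap.id : N →ₗ[Bᵐᵒᵖ] N)).symm ▸ (sub_zero (0 : N →ₗ[Bᵐᵒᵖ] N)).symm ▸ .zero
  | succ i ih =>
    obtain ⟨g, c, hg, hc, k, b, hk, hb⟩ := ih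
    have hp : IsComm 0 (powMap φ (piMap φ N).1 i) 0 :=
      ((mem_dgHom_iff.1 (piMap φ N).2).powMap φ i).congr_comm (powMap_zero φ i)
    have hκ : IsComm (-1) (powDown φ (kappa φ N) i) 0 :=
      ((isComm_kappa φ N).powDown φ i).congr_comm (powDown_zero φ i)
    have hρ : IsComm 0 (powMap φ (basisSection φ E) i)
        (powDown φ (kappa φ N) i ∘ₗ omegaPow φ E i) :=
      ((isComm_basisSection φ E).powMap φ i).congr_comm (by
        rw [powMap_comp_down_up, omegaPow_eq_powUp])
    have hpρ : powMap φ (piMap φ N).1 i ∘ₗ powMap φ (basisSection φ E) i = LinearMap.id := by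
      rw [← powMap_comp, piMap_comp_basisSection, powMap_id]
    have hpκ : powMap φ (piMap φ N).1 i ∘ₗ powDown φ (kappa φ N) i = 0 := by
      rw [← powDown_comp, piMap_comp_kappa, powDown_zero]
    have hΦ : IsComm 0 (omegaIter φ E i) 0 := mem_dgHom_iff.1 (omegaIter_mem φ E i)
    -- g ∘ π is a chain map up to finite rank on a homotopically finite module, so there is an a
    -- with [d, a] = b' such that g ∘ π - b' has finite rank.
    obtain ⟨a, b', ha, hb'⟩ := (hf i).exists_htpy (hg.comp_chain hp) (hc.comp_right _)
    have ha := ha.congr_deg (show (1 : ℤ) + (0 + 0) = 1 by norm_num)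
    -- With ρ the basis section, [d, a ρ] = b' ρ - a κ ω, and b' ρ agrees with g π ρ = g up to
    -- finite rank. Thus g may be exchanged for a κ ω, and a κ is the map g of the next stage.
    have h1 := ((ha.comp hρ).comp_chain hΦ).congr_deg (show (0 : ℤ) + (0 + 1) = 1 by norm_num)
    refine ⟨a ∘ₗ powDown φ (kappa φ N) i, b' ∘ₗ powDown φ (kappa φ N) i,
      (ha.comp_chain hκ).congr_deg (by norm_num), ?_, _, _, hk.add h1, ?_⟩
    -- Since π κ = 0, the differential b' κ of a κ is minus the finite-rank map (g π - b') κ.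
    · have e : b' ∘ₗ powDown φ (kappa φ N) i =
          -((g ∘ₗ powMap φ (piMap φ N).1 i - b') ∘ₗ powDown φ (kappa φ N) i) := by
        rw [LinearMap.sub_comp, LinearMap.comp_assoc, hpκ, LinearMap.comp_zero, zero_sub, neg_neg]
      rw [e]
      exact (hb'.comp_right _).neg
    · have e : g = (g ∘ₗ powMap φ (piMap φ N).1 i) ∘ₗ powMap φ (basisSection φ E) i := by
        rw [LinearMap.comp_assoc, hpρ, LinearMap.comp_id]
      have e2 : LinearMap.id - (a ∘ₗ powDown φ (kappa φ N) i) ∘ₗ omegaIter φ E (i + 1) -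
          (b + (b' ∘ₗ powMap φ (basisSection φ E) i + Int.negOnePow 1 •
            (a ∘ₗ powDown φ (kappa φ N) i ∘ₗ omegaPow φ E i)) ∘ₗ omegaIter φ E i) =
          (LinearMap.id - g ∘ₗ omegaIter φ E i - b) +
          ((g ∘ₗ powMap φ (piMap φ N).1 i - b') ∘ₗ powMap φ (basisSection φ E) i) ∘ₗ
            omegaIter φ E i := by
        rw [LinearMap.sub_comp _ (g ∘ₗ powMap φ (piMap φ N).1 i), ← e, Int.negOnePow_one, Units.neg_smul, one_smul, LinearMap.sub_comp,
          LinearMap.add_comp, LinearMap.neg_comp]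
        have e3 : (a ∘ₗ powDown φ (kappa φ N) i) ∘ₗ omegaIter φ E (i + 1) =
          (a ∘ₗ powDown φ (kappa φ N) i ∘ₗ omegaPow φ E i) ∘ₗ omegaIter φ E i := rfl
        rw [e3]
        abel
      rw [e2]
      exact hb.add ((hb'.comp_right _).comp_right _)

/-- If some iterate of `omegaZero` is null-homotopic, then `N` is homotopically finite. -/
lemma hFinite_of_omegaIter_htpy (E : SemifreeBasis N)
    (hf : ∀ i, HFinite (tensorPow φ (baseChange φ N) i)) {n : ℕ}
    {h : N →ₗ[Bᵐᵒᵖ] tensorPow φ N n} (hh : IsHomotopy (omegaIter φ E n) h) : HFinite N := by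
  obtain ⟨g, c, hg, hc, k, b, hk, hb⟩ := exists_factor_omegaIter φ E hf n
  -- [d, g h] = c h + g ω^n, and c h has finite rank because c does. So the identity becomes
  -- null-homotopic up to finite rank.
  have h1 := hg.comp (isHomotopy_iff.1 hh)
  rw [Int.negOnePow_zero, one_smul, add_zero] at h1
  refine ⟨_, _, hk.add h1, ?_⟩
  have e : LinearMap.id - (b + (c ∘ₗ h + g ∘ₗ omegaIter φ E n)) =
      (LinearMap.id - g ∘ₗ omegaIter φ E n - b) - c ∘ₗ h := by abel
  rw [e]
  exact hb.sub (hc.comp_right h)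

/-- A right inverse of π_N exhibits N as a retract of the homotopically finite module N|_A ⊗_A B. -/
lemma hFinite_of_naivelyLiftable (hf : HFinite (baseChange φ N)) (h : NaivelyLiftable φ N) :
    HFinite N := by
  obtain ⟨ρ, hρ⟩ := h
  exact hf.of_strict_retract (mem_dgHom_iff.1 ρ.2)
    ((mem_dgHom_iff.1 (piMap φ N).2).congr_deg neg_zero.symm) hρ

/-- The modules `(N|_A ⊗_A B) ⊗_B T^i` are homotopically finite. -/
lemma _root_.AR1.hFinite_pow_baseChange (hφ : StandingAssumptions φ) (hN : AR1 φ N) (i : ℕ) :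
    HFinite (tensorPow φ (baseChange φ N) i) := by
  obtain ⟨F⟩ := hφ.semifree
  obtain ⟨E⟩ := hN.semifree
  exact (hFinite_pow_self φ F hN.perfect_algebra i).pow_baseChange φ (SemifreeBasis.restrict φ F E) hN.perfect

end DGMod

end UniversalSection

/-! ### From homotopical finiteness to a direct summand of a free module in D(B). -/

section FreeRetract

open DGMod

variable {A B : DGAlg.{u} R}

namespace DGMod

section DirectSum

variable {ι : Type} [DecidableEq ι] (X : ι → DGMod B)

/-- The inclusion of a summand. -/
def sumIncl (i : ι) : X i →ₗ[Bᵐᵒᵖ] directSum X := DirectSum.lof Bᵐᵒᵖ ι (fun i => (X i).carrier) i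

/-- The projection to a summand. -/
def sumProj (i : ι) : directSum X →ₗ[Bᵐᵒᵖ] X i :=
  DirectSum.component Bᵐᵒᵖ ι (fun i => (X i).carrier) i

lemma sumProj_comp_sumIncl_same (i : ι) : sumProj X i ∘ₗ sumIncl X i = LinearMap.id :=
  LinearMap.ext fun x => DirectSum.component.lof_self Bᵐᵒᵖ (M := fun i => (X i).carrier) i x

lemma sumProj_comp_sumIncl_ne {i j : ι} (h : i ≠ j) : sumProj X i ∘ₗ sumIncl X j = 0 :=
  LinearMap.ext fun x => DirectSum.of_eq_of_ne (β := fun i => (X i).carrier) _ _ x h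

lemma isComm_sumProj (i : ι) : IsComm 0 (sumProj X i) 0 :=
  mem_dgHom_iff.1 ⟨fun _ _ hx => hx i, fun _ => rfl⟩

lemma isComm_sumIncl (i : ι) : IsComm 0 (sumIncl X i) 0 := by
  refine mem_dgHom_iff.1 ⟨fun n x hx j => ?_, fun x => ?_⟩
  · by_cases h : i = j
    · subst h
      have := LinearMap.congr_fun (sumProj_comp_sumIncl_same X i) x
      change sumProj X i (sumIncl X i x) ∈ _
      rw [show sumProj X i (sumIncl X i x) = x from this]
      exact hx
    · have := LinearMap.congr_fun (sumProj_comp_sumIncl_ne X (Ne.symm h)) x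
      change sumProj X j (sumIncl X i x) ∈ _
      rw [show sumProj X j (sumIncl X i x) = 0 from this]
      exact zero_mem _
  · exact (DirectSum.map_of (fun i => (X i).d) i x).symm

lemma directSum_ext {x y : directSum X} (h : ∀ i, sumProj X i x = sumProj X i y) : x = y :=
  DFinsupp.ext h

end DirectSum

/-! ### The mapping cocone -/

/-- The mapping cocone of a homomorphism of DG modules. -/
def cocone {X N : DGMod B} (r : dgHom X N) : DGMod B where
  carrier := X × N
  deg n := (X.deg n).prod (N.deg (n + 1))
  graded := ofProj _ (fun n => (proj X.deg n).prodMap (proj N.deg (n + 1)))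
    (fun n x hx => Prod.ext (proj_same _ hx.1) (proj_same _ hx.2))
    (fun n m x hx h => Prod.ext (proj_ne _ hx.1 h) (proj_ne _ hx.2 (by omega)))
    (fun x => by
      obtain ⟨x, y⟩ := x
      have h1 : ∀ x : X, (x, (0 : N)) ∈ ⨆ n, (X.deg n).prod (N.deg (n + 1)) := fun x => by
        induction x using induct X.deg with
        | hom n x hx => exact AddSubgroup.mem_iSup_of_mem n ⟨hx, zero_mem _⟩
        | add x y hx hy => simpa using add_mem hx hy
      have h2 : ∀ y : N, ((0 : X), y) ∈ ⨆ n, (X.deg n).prod (N.deg (n + 1)) := fun y => by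
        induction y using induct N.deg with
        | hom n y hy =>
          refine AddSubgroup.mem_iSup_of_mem (n - 1) ⟨zero_mem _, ?_⟩
          rwa [sub_add_cancel]
        | add x y hx hy => simpa using add_mem hx hy
      simpa using add_mem (h1 x) (h2 y))
  smul_mem i j x b hx hb := ⟨X.smul_mem i j x.1 b hx.1 hb, by
    have := N.smul_mem (i + 1) j x.2 b hx.2 hb
    rwa [show i + 1 + j = i + j + 1 by omega] at this⟩
  d := (X.d.comp (AddMonoidHom.fst X N)).prod
    (r.1.toAddMonoidHom.comp (AddMonoidHom.fst X N) - N.d.comp (AddMonoidHom.snd X N))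
  d_mem n x hx := ⟨X.d_mem n x.1 hx.1, by
    change r.1 x.1 - N.d x.2 ∈ N.deg (n - 1 + 1)
    have h1 := r.2.1 n x.1 hx.1
    have h2 := N.d_mem (n + 1) x.2 hx.2
    rw [add_sub_cancel_right] at h2
    rw [sub_add_cancel]
    exact sub_mem h1 h2⟩
  d_d x := Prod.ext (X.d_d x.1) (by
    change r.1 (X.d x.1) - N.d (r.1 x.1 - N.d x.2) = 0
    rw [r.2.2, map_sub, N.d_d, sub_zero, sub_self])
  leibniz n x b hx := Prod.ext (X.leibniz n x.1 b hx.1) (by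
    change r.1 (op b • x.1) - N.d (op b • x.2) =
      op b • (r.1 x.1 - N.d x.2) + n.negOnePow • (op (B.d b) • x.2)
    rw [N.leibniz (n + 1) x.2 b hx.2, map_smul, smul_sub, Int.negOnePow_succ, Units.neg_smul]
    abel)

/-- If `r ∘ s` is homotopic to the identity of `N`, then `N` is a direct summand of the source of
`r` up to quasi-isomorphism. -/
lemma isQuasiIso_of_retract {X : DGMod B} {Y : Fin 2 → DGMod B} {s : dgHom (Y 0) X}
    {r : dgHom X (Y 0)} {h : Y 0 →ₗ[Bᵐᵒᵖ] Y 0}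
    (hh : IsHomotopy (LinearMap.id - r.1 ∘ₗ s.1) h) (e : Y 1 = cocone r) :
    ∃ q : dgHom (directSum Y) X, IsQuasiIso q := by
  obtain ⟨v, vd, vdeg⟩ : ∃ v : (Y 1) ≃ₗ[Bᵐᵒᵖ] cocone r, (∀ x, v ((Y 1).d x) = (cocone r).d (v x)) ∧
      ∀ n x, x ∈ (Y 1).deg n ↔ v x ∈ (cocone r).deg n := by
    rw [e]
    exact ⟨LinearEquiv.refl _ _, fun _ => rfl, fun _ _ => Iff.rfl⟩
  let fst : cocone r →ₗ[Bᵐᵒᵖ] X := LinearMap.fst Bᵐᵒᵖ X (Y 0)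
  have hfst : fst ∈ dgHom (cocone r) X := ⟨fun _ _ hx => hx.1, fun _ => rfl⟩
  have hv : v.toLinearMap ∈ dgHom (Y 1) (cocone r) := ⟨fun n x hx => (vdeg n x).1 hx, vd⟩
  let q : dgHom (directSum Y) X := ⟨s.1 ∘ₗ sumProj Y 0 + fst ∘ₗ v.toLinearMap ∘ₗ sumProj Y 1,
    add_mem (comp_mem s.2 (mem_dgHom_iff.2 (isComm_sumProj Y 0)))
      (comp_mem hfst (comp_mem hv (mem_dgHom_iff.2 (isComm_sumProj Y 1))))⟩
  -- The element (z, (x, y)) of Y 0 ⊕ cocone r, which q sends to s z + x.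
  let mk : Y 0 → X → Y 0 → directSum Y := fun z x y =>
    sumIncl Y 0 z + sumIncl Y 1 (v.symm ((x, y) : X × Y 0))
  have mk0 : ∀ z x y, sumProj Y 0 (mk z x y) = z := fun z x y => by
    change sumProj Y 0 (sumIncl Y 0 z + sumIncl Y 1 _) = z
    rw [map_add, ← LinearMap.comp_apply, sumProj_comp_sumIncl_same, ← LinearMap.comp_apply,
      sumProj_comp_sumIncl_ne Y (by decide)]
    exact add_zero z
  have mk1 : ∀ z x y, v (sumProj Y 1 (mk z x y)) = ((x, y) : X × Y 0) := fun z x y => by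
    change v (sumProj Y 1 (sumIncl Y 0 z + sumIncl Y 1 _)) = _
    rw [map_add, ← LinearMap.comp_apply, sumProj_comp_sumIncl_ne Y (by decide),
      ← LinearMap.comp_apply, sumProj_comp_sumIncl_same, LinearMap.zero_apply, zero_add]
    exact v.apply_symm_apply _
  have ext : ∀ a b : directSum Y, sumProj Y 0 a = sumProj Y 0 b →
      v (sumProj Y 1 a) = v (sumProj Y 1 b) → a = b := fun a b h0 h1 =>
    directSum_ext Y fun i => by
      match i with
      | 0 => exact h0
      | 1 => exact v.injective h1
  have mem : ∀ n z x y, z ∈ (Y 0).deg n → x ∈ X.deg n → y ∈ (Y 0).deg (n + 1) →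
      mk z x y ∈ (directSum Y).deg n := fun n z x y hz hx hy i => by
    match i with
    | 0 => exact (mk0 z x y).symm ▸ hz
    | 1 =>
      refine (vdeg n _).2 ?_
      change v (sumProj Y 1 (mk z x y)) ∈ _
      rw [mk1]
      exact ⟨hx, hy⟩
  have dmk : ∀ z x y, (directSum Y).d (mk z x y) =
      mk ((Y 0).d z) (X.d x) (r.1 x - (Y 0).d y) := fun z x y => by
    refine ext _ _ ?_ ?_
    · rw [mk0]
      change (Y 0).d (sumProj Y 0 (mk z x y)) = _
      rw [mk0]
    · rw [mk1]
      change v ((Y 1).d (sumProj Y 1 (mk z x y))) = _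
      rw [vd, mk1]
      rfl
  have qmk : ∀ z x y, q.1 (mk z x y) = s.1 z + x := fun z x y => by
    change s.1 (sumProj Y 0 (mk z x y)) + fst (v (sumProj Y 1 (mk z x y))) = _
    rw [mk0, mk1]
    rfl
  have hd : ∀ z, r.1 (s.1 z) = z - (Y 0).d (h z) - h ((Y 0).d z) := fun z => by
    have := hh.2 z
    rw [LinearMap.sub_apply, LinearMap.id_apply, LinearMap.comp_apply] at this
    rw [sub_sub, ← this, sub_sub_cancel]
  refine ⟨q, fun n => ⟨?_, ?_⟩⟩
  · refine (injective_iff_map_eq_zero _).2 fun a ha => ?_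
    obtain ⟨⟨a, ha1, ha2⟩, rfl⟩ := QuotientAddGroup.mk_surjective a
    obtain ⟨w, hw, hdw⟩ := (QuotientAddGroup.eq_zero_iff _).1 ha
    refine (QuotientAddGroup.eq_zero_iff _).2 ?_
    obtain ⟨⟨x, y⟩, hxy⟩ : ∃ p : X × Y 0, v (sumProj Y 1 a) = p := ⟨_, rfl⟩
    have hxd : x ∈ X.deg n ∧ y ∈ (Y 0).deg (n + 1) := by
      have := (vdeg n _).1 (ha1 1)
      change v (sumProj Y 1 a) ∈ _ at this
      rw [hxy] at this
      exact this
    obtain ⟨z, hz⟩ : ∃ z, sumProj Y 0 a = z := ⟨_, rfl⟩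
    have hzd : z ∈ (Y 0).deg n := hz ▸ ha1 0
    have ea : a = mk z x y := ext _ _ (by rw [mk0, hz]) (by rw [mk1, hxy])
    have ha2 : (directSum Y).d a = 0 := ha2
    rw [ea, dmk] at ha2
    have hdz : (Y 0).d z = 0 := by
      have := congrArg (sumProj Y 0) ha2
      rwa [mk0, map_zero] at this
    have h1 := congrArg (fun t => v (sumProj Y 1 t)) ha2
    simp only [mk1, map_zero] at h1
    have hdy : r.1 x = (Y 0).d y := sub_eq_zero.1 (Prod.ext_iff.1 h1).2
    have hdw : X.d w = s.1 z + x := by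
      rw [← qmk z x y, ← ea]
      exact hdw
    -- Put z' = r w - y + h z. From d w = s z + x, r x = d y, d z = 0 and r s = id - d h - h d it
    -- follows that d z' = z, and (z', w - s z', h z') has boundary (z, x, y).
    have hz' : r.1 w - y + h z ∈ (Y 0).deg (n + 1) :=
      add_mem (sub_mem (r.2.1 _ _ hw) hxd.2) (hh.1 _ _ hzd)
    have hdz' : (Y 0).d (r.1 w - y + h z) = z := by
      rw [map_add, map_sub, ← r.2.2, hdw, map_add, hd, hdy, hdz, map_zero]
      abel
    refine ⟨mk (r.1 w - y + h z) (w - s.1 (r.1 w - y + h z)) (h (r.1 w - y + h z)),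
      mem _ _ _ _ hz' (sub_mem hw (s.2.1 _ _ hz')) (hh.1 _ _ hz'), ?_⟩
    refine (dmk _ _ _).trans ?_
    change _ = a
    rw [ea, hdz', map_sub X.d, ← s.2.2, hdz', hdw, map_sub r.1, hd, hdz']
    congr 1 <;> abel
  · intro a
    obtain ⟨⟨x, hx, hdx⟩, rfl⟩ := QuotientAddGroup.mk_surjective a
    have hdx : X.d x = 0 := hdx
    -- A cycle x is the image of (r x, x - s r x, h r x), which is a cycle because r (x - s r x) = d
    -- h r x.
    have hc : (directSum Y).d (mk (r.1 x) (x - s.1 (r.1 x)) (h (r.1 x))) = 0 := by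
      rw [dmk]
      refine ext _ _ ?_ ?_
      · rw [mk0, ← r.2.2, hdx, map_zero, map_zero]
      · rw [mk1, map_zero, map_zero]
        refine Prod.ext ?_ ?_
        · change X.d (x - s.1 (r.1 x)) = 0
          rw [map_sub, hdx, ← s.2.2, ← r.2.2, hdx, map_zero, map_zero, sub_zero]
        · change r.1 (x - s.1 (r.1 x)) - (Y 0).d (h (r.1 x)) = 0
          rw [map_sub, hd, ← r.2.2, hdx, map_zero, map_zero]
          abel
    refine ⟨QuotientAddGroup.mk ⟨mk (r.1 x) (x - s.1 (r.1 x)) (h (r.1 x)),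
      mem _ _ _ _ (r.2.1 _ _ hx) (sub_mem hx (s.2.1 _ _ (r.2.1 _ _ hx)))
        (hh.1 _ _ (r.2.1 _ _ hx)), hc⟩, ?_⟩
    refine congrArg QuotientAddGroup.mk (Subtype.ext ?_)
    refine (qmk _ _ _).trans ?_
    exact add_sub_cancel _ _

/-- The cocone of r serves as an explicit complement, so no abstract splitting of idempotents in
D(B) is needed. -/
lemma isSummandOfFree_of_retract {N : DGMod B} {n : ℕ}
    {s : dgHom N (directSum fun _ : Fin n => DGMod.self B)}
    {r : dgHom (directSum fun _ : Fin n => DGMod.self B) N} {h : N →ₗ[Bᵐᵒᵖ] N}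
    (hh : IsHomotopy (LinearMap.id - r.1 ∘ₗ s.1) h) : IsSummandOfFree N := by
  obtain ⟨q, hq⟩ := isQuasiIso_of_retract (Y := ![N, cocone r]) (s := s) (r := r) hh rfl
  let q' : directSum ![N, cocone r] ⟶ directSum fun _ : Fin n => DGMod.self B := q
  have : IsIso ((quasiIso B).Q.map q') := Localization.inverts (quasiIso B).Q (quasiIso B) q' hq
  exact ⟨n, cocone r, ⟨asIso ((quasiIso B).Q.map q')⟩⟩

/-- The vanishing condition of (AR1), for homogeneous maps. -/
lemma _root_.AR1.exists_htpy {φ : DGAlg.Hom A B} {N : DGMod B} (hN : AR1 φ N) {n : ℤ} (hn : 1 ≤ n)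
    {f : N →ₗ[Bᵐᵒᵖ] DGMod.self B} (hf : IsComm (-n) f 0) : ∃ h, IsComm (1 - n) h f := by
  have hf' : f ∈ dgHom N ((DGMod.self B).shift n) := by
    refine ⟨fun m x hx => ?_, fun x => ?_⟩
    · have := hf.1 m x hx
      rwa [← sub_eq_add_neg] at this
    · change f (N.d x) = n.negOnePow • (DGMod.self B).d (f x)
      rw [hf.2, LinearMap.zero_apply, zero_add, Int.negOnePow_neg, smul_smul, Int.units_mul_self,
        one_smul]
  have := hN.vanishing n hn
  obtain ⟨h, hh⟩ := (QuotientAddGroup.eq_zero_iff (⟨f, hf'⟩ : dgHom N ((DGMod.self B).shift n))).1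
    (Subsingleton.elim (α := HomK N ((DGMod.self B).shift n)) _ 0)
  -- A homotopy into Σ^n B is a map of degree 1 - n into B. The sign (-1)^n of the shifted
  -- differential is removed by rescaling.
  let h' : N →ₗ[Bᵐᵒᵖ] DGMod.self B := h
  have h1 : IsComm (1 - n) h' (n.negOnePow • f) := by
    refine ⟨fun m x hx => ?_, fun x => ?_⟩
    · have : h x ∈ (DGMod.self B).deg (m + 1 - n) := hh.1 m x hx
      rwa [add_sub_assoc] at this
    · have e : f x = n.negOnePow • (DGMod.self B).d (h' x) + h' (N.d x) := hh.2 x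
      rw [LinearMap.smul_apply, e, smul_add, smul_smul, Int.units_mul_self, one_smul,
        Int.negOnePow_sub, Int.negOnePow_one, neg_one_mul, Units.neg_smul]
      abel
  have h2 := h1.units_smul n.negOnePow
  rw [smul_smul, Int.units_mul_self, one_smul] at h2
  exact ⟨_, h2⟩

end DGMod

namespace SemifreeBasis

variable {N : DGMod B} (E : SemifreeBasis N)

/-- Every basis element lies in a finite set of basis elements spanning a DG submodule. -/
lemma exists_finset_closed (i : E.ι) : ∃ T : Finset E.ι, i ∈ T ∧
    ∀ j ∈ T, ∀ k, E.basis.repr (N.d (E.basis j)) k ≠ 0 → k ∈ T := by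
  classical
  induction i using WellFoundedLT.induction with
  | ind i ih =>
    choose T hT using ih
    -- The boundary of a basis element involves finitely many smaller ones; i together with the
    -- closed sets chosen for these is again closed.
    refine ⟨insert i ((E.basis.repr (N.d (E.basis i))).support.attach.biUnion fun j =>
      T j.1 (E.d_lt i j.1 (Finsupp.mem_support_iff.1 j.2))), Finset.mem_insert_self _ _,
      fun j hj k hk => ?_⟩
    refine Finset.mem_insert_of_mem (Finset.mem_biUnion.2 ?_)
    rcases Finset.mem_insert.1 hj with rfl | hj
    · exact ⟨⟨k, Finsupp.mem_support_iff.2 hk⟩, Finset.mem_attach _ _, (hT k (E.d_lt j k hk)).1⟩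
    · obtain ⟨l, hl, hj⟩ := Finset.mem_biUnion.1 hj
      exact ⟨l, hl, (hT _ _).2 j hj k hk⟩

/-- A map of finite rank has image in the span of a finite set of basis elements spanning a DG
submodule. -/
lemma exists_finset_of_finiteRank {f : N →ₗ[Bᵐᵒᵖ] N} (hf : FiniteRank f) :
    ∃ T : Finset E.ι, (∀ j ∈ T, ∀ k, E.basis.repr (N.d (E.basis j)) k ≠ 0 → k ∈ T) ∧
      ∀ j, j ∉ T → E.coord j ∘ₗ f = 0 := by
  classical
  obtain ⟨V, ⟨S, rfl⟩, hV⟩ := hf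
  choose T hT using E.exists_finset_closed
  refine ⟨S.biUnion fun x => (E.basis.repr x).support.biUnion T, fun j hj k hk => ?_,
    fun j hj => LinearMap.ext fun x => ?_⟩
  · obtain ⟨x, hx, hj⟩ := Finset.mem_biUnion.1 hj
    obtain ⟨i, hi, hj⟩ := Finset.mem_biUnion.1 hj
    exact Finset.mem_biUnion.2 ⟨x, hx, Finset.mem_biUnion.2 ⟨i, hi, (hT i).2 j hj k hk⟩⟩
  · have h : Submodule.span Bᵐᵒᵖ (S : Set N) ≤ LinearMap.ker (E.coord j) := by
      refine Submodule.span_le.2 fun y hy => ?_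
      refine (E.coord_eq_zero_iff j y).2 (not_not.1 fun h => hj ?_)
      exact Finset.mem_biUnion.2 ⟨y, hy, Finset.mem_biUnion.2
        ⟨j, Finsupp.mem_support_iff.2 h, (hT j).1⟩⟩
    exact h (hV x)

/-- A coordinate which does not occur in the differentials of the basis elements in `T` is a chain
map on the span of `T`. -/
lemma isComm_coord_comp {f : N →ₗ[Bᵐᵒᵖ] N} (hf : IsComm 0 f 0) {T : Finset E.ι}
    (hT : ∀ j, j ∉ T → E.coord j ∘ₗ f = 0) {i : E.ι}
    (hi : ∀ j ∈ T, E.basis.repr (N.d (E.basis j)) i = 0) :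
    IsComm (-E.degree i) (E.coord i ∘ₗ f) 0 := by
  obtain ⟨c, hc⟩ := exists_isComm (E.coord i) (E.coord_degree i)
  refine ((hc.comp_chain hf).congr_deg (zero_add _)).congr_comm (LinearMap.ext fun x => ?_)
  -- f x lies in the span of T, so it is enough that the differential of the i-th coordinate kills
  -- each e_j with j in T. Its value there combines d(0) or d(1) with the i-th coordinate of d e_j,
  -- and all of these are zero.
  rw [LinearMap.comp_apply, ← E.sum_support (f x), map_sum]
  refine Finset.sum_eq_zero fun j hj => ?_
  have hjT : j ∈ T := by
    by_contra h
    exact Finsupp.mem_support_iff.1 hj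
      ((E.coord_eq_zero_iff j _).1 (LinearMap.congr_fun (hT j h) x))
  have h1 : c (E.basis j) = 0 := by
    have h := hc.2 (E.basis j)
    rw [(E.coord_eq_zero_iff i _).2 (hi j hjT), smul_zero, add_zero] at h
    rw [← h]
    by_cases hij : i = j
    · subst hij
      rw [coord_basis_same]
      exact B.d_one
    · rw [coord_basis_ne E hij, map_zero]
  have h2 : ∀ b : B, c (E.incl j b) = 0 := fun b => by
    rw [incl_apply, map_smul, h1, smul_zero]
  exact h2 _

/-- Basis elements of positive degree can be removed from the support of an endomorphism homotopic
to the identity. -/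
lemma exists_htpy_support_nonpos {φ : DGAlg.Hom A B} (hN : AR1 φ N) (T : Finset E.ι)
    (hcl : ∀ j ∈ T, ∀ k, E.basis.repr (N.d (E.basis j)) k ≠ 0 → k ∈ T) {f h : N →ₗ[Bᵐᵒᵖ] N}
    (hh : IsComm 1 h (LinearMap.id - f)) (hT : ∀ j, j ∉ T → E.coord j ∘ₗ f = 0) :
    ∃ (T' : Finset E.ι) (f' h' : N →ₗ[Bᵐᵒᵖ] N), IsComm 1 h' (LinearMap.id - f') ∧
      (∀ j, j ∉ T' → E.coord j ∘ₗ f' = 0) ∧ ∀ j ∈ T', E.degree j ≤ 0 := by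
  classical
  induction hn : T.card using Nat.strong_induction_on generalizing T f h with
  | _ n ih =>
    by_cases hneg : ∀ j ∈ T, E.degree j ≤ 0
    · exact ⟨T, f, h, hh, hT, hneg⟩
    push Not at hneg
    obtain ⟨i, hi, hpos⟩ := hneg
    -- For e of maximal degree in T, its coefficient in d e_j with j in T would have negative degree
    -- in B. So e occurs in no such boundary: T without e is still closed, and the e-coordinate of f
    -- is a chain map.
    obtain ⟨e, he, hmax⟩ := T.exists_max_image E.degree ⟨i, hi⟩
    have hpos : 1 ≤ E.degree e := hpos.trans_le (hmax i hi)
    have hf : IsComm 0 f 0 := by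
      have := (IsComm.id N).sub (hh.comm_comm.congr_deg (sub_self 1))
      rwa [sub_sub_cancel, sub_zero] at this
    have hde : ∀ j ∈ T, E.basis.repr (N.d (E.basis j)) e = 0 := fun j hj => by
      rw [← E.coord_eq_zero_iff]
      have h1 : E.coord e (N.d (E.basis j)) ∈ B.deg (E.degree j - 1 - E.degree e) :=
        E.coord_mem e (N.d_mem _ _ (E.mem_deg j))
      rw [B.deg_neg _ (by have := hmax j hj; omega)] at h1
      exact h1
    -- This coordinate represents a class in Hom_K(N, Σ^|e| B), which vanishes because |e| ≥ 1.
    obtain ⟨k, hk⟩ := hN.exists_htpy hpos (E.isComm_coord_comp hf hT hde)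
    have hk' := (((E.isComm_incl e).comp hk).congr_deg (sub_add_cancel 1 _)).units_smul
      (E.degree e).negOnePow
    rw [smul_add, smul_smul, Int.units_mul_self, one_smul] at hk'
    -- Subtracting the boundary of ± e k removes the e-coordinate from f, at the price of a term ±
    -- d(e) k supported on T without e.
    have hc : IsComm 1 _ (LinearMap.id - (f - ((E.degree e).negOnePow • (E.dIncl e ∘ₗ k) +
        E.incl e ∘ₗ E.coord e ∘ₗ f))) := (hh.add hk').congr_comm (by abel)
    refine ih (T.erase e).card (hn ▸ Finset.card_erase_lt_of_mem he) (T.erase e)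
      (fun j hj l hl => ?_) hc (fun j hj => ?_) rfl
    · rw [Finset.mem_erase] at hj ⊢
      exact ⟨fun hle => hl (hle ▸ hde j hj.2), hcl j hj.2 l hl⟩
    · have hd : E.coord j ∘ₗ E.dIncl e = 0 := by
        refine self_hom_ext fun b => ?_
        change E.coord j (op b • N.d (E.basis e)) = 0
        have h0 : E.basis.repr (N.d (E.basis e)) j = 0 := by
          by_contra h0
          by_cases hje : j = e
          · exact h0 (hje ▸ hde e he)
          · exact hj (Finset.mem_erase.2 ⟨hje, hcl e he j h0⟩)
        rw [coord_smul, (E.coord_eq_zero_iff j _).2 h0, smul_zero]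
      have h2 : E.coord j ∘ₗ ((E.degree e).negOnePow • (E.dIncl e ∘ₗ k)) = 0 := by
        have h3 : E.coord j ∘ₗ (E.dIncl e ∘ₗ k) = 0 := by
          rw [← LinearMap.comp_assoc, hd, LinearMap.zero_comp]
        rcases Int.units_eq_one_or (E.degree e).negOnePow with h | h
        · rw [h, one_smul, h3]
        · rw [h, Units.neg_smul, one_smul, LinearMap.comp_neg, h3, neg_zero]
      rw [LinearMap.comp_sub, LinearMap.comp_add, h2, zero_add, ← LinearMap.comp_assoc]
      by_cases hje : j = e
      · subst hje
        rw [coord_comp_incl_same, LinearMap.id_comp, sub_self]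
      · rw [coord_comp_incl_ne E hje, LinearMap.zero_comp, sub_zero]
        exact hT j fun h => hj (Finset.mem_erase.2 ⟨hje, h⟩)

/-- A homotopically finite module satisfying (AR1) is a summand of a finite free module. -/
lemma isSummandOfFree (E : SemifreeBasis N) {φ : DGAlg.Hom A B} (hN : AR1 φ N) (hf : HFinite N) : IsSummandOfFree N := by
  classical
  obtain ⟨h₀, g, hg, hgf⟩ := hf
  obtain ⟨T₀, hcl, hT₀⟩ := E.exists_finset_of_finiteRank hgf
  obtain ⟨T, f, h, hh, hT, hdeg⟩ := E.exists_htpy_support_nonpos hN T₀ hcl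
    (hg.congr_comm (sub_sub_cancel _ _).symm) hT₀
  have hneg : ∀ n < 0, ∀ x ∈ N.deg n, x = 0 := fun n hn x hx => by
    rw [hN.nonneg n hn] at hx
    exact hx
  -- Degrees in T are at most 0 and N vanishes in negative degrees, so the remaining basis elements
  -- are cycles.
  have hd : ∀ j ∈ T, N.d (E.basis j) = 0 := fun j hj =>
    hneg _ (by have := hdeg j hj; omega) _ (N.d_mem _ _ (E.mem_deg j))
  set S := T.filter fun j => E.degree j = 0 with hS
  have hST : ∀ j, j ∉ S → E.coord j ∘ₗ f = 0 := fun j hj => by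
    by_cases hjT : j ∈ T
    · have hlt : E.degree j < 0 :=
        lt_of_le_of_ne (hdeg j hjT) fun h => hj (Finset.mem_filter.2 ⟨hjT, h⟩)
      -- A basis element of negative degree is zero, which forces B = 0 and makes its coordinate
      -- vanish.
      have h1 : (1 : B) = 0 := by
        have := E.coord_basis_same j
        rw [hneg _ hlt _ (E.mem_deg j), map_zero] at this
        exact this.symm
      refine LinearMap.ext fun x => ?_
      refine (one_smul Bᵐᵒᵖ (E.coord j (f x))).symm.trans ?_
      rw [← MulOpposite.op_one, h1, MulOpposite.op_zero, zero_smul]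
      rfl
    · exact hT j hjT
  have hf : IsComm 0 f 0 := by
    have := (IsComm.id N).sub (hh.comm_comm.congr_deg (sub_self 1))
    rwa [sub_sub_cancel, sub_zero] at this
  let X : Fin S.card → DGMod B := fun _ => DGMod.self B
  let e : Fin S.card → E.ι := fun i => (S.equivFin.symm i).1
  have heS : ∀ i, e i ∈ T ∧ E.degree (e i) = 0 := fun i =>
    Finset.mem_filter.1 (S.equivFin.symm i).2
  -- s reads off the S-coordinates of f, and r sends the standard generators to the basis elements
  -- in S. Both are chain maps because basis elements in T are cycles, and r s = f since f is
  -- supported on S.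
  have hs : IsComm 0 (∑ i, sumIncl X i ∘ₗ E.coord (e i) ∘ₗ f) 0 := by
    have := IsComm.sum (k := 0) Finset.univ (f := fun i => sumIncl X i ∘ₗ E.coord (e i) ∘ₗ f)
      (g := fun _ => 0) fun i => by
        have h1 : IsComm 0 (E.coord (e i) ∘ₗ f) 0 :=
          (E.isComm_coord_comp hf hT (i := e i) fun j hj => by
            rw [hd j hj, map_zero]; rfl).congr_deg (by rw [(heS i).2, neg_zero])
        exact ((isComm_sumIncl X i).comp_chain h1).congr_comm (LinearMap.zero_comp _)
    rwa [Finset.sum_const_zero] at this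
  have hr : IsComm 0 (∑ i, E.incl (e i) ∘ₗ sumProj X i) 0 := by
    have := IsComm.sum (k := 0) Finset.univ (f := fun i => E.incl (e i) ∘ₗ sumProj X i)
      (g := fun _ => 0) fun i => by
        have h1 : IsComm 0 (E.incl (e i)) 0 :=
          ((E.isComm_incl (e i)).congr_deg (heS i).2).congr_comm (self_hom_ext fun b => by
            rw [dIncl_apply, hd _ (heS i).1, smul_zero]; rfl)
        exact (h1.comp_chain (isComm_sumProj X i)).congr_comm (LinearMap.zero_comp _)
    rwa [Finset.sum_const_zero] at this
  have hrs : (∑ i, E.incl (e i) ∘ₗ sumProj X i) ∘ₗ (∑ i, sumIncl X i ∘ₗ E.coord (e i) ∘ₗ f) =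
      f := by
    have h1 : ∀ i, (E.incl (e i) ∘ₗ sumProj X i) ∘ₗ (∑ j, sumIncl X j ∘ₗ E.coord (e j) ∘ₗ f) =
        E.incl (e i) ∘ₗ E.coord (e i) ∘ₗ f := fun i => by
      rw [comp_sum, Finset.sum_eq_single i]
      · rw [LinearMap.comp_assoc, ← LinearMap.comp_assoc _ _ (sumProj X i),
          sumProj_comp_sumIncl_same, LinearMap.id_comp]
      · intro j _ hj
        rw [LinearMap.comp_assoc, ← LinearMap.comp_assoc _ _ (sumProj X i),
          sumProj_comp_sumIncl_ne X hj.symm, LinearMap.zero_comp, LinearMap.comp_zero]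
      · exact fun h => absurd (Finset.mem_univ i) h
    rw [sum_comp]
    simp only [h1]
    refine LinearMap.ext fun x => ?_
    rw [LinearMap.sum_apply]
    have h2 : ∑ i, E.incl (e i) (E.coord (e i) (f x)) = ∑ j ∈ S, E.incl j (E.coord j (f x)) := by
      rw [← Finset.sum_coe_sort S]
      exact Fintype.sum_equiv S.equivFin.symm _ _ fun i => rfl
    refine h2.trans ?_
    conv_rhs => rw [← E.sum_support (f x)]
    symm
    refine Finset.sum_subset_zero_on_sdiff ?_ ?_ fun _ _ => rfl
    · intro j hj
      by_contra h
      exact Finsupp.mem_support_iff.1 hj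
        ((E.coord_eq_zero_iff j _).1 (LinearMap.congr_fun (hST j h) x))
    · intro j hj
      have h := Finsupp.notMem_support_iff.1 (Finset.mem_sdiff.1 hj).2
      rw [(E.coord_eq_zero_iff j _).2 h, map_zero]
  refine isSummandOfFree_of_retract (s := ⟨_, mem_dgHom_iff.2 hs⟩) (r := ⟨_, mem_dgHom_iff.2 hr⟩)
    (h := h) ?_
  rw [isHomotopy_iff]
  exact hh.congr_comm (congrArg (LinearMap.id - ·) hrs.symm)

end SemifreeBasis

end FreeRetract

/-! ### Maps out of summands of free modules, and the degrees of N ⊗_B T^i. -/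

section LocalizedHom

open DGMod

variable {A B : DGAlg.{u} R}

/-- Naturality for functors on a localization: if every element of `F Y` is the image of some
element of `G Y` under one of the transformations `T s : G ⟶ F`, then the same holds for `F.map u m`
whenever the source of `u` becomes isomorphic to `Y` in the localization. -/
lemma exists_app_eq_of_localization_iso {C : Type*} [Category C] (W : MorphismProperty C)
    {F G : C ⥤ Type u} (hF : W.IsInvertedBy F) (hG : W.IsInvertedBy G) {S : Type*}
    (T : S → (G ⟶ F)) {M X Y : C} (hT : ∀ ξ : F.obj Y, ∃ s g, (T s).app Y g = ξ)
    (α : W.Q.obj M ≅ W.Q.obj Y) (f : M ⟶ X) (m : F.obj M) :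
    ∃ s x, F.map f m = (T s).app X x := by
  let F' := Localization.lift F hF W.Q
  let G' := Localization.lift G hG W.Q
  let i : W.Q ⋙ F' ≅ F := Localization.Lifting.iso W.Q W F F'
  let j : W.Q ⋙ G' ≅ G := Localization.Lifting.iso W.Q W G G'
  -- Move m along α to F Y, write it there as the image of g under T s, and carry g to G X along α⁻¹
  -- and f. Naturality of T s, extended to the localization, identifies the result.
  obtain ⟨s, g, hg⟩ := hT (i.hom.app Y (F'.map α.hom (i.inv.app M m)))
  let τ : G' ⟶ F' := Localization.liftNatTrans W.Q W G F G' F' (T s)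
  have hτ : ∀ Z, τ.app (W.Q.obj Z) = j.hom.app Z ≫ (T s).app Z ≫ i.inv.app Z := fun Z =>
    Localization.liftNatTrans_app W.Q W G F G' F' (T s) Z
  refine ⟨s, j.hom.app X (G'.map (α.inv ≫ W.Q.map f) (j.inv.app Y g)), ?_⟩
  have h1 : F.map f = i.inv.app M ≫ F'.map α.hom ≫ F'.map (α.inv ≫ W.Q.map f) ≫ i.hom.app X := by
    rw [← F'.map_comp_assoc, Iso.hom_inv_id_assoc]
    have := i.hom.naturality f
    rw [← cancel_epi (i.hom.app M)]
    rw [← this, ← Category.assoc (i.hom.app M), ← NatTrans.comp_app, i.hom_inv_id]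
    simp
  have h2 : j.inv.app Y ≫ G'.map (α.inv ≫ W.Q.map f) ≫ j.hom.app X ≫ (T s).app X =
      (T s).app Y ≫ i.inv.app Y ≫ F'.map (α.inv ≫ W.Q.map f) ≫ i.hom.app X := by
    have h := τ.naturality (α.inv ≫ W.Q.map f)
    rw [hτ, hτ] at h
    have h3 := congrArg (fun t => j.inv.app Y ≫ t ≫ i.hom.app X) h
    simpa using h3
  have h3 := ConcreteCategory.congr_hom h2 g
  have h4 := ConcreteCategory.congr_hom h1 m
  simp only [ConcreteCategory.comp_apply] at h3 h4
  rw [h3, h4, hg]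
  simp

namespace DGMod

variable {P P' X Y Z : DGMod B}

/-- Postcomposition with a homomorphism of DG modules, on homotopy classes. -/
def HomK.map (P : DGMod B) (g : dgHom X Y) : HomK P X →+ HomK P Y :=
  QuotientAddGroup.map _ _ (AddMonoidHom.mk' (fun f => ⟨g.1 ∘ₗ f.1, comp_mem g.2 f.2⟩)
    fun _ _ => Subtype.ext (LinearMap.comp_add _ _ _)) fun _ ⟨_, hh⟩ => ⟨_, hh.comp_left g.2⟩

/-- Precomposition with a homomorphism of DG modules, on homotopy classes. -/
def HomK.precomp (g : dgHom P P') (X : DGMod B) : HomK P' X →+ HomK P X :=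
  QuotientAddGroup.map _ _ (AddMonoidHom.mk' (fun f => ⟨f.1 ∘ₗ g.1, comp_mem f.2 g.2⟩)
    fun _ _ => Subtype.ext (LinearMap.add_comp _ _ _)) fun _ ⟨_, hh⟩ => ⟨_, hh.comp_right g.2⟩

/-- The functor `Hom_{K(B)}(P, -)` on the category of DG modules. -/
def homKFunctor (P : DGMod B) : DGMod B ⥤ Type u where
  obj X := HomK P X
  map g := TypeCat.ofHom (HomK.map P g)
  map_id X := by
    ext x
    obtain ⟨x, rfl⟩ := QuotientAddGroup.mk_surjective x
    rfl
  map_comp f g := by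
    ext x
    obtain ⟨x, rfl⟩ := QuotientAddGroup.mk_surjective x
    rfl

/-- Precomposition as a natural transformation. -/
def homKPrecomp (g : dgHom P P') : homKFunctor P' ⟶ homKFunctor P where
  app X := TypeCat.ofHom (HomK.precomp g X)
  naturality X Y f := by
    ext x
    obtain ⟨x, rfl⟩ := QuotientAddGroup.mk_surjective x
    rfl

/-- Maps out of a semifree module up to homotopy invert quasi-isomorphisms. -/
lemma _root_.SemifreeBasis.isInvertedBy_homKFunctor (E : SemifreeBasis P) :
    (quasiIso B).IsInvertedBy (homKFunctor P) := by
  intro X Y g hg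
  refine (isIso_iff_bijective _).2 ⟨?_, fun y => ?_⟩
  · refine (injective_iff_map_eq_zero (HomK.map P g)).2 fun x hx => ?_
    obtain ⟨f, rfl⟩ := QuotientAddGroup.mk_surjective x
    obtain ⟨h, hh⟩ := (QuotientAddGroup.eq_zero_iff _).1 hx
    exact (QuotientAddGroup.eq_zero_iff _).2 (E.exists_htpy_of_comp hg f.2 hh)
  · obtain ⟨f, rfl⟩ := QuotientAddGroup.mk_surjective y
    obtain ⟨a, ha, h, hh⟩ := E.exists_htpy_lift hg f.2
    refine ⟨(QuotientAddGroup.mk ⟨a, ha⟩ : HomK P X), QuotientAddGroup.eq.2 ⟨h, ?_⟩⟩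
    refine (congrArg (IsHomotopy · h) ?_).mp hh
    change f.1 - g.1 ∘ₗ a = -(g.1 ∘ₗ a) + f.1
    abel

/-- The semifree basis of a finite free module. -/
def freeBasis (B : DGAlg.{u} R) (n : ℕ) :
    SemifreeBasis (directSum fun _ : Fin n => DGMod.self B) :=
  let X : Fin n → DGMod B := fun _ => DGMod.self B
  let e : directSum X ≃ₗ[Bᵐᵒᵖ] (ULift.{u} (Fin n) → Bᵐᵒᵖ) :=
    { toFun := fun x i => op (sumProj X i.down x : B)
      invFun := fun y => ∑ i, sumIncl X i ((y ⟨i⟩).unop : B)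
      map_add' := fun _ _ => rfl
      map_smul' := fun _ _ => rfl
      left_inv := fun x => directSum_ext X fun i => by
        refine (map_sum _ _ _).trans ?_
        refine (Finset.sum_eq_single i (fun j _ hj => ?_) fun h =>
          absurd (Finset.mem_univ i) h).trans ?_
        · exact LinearMap.congr_fun (sumProj_comp_sumIncl_ne X hj.symm) _
        · exact LinearMap.congr_fun (sumProj_comp_sumIncl_same X i) _
      right_inv := fun y => funext fun i => congrArg op (by
        refine (map_sum _ _ _).trans ?_
        refine (Finset.sum_eq_single i.down (fun j _ hj => ?_) fun h =>
          absurd (Finset.mem_univ _) h).trans ?_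
        · exact LinearMap.congr_fun (sumProj_comp_sumIncl_ne X hj.symm) _
        · exact LinearMap.congr_fun (sumProj_comp_sumIncl_same X i.down) _) }
  let b := Module.Basis.ofEquivFun e
  have hb : ∀ i, b i = sumIncl X i.down (selfOne B) := fun i => e.injective <| by
    rw [Module.Basis.coe_ofEquivFun, LinearEquiv.apply_symm_apply]
    refine funext fun j => ?_
    by_cases h : j = i
    · subst h
      rw [Pi.single_eq_same]
      exact congrArg op (LinearMap.congr_fun (sumProj_comp_sumIncl_same X j.down) _).symm
    · rw [Pi.single_eq_of_ne h]
      exact congrArg op (LinearMap.congr_fun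
        (sumProj_comp_sumIncl_ne X fun h' => h (ULift.ext _ _ h')) _).symm
  have hd : ∀ i, (directSum fun _ : Fin n => DGMod.self B).d (b i) = 0 := fun i => by
    rw [hb, (isComm_sumIncl _ _).2, d_selfOne, map_zero, smul_zero, add_zero]
    rfl
  { ι := ULift.{u} (Fin n)
    wf := Finite.to_wellFoundedLT
    basis := b
    degree := fun _ => 0
    mem_deg := fun i => by
      rw [hb]
      have := (isComm_sumIncl (fun _ : Fin n => DGMod.self B) i.down).1 0 _ selfOne_mem
      rwa [add_zero] at this
    d_lt := fun i j h => absurd (by rw [hd, map_zero]; rfl) h }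

lemma freeBasis_degree (n : ℕ) (i : (freeBasis B n).ι) : (freeBasis B n).degree i = 0 := rfl

/-- There are no nonzero maps from a direct summand of a finite free module in the derived category
to a module without elements of degree zero. -/
lemma _root_.IsSummandOfFree.subsingleton_homK {N : DGMod B} (E : SemifreeBasis N)
    (hN : IsSummandOfFree N) {X : DGMod B} (hX : X.deg 0 = ⊥) : Subsingleton (HomK N X) := by
  obtain ⟨n, N', ⟨α⟩⟩ := hN
  refine subsingleton_of_forall_eq 0 fun a => ?_
  obtain ⟨a, rfl⟩ := QuotientAddGroup.mk_surjective a
  let p : dgHom (directSum ![N, N']) N := ⟨sumProj ![N, N'] 0, mem_dgHom_iff.2 (isComm_sumProj _ _)⟩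
  let i : dgHom N (directSum ![N, N']) := ⟨sumIncl ![N, N'] 0, mem_dgHom_iff.2 (isComm_sumIncl _ _)⟩
  have hpi : p.1 ∘ₗ i.1 = LinearMap.id := sumProj_comp_sumIncl_same ![N, N'] 0
  let f : directSum ![N, N'] ⟶ X := (⟨a.1 ∘ₗ p.1, comp_mem a.2 p.2⟩ : dgHom _ X)
  -- Here F = Hom_K(N, -), G = Hom_K(B^n, -), and T s is precomposition with s : N → B^n; every
  -- class in F(B^n) is a precomposition of the identity. Applied to a ∘ p and the inclusion of N,
  -- this factors a, up to homotopy, as N → B^n → X.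
  obtain ⟨s, x, hx⟩ := exists_app_eq_of_localization_iso (quasiIso B)
    E.isInvertedBy_homKFunctor (freeBasis B n).isInvertedBy_homKFunctor
    (fun s => homKPrecomp s) (fun ξ => by
      obtain ⟨s, rfl⟩ := QuotientAddGroup.mk_surjective ξ
      exact ⟨s, (QuotientAddGroup.mk ⟨LinearMap.id, id_mem _⟩ : HomK _ _), rfl⟩) α f
    (QuotientAddGroup.mk i : HomK N _)
  have e : HomK.map N f (QuotientAddGroup.mk i : HomK N _) = QuotientAddGroup.mk a := by
    refine congrArg QuotientAddGroup.mk (Subtype.ext ?_)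
    change (a.1 ∘ₗ p.1) ∘ₗ i.1 = a.1
    rw [LinearMap.comp_assoc, hpi, LinearMap.comp_id]
  refine e.symm.trans (hx.trans ?_)
  obtain ⟨g, rfl⟩ := QuotientAddGroup.mk_surjective x
  -- The free generators have degree 0, where X vanishes.
  have hg : g = 0 := Subtype.ext ((freeBasis B n).hom_ext fun j => by
    have := g.2.1 _ _ ((freeBasis B n).mem_deg j)
    rw [freeBasis_degree, hX] at this
    exact this)
  rw [hg]
  exact map_zero (HomK.precomp s X)

/-! ### Degrees of the tensor powers -/

variable {φ : DGAlg.Hom A B}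

/-- If |x| + |y| ≤ 0 and x ≠ 0, then |x| ≥ 0 and |y| ≤ 0, so y comes from A and x ⊗ y = x y ⊗ 1.
Hence π_B is injective in degrees at most 0. -/
lemma diagonal_eq_zero (hφ : StandingAssumptions φ) {n : ℤ} (hn : n ≤ 0) {z : diagonal φ}
    (hz : z ∈ (diagonal φ).deg n) : z = 0 := by
  have key : ∀ w ∈ tensorDeg (restrict φ (DGMod.self B)) (DGBimod.ofHom φ) n,
      (w : envBimod φ) = emul φ ((mulMap φ).1 (w : envBimod φ)) 1 := fun w hw => by
    induction hw using AddSubgroup.closure_induction with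
    | mem w hw =>
      obtain ⟨i, j, (x : B), (y : B), hx, hy, hij, rfl⟩ := hw
      have hx : x ∈ B.deg i := hx
      have hy : y ∈ B.deg j := hy
      change emul φ x y = emul φ (x * y : B) 1
      by_cases hi : i < 0
      · have hx0 : x = 0 := by
          rw [B.deg_neg i hi] at hx
          exact hx
        rw [hx0, zero_mul, zero_emul, zero_emul]
      · obtain ⟨a, rfl⟩ := hφ.pos j (by omega) y hy
        have h := smul_tmul (M := restrict φ (DGMod.self B)) (L := DGBimod.ofHom φ) x a (1 : B)
        have h2 : emul φ x (φ.toAlgHom a) = emul φ x (φ.toAlgHom a * 1) := by rw [mul_one]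
        exact h2.trans h.symm
    | zero =>
      refine Eq.trans ?_ (congrArg (emul φ · 1) (map_zero (mulMap φ).1)).symm
      exact (zero_emul φ 1).symm
    | add x y _ _ hx hy =>
      refine Eq.trans (congrArg₂ (· + ·) hx hy) ((add_emul φ _ _ 1).symm.trans ?_)
      exact (congrArg (emul φ · 1) (map_add (mulMap φ).1 (x : envBimod φ) y)).symm
    | neg x _ hx =>
      refine Eq.trans (congrArg (- ·) hx) ((neg_bmul φ (N := DGMod.self B) _ 1).symm.trans ?_)
      exact (congrArg (emul φ · 1) (map_neg (mulMap φ).1 (x : envBimod φ))).symm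
  refine Subtype.ext ((key z.1 hz).trans ?_)
  refine (congrArg (emul φ · 1) z.2).trans ?_
  exact zero_emul φ 1

lemma suspDiagonal_eq_zero (hφ : StandingAssumptions φ) {n : ℤ} (hn : n < 2)
    {c : suspDiagonal φ} (hc : c ∈ (suspDiagonal φ).deg n) : c = 0 := by
  rw [← DGBimod.suspMk_suspVal _ c,
    diagonal_eq_zero hφ (by omega) ((diagonal φ).suspVal_mem hc), map_zero]

/-- ΣJ starts in degree 2 because J starts in degree 1. In particular nothing is left in degree 0,
which is all that the vanishing of maps requires. -/
lemma tensor_deg_eq_bot (hφ : StandingAssumptions φ) {M : DGMod B} (hM : ∀ n < 0, M.deg n = ⊥)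
    {n : ℤ} (hn : n < 2) : (M.tensor (suspDiagonal φ)).deg n = ⊥ := by
  refine (AddSubgroup.eq_bot_iff_forall _).2 fun x hx => ?_
  change x ∈ tensorDeg M (suspDiagonal φ) n at hx
  induction hx using AddSubgroup.closure_induction with
  | mem x hx =>
    obtain ⟨i, j, m, c, hm, hc, hij, rfl⟩ := hx
    by_cases hi : i < 0
    · rw [hM i hi] at hm
      rw [show m = 0 from hm]
      exact zero_tmul c
    · rw [suspDiagonal_eq_zero hφ (by omega) hc]
      exact tmul_zero m
  | zero => rfl
  | add x y _ _ hx hy => exact (congrArg₂ (· + ·) hx hy).trans (add_zero _)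
  | neg x _ hx => exact (congrArg (- ·) hx).trans neg_zero

lemma tensorPow_deg_eq_bot (hφ : StandingAssumptions φ) {N : DGMod B}
    (hN : ∀ n < 0, N.deg n = ⊥) (i : ℕ) : ∀ n < 0, (tensorPow φ N i).deg n = ⊥ := by
  induction i with
  | zero => exact hN
  | succ i ih => exact fun n hn => tensor_deg_eq_bot hφ ih (by omega)

/-- Vanishing of maps into the tensor powers for summands of finite free modules. -/
lemma _root_.IsSummandOfFree.subsingleton_homK_tensorPow (hφ : StandingAssumptions φ) {N : DGMod B}
    (hN : AR1 φ N) (h : IsSummandOfFree N) {i : ℕ} (hi : 1 ≤ i) :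
    Subsingleton (HomK N (tensorPow φ N i)) := by
  obtain ⟨E⟩ := hN.semifree
  obtain ⟨i, rfl⟩ := Nat.exists_eq_add_of_le' hi
  exact h.subsingleton_homK E (tensor_deg_eq_bot hφ (tensorPow_deg_eq_bot hφ hN.nonneg i) two_pos)

end DGMod

end LocalizedHom

/-! ### Γ and the groups Hom_K(N, N ⊗_B T^i). -/

section GradedEndomorphisms

open DGMod

variable {A B : DGAlg.{u} R} (φ : DGAlg.Hom A B) (N : DGMod B)

namespace DGMod

/-- The inclusion `N = N ⊗_B T^0 → N ⊗_B T`. -/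
def tensorTZero : N →ₗ[Bᵐᵒᵖ] (tensorT φ N).toDGMod := tensorTOf φ N 0

/-- The projection `N ⊗_B T → N ⊗_B T^k`. -/
def tensorTComp (k : ℕ) : (tensorT φ N).toDGMod →ₗ[Bᵐᵒᵖ] tensorPow φ N k :=
  sumProj (tensorPow φ N) k

lemma tensorTZero_mem : tensorTZero φ N ∈ dgHom N (tensorT φ N).toDGMod := tensorTOf_mem φ N 0

lemma tensorTComp_mem (k : ℕ) :
    tensorTComp φ N k ∈ dgHom (tensorT φ N).toDGMod (tensorPow φ N k) :=
  mem_dgHom_iff.2 (isComm_sumProj (tensorPow φ N) k)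

lemma tensorTComp_of (k : ℕ) (x : tensorPow φ N k) :
    tensorTComp φ N k (tensorTOf φ N k x) = x :=
  LinearMap.congr_fun (sumProj_comp_sumIncl_same (tensorPow φ N) k) x

lemma tensorTComp_eq_zero {n : ℤ} {x : (tensorT φ N).toDGMod} (hx : x ∈ (tensorT φ N).tdeg n)
    {k : ℕ} (hk : (k : ℤ) ≠ n) : tensorTComp φ N k x = 0 := hx k hk

lemma tensorT_ext {x y : (tensorT φ N).toDGMod}
    (h : ∀ k, tensorTComp φ N k x = tensorTComp φ N k y) : x = y :=
  directSum_ext (tensorPow φ N) h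

/-- The component `N → N ⊗_B T^k` of an endomorphism of `N ⊗_B T`. -/
def endComp (k : ℕ) : Module.End Bᵐᵒᵖ (tensorT φ N).toDGMod →+ (N →ₗ[Bᵐᵒᵖ] tensorPow φ N k) :=
  AddMonoidHom.mk' (fun F => tensorTComp φ N k ∘ₗ F ∘ₗ tensorTZero φ N) fun F G => by
    rw [LinearMap.add_comp, LinearMap.comp_add]

lemma endComp_apply (k : ℕ) (F : Module.End Bᵐᵒᵖ (tensorT φ N).toDGMod) (x : N) :
    endComp φ N k F x = tensorTComp φ N k (F (tensorTZero φ N x)) := rfl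

variable {φ N}

lemma endComp_mem {F : Module.End Bᵐᵒᵖ (tensorT φ N).toDGMod}
    (hF : F ∈ dgHom (tensorT φ N).toDGMod (tensorT φ N).toDGMod) (k : ℕ) :
    endComp φ N k F ∈ dgHom N (tensorPow φ N k) :=
  comp_mem (tensorTComp_mem φ N k) (comp_mem hF (tensorTZero_mem φ N))

lemma endComp_htpy {F H : Module.End Bᵐᵒᵖ (tensorT φ N).toDGMod} (h : IsHomotopy F H) (k : ℕ) :
    IsHomotopy (endComp φ N k F) (endComp φ N k H) :=
  (h.comp_right (tensorTZero_mem φ N)).comp_left (tensorTComp_mem φ N k)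

/-- Only the underlying homotopy is kept; its tensor grading is not needed, because single
components are extracted afterwards by `endComp`. -/
lemma exists_htpy_of_mem_iSup {F : Module.End Bᵐᵒᵖ (tensorT φ N).toDGMod}
    (hF : F ∈ ⨆ n, TGMod.endNull (tensorT φ N) n) : ∃ H, IsHomotopy F H := by
  induction hF using AddSubgroup.iSup_induction' with
  | hp n f hf => exact ⟨_, hf.2.choose_spec.1⟩
  | h1 => exact ⟨0, .zero⟩
  | hadd x y _ _ hx hy => exact ⟨_, hx.choose_spec.add hy.choose_spec⟩

/-! ### Extension of maps `N → N ⊗_B T^a` to `N ⊗_B T` -/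

/-- The map `N ⊗_B T^j → N ⊗_B T^{a + j}` induced by a map `N → N ⊗_B T^a`. -/
def powShift {a : ℕ} (f : N →ₗ[Bᵐᵒᵖ] tensorPow φ N a) :
    ∀ j, tensorPow φ N j →ₗ[Bᵐᵒᵖ] tensorPow φ N (a + j)
  | 0 => f
  | j + 1 => tensorMap (powShift f j) (suspDiagonal φ)

lemma IsComm.powShift {a : ℕ} {f g : N →ₗ[Bᵐᵒᵖ] tensorPow φ N a} {k : ℤ} (h : IsComm k f g)
    (j : ℕ) : IsComm k (powShift f j) (powShift g j) := by
  induction j with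
  | zero => exact h
  | succ j ih => exact ih.tensorMap _

lemma powShift_zero {a : ℕ} (j : ℕ) : powShift (0 : N →ₗ[Bᵐᵒᵖ] tensorPow φ N a) j = 0 := by
  induction j with
  | zero => rfl
  | succ j ih => exact (congrArg (tensorMap · _) ih).trans (tensorMap_zero _)

/-- The `T`-linear extension of a map `N → N ⊗_B T^a`. -/
def extT {a : ℕ} (f : N →ₗ[Bᵐᵒᵖ] tensorPow φ N a) : Module.End Bᵐᵒᵖ (tensorT φ N).toDGMod :=
  DirectSum.toModule (M := fun i => (tensorPow φ N i).carrier) Bᵐᵒᵖ ℕ (tensorT φ N).toDGMod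
    fun j => (tensorTOf φ N (a + j)) ∘ₗ powShift f j

lemma extT_of {a : ℕ} (f : N →ₗ[Bᵐᵒᵖ] tensorPow φ N a) (j : ℕ) (x : tensorPow φ N j) :
    extT f (tensorTOf φ N j x) = tensorTOf φ N (a + j) (powShift f j x) :=
  DirectSum.toModule_lof (M := fun i => (tensorPow φ N i).carrier) Bᵐᵒᵖ j x

lemma act_of (i : ℕ) (x : tensorPow φ N i) (c : suspDiagonal φ) :
    (tensorT φ N).act.1 (tmul (M := (tensorT φ N).toDGMod) (tensorTOf φ N i x) c) =
      tensorTOf φ N (i + 1) (tmul x c : (tensorPow φ N i).tensor _) :=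
  tensorTActAux_of φ N i x c

lemma extT_tensorTZero {a : ℕ} (f : N →ₗ[Bᵐᵒᵖ] tensorPow φ N a) (x : N) :
    extT f (tensorTZero φ N x) = tensorTOf φ N a (f x) := extT_of f 0 x

lemma endT_tensorTZero (f : Module.End Bᵐᵒᵖ N) (x : N) :
    endT φ f (tensorTZero φ N x) = tensorTZero φ N (f x) := endT_of φ f 0 x

lemma tensorTZero_tdeg (x : N) : tensorTZero φ N x ∈ (tensorT φ N).tdeg 0 :=
  tensorTOf_tdeg φ N 0 x

lemma isTLinear_extT {a : ℕ} (f : N →ₗ[Bᵐᵒᵖ] tensorPow φ N a) :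
    TGMod.IsTLinear (M := tensorT φ N) (N := tensorT φ N) a (extT f) := by
  refine ⟨fun x c => ?_, fun n x hx => ?_⟩
  · induction x using tensorT_induct with
    | of i x =>
      refine (congrArg (extT f) (act_of i x c)).trans ((extT_of f (i + 1) _).trans ?_)
      exact ((congrArg (fun t => (tensorT φ N).act.1 (tmul t c)) (extT_of f i x)).trans
        (act_of (a + i) _ c)).symm
    | add x y hx hy =>
      have e := add_tmul (M := (tensorT φ N).toDGMod) x y c
      refine (congrArg (fun t => extT f ((tensorT φ N).act.1 t)) e).trans ?_
      simp only [map_add]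
      rw [hx, hy, ← map_add, ← add_tmul]
      exact congrArg (fun t => (tensorT φ N).act.1 (tmul t c)) (map_add (extT f) x y).symm
  · refine tensorTDeg_induct φ N (p := fun x => extT f x ∈ tensorTDeg φ N (n + a)) ?_
      (fun i x hi => ?_) (fun x y hx hy => ?_) hx
    · exact (map_zero (extT f)).symm ▸ zero_mem _
    · rw [extT_of, ← hi, add_comm, ← Nat.cast_add]
      exact tensorTOf_tdeg φ N (a + i) _
    · exact (map_add (extT f) x y).symm ▸ add_mem hx hy

lemma isComm_extT {a : ℕ} {f g : N →ₗ[Bᵐᵒᵖ] tensorPow φ N a} {k : ℤ} (h : IsComm k f g) :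
    IsComm (M := (tensorT φ N).toDGMod) (N := (tensorT φ N).toDGMod) k (extT f) (extT g) := by
  have hd : ∀ i x, (tensorT φ N).d (tensorTOf φ N i x) = tensorTOf φ N i ((tensorPow φ N i).d x) :=
    fun i x => ((tensorTOf_mem φ N i).2 x).symm
  refine ⟨fun n x hx => ?_, fun x => ?_⟩
  · refine directSum_deg_induct (p := fun x => extT f x ∈ (tensorT φ N).deg (n + k)) ?_
      (fun i y hy => ?_) (fun x y hx hy => ?_) hx
    · exact (map_zero (extT f)).symm ▸ zero_mem _
    · change extT f (tensorTOf φ N i y) ∈ (directSum (tensorPow φ N)).deg (n + k)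
      rw [extT_of]
      exact (tensorTOf_mem φ N (a + i)).1 _ _ ((h.powShift i).1 _ _ hy)
    · exact (map_add (extT f) x y).symm ▸ add_mem hx hy
  · induction x using tensorT_induct with
    | of i x =>
      have h1 := congrArg (tensorTOf φ N (a + i)) ((h.powShift i).2 x)
      rw [hd, extT_of, extT_of, extT_of, hd, h1, map_add]
      refine congrArg _ ?_
      change _ = k.negOnePow • tensorTOf φ N (a + i) (powShift f i ((tensorPow φ N i).d x))
      rcases Int.units_eq_one_or k.negOnePow with hk | hk
      · rw [hk, one_smul, one_smul]
      · rw [hk, Units.neg_smul, one_smul, map_neg, Units.neg_smul, one_smul]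
    | add x y hx hy =>
      refine (congrArg (tensorT φ N).d (map_add (extT f) x y)).trans ?_
      refine (map_add (tensorT φ N).d _ _).trans ((congrArg₂ (· + ·) hx hy).trans ?_)
      refine Eq.symm ((congrArg₂ (fun s t => s + k.negOnePow • t) (map_add (extT g) x y)
        ((congrArg (extT f) (map_add (tensorT φ N).d x y)).trans (map_add (extT f) _ _))).trans ?_)
      rw [smul_add]
      exact add_add_add_comm _ _ _ _

lemma extT_zero {a : ℕ} : extT (0 : N →ₗ[Bᵐᵒᵖ] tensorPow φ N a) = 0 :=
  tensorT_hom_ext φ fun i x => by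
    rw [extT_of, powShift_zero]
    exact map_zero (tensorTOf φ N (a + i))

lemma extT_mem {a : ℕ} {f : N →ₗ[Bᵐᵒᵖ] tensorPow φ N a} (hf : f ∈ dgHom N (tensorPow φ N a)) :
    extT f ∈ TGMod.endDeg (tensorT φ N) a :=
  ⟨mem_dgHom_iff.2 ((isComm_extT (mem_dgHom_iff.1 hf)).congr_comm extT_zero), isTLinear_extT f⟩

lemma extT_null {a : ℕ} {f h : N →ₗ[Bᵐᵒᵖ] tensorPow φ N a} (hf : f ∈ dgHom N (tensorPow φ N a))
    (hh : IsHomotopy f h) : extT f ∈ TGMod.endNull (tensorT φ N) a :=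
  ⟨extT_mem hf, extT h, isHomotopy_iff.2 (isComm_extT (isHomotopy_iff.1 hh)), isTLinear_extT h⟩

lemma endComp_extT {a : ℕ} (f : N →ₗ[Bᵐᵒᵖ] tensorPow φ N a) : endComp φ N a (extT f) = f :=
  LinearMap.ext fun x => by
    rw [endComp_apply, extT_tensorTZero]
    exact tensorTComp_of φ N a (f x)

/-- `T`-linear maps which agree on `N` are equal. -/
lemma isTLinear_ext {F G : Module.End Bᵐᵒᵖ (tensorT φ N).toDGMod} {n m : ℤ}
    (hF : TGMod.IsTLinear (M := tensorT φ N) (N := tensorT φ N) n F)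
    (hG : TGMod.IsTLinear (M := tensorT φ N) (N := tensorT φ N) m G)
    (h : ∀ x : N, F (tensorTZero φ N x) = G (tensorTZero φ N x)) : F = G := by
  refine tensorT_hom_ext φ fun i => ?_
  induction i with
  | zero => exact h
  | succ i ih =>
    intro x
    induction x using induct_tmul with
    | tmul x c =>
      have h1 := hF.1 (tensorTOf φ N i x) c
      have h2 := hG.1 (tensorTOf φ N i x) c
      rw [act_of] at h1 h2
      rw [h1, h2, ih]
    | add x y hx hy =>
      have e : tensorTOf φ N (i + 1) (x + y) = tensorTOf φ N (i + 1) x + tensorTOf φ N (i + 1) y :=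
        map_add (tensorTOf φ N (i + 1)) x y
      refine (congrArg F e).trans ((map_add F _ _).trans ((congrArg₂ (· + ·) hx hy).trans ?_))
      exact ((congrArg G e).trans (map_add G _ _)).symm

/-- N generates N ⊗_B T under the action of ΣJ, so an endomorphism of tensor degree a is determined
by its restriction to N, which lands in N ⊗_B T^a. -/
lemma eq_extT_of_mem {F : Module.End Bᵐᵒᵖ (tensorT φ N).toDGMod} {a : ℕ}
    (hF : F ∈ TGMod.endDeg (tensorT φ N) a) : F = extT (endComp φ N a F) := by
  refine isTLinear_ext hF.2 (isTLinear_extT _) fun x => tensorT_ext φ N fun k => ?_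
  rw [extT_tensorTZero]
  have h1 := hF.2.2 0 _ (tensorTZero_tdeg x)
  have h2 := tensorTOf_tdeg φ N a (endComp φ N a F x)
  by_cases hk : k = a
  · subst hk
    exact (tensorTComp_of φ N k _).symm
  · exact (tensorTComp_eq_zero φ N h1 (by omega)).trans
      (tensorTComp_eq_zero φ N h2 (by omega)).symm

/-- The image of the generators N lies in negative tensor degree, where N ⊗_B T is zero. -/
lemma eq_zero_of_mem_neg {F : Module.End Bᵐᵒᵖ (tensorT φ N).toDGMod} {n : ℤ} (hn : n < 0)
    (hF : F ∈ TGMod.endDeg (tensorT φ N) n) : F = 0 := by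
  refine isTLinear_ext hF.2 (TGMod.IsTLinear.zero (n := n)) fun x => tensorT_ext φ N fun k => ?_
  refine (tensorTComp_eq_zero φ N (hF.2.2 0 _ (tensorTZero_tdeg x)) (by omega)).trans ?_
  exact (map_zero (tensorTComp φ N k)).symm

/-! ### The graded ring `Γ` -/

open TGMod

/-- The class in `Γ` of a tensor graded endomorphism. -/
def gamMk (F : endRing (tensorT φ N)) : Gam (tensorT φ N) := (TGMod.htpyCon (tensorT φ N)).mk' F

lemma gamMk_surjective (x : Gam (tensorT φ N)) : ∃ F, gamMk F = x :=
  RingCon.mk'_surjective _ x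

lemma gamMk_eq_zero {F : endRing (tensorT φ N)} :
    gamMk F = 0 ↔ F.1 ∈ ⨆ n, endNull (tensorT φ N) n := by
  have h : gamMk F = 0 ↔ gamMk F = gamMk 0 := by
    rw [show gamMk (0 : endRing (tensorT φ N)) = 0 from map_zero _]
  refine h.trans ((RingCon.eq _).trans ?_)
  change F.1 - 0 ∈ _ ↔ _
  rw [sub_zero]

lemma toGam_eq {n : ℤ} (F : endDeg (tensorT φ N) n) :
    toGam (tensorT φ N) n F = gamMk ⟨F.1, AddSubgroup.mem_iSup_of_mem n F.2⟩ := rfl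

lemma exists_htpy_of_gamMk_eq_zero {F : endRing (tensorT φ N)} (h : gamMk F = 0) (k : ℕ) :
    ∃ H, IsHomotopy (endComp φ N k F.1) H := by
  obtain ⟨H, hH⟩ := exists_htpy_of_mem_iSup (gamMk_eq_zero.1 h)
  exact ⟨_, endComp_htpy hH k⟩

lemma homK_mk_eq_zero {P Q : DGMod B} (h : Subsingleton (HomK P Q)) {f : P →ₗ[Bᵐᵒᵖ] Q}
    (hf : f ∈ dgHom P Q) : ∃ H, IsHomotopy f H :=
  (QuotientAddGroup.eq_zero_iff (⟨f, hf⟩ : dgHom P Q)).1 (Subsingleton.elim (α := HomK P Q) _ _)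

lemma subsingleton_homK_iff {P Q : DGMod B} :
    Subsingleton (HomK P Q) ↔ ∀ f ∈ dgHom P Q, ∃ H, IsHomotopy f H := by
  refine ⟨fun h f hf => homK_mk_eq_zero h hf, fun h => subsingleton_of_forall_eq 0 fun x => ?_⟩
  obtain ⟨f, rfl⟩ := QuotientAddGroup.mk_surjective x
  exact (QuotientAddGroup.eq_zero_iff f).2 (h f.1 f.2)

lemma mem_endNull_of_subsingleton {a : ℕ} (h : Subsingleton (HomK N (tensorPow φ N a)))
    {F : Module.End Bᵐᵒᵖ (tensorT φ N).toDGMod} (hF : F ∈ endDeg (tensorT φ N) a) :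
    F ∈ endNull (tensorT φ N) a := by
  have hf := endComp_mem hF.1 a
  obtain ⟨H, hH⟩ := homK_mk_eq_zero h hf
  rw [eq_extT_of_mem hF]
  exact extT_null hf hH

/-- Restriction to N and T-linear extension are mutually inverse in tensor degree a, and both
preserve null-homotopies. -/
lemma gamDeg_eq_bot_iff (a : ℕ) : gamDeg (tensorT φ N) a = ⊥ ↔
    Subsingleton (HomK N (tensorPow φ N a)) := by
  constructor
  · intro h
    refine subsingleton_homK_iff.2 fun f hf => ?_
    have h1 : toGam (tensorT φ N) a ⟨extT f, extT_mem hf⟩ ∈ gamDeg (tensorT φ N) a := ⟨_, rfl⟩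
    rw [h, AddSubgroup.mem_bot, toGam_eq] at h1
    obtain ⟨H, hH⟩ := exists_htpy_of_gamMk_eq_zero h1 a
    exact ⟨H, by rwa [endComp_extT] at hH⟩
  · intro h
    refine (AddSubgroup.eq_bot_iff_forall _).2 fun x hx => ?_
    obtain ⟨F, rfl⟩ := hx
    rw [toGam_eq, gamMk_eq_zero]
    exact AddSubgroup.mem_iSup_of_mem _ (mem_endNull_of_subsingleton h F.2)

variable (E : SemifreeBasis N)

lemma omega_eq : omega φ E =
    gamMk ⟨omegaMap φ E, AddSubgroup.mem_iSup_of_mem 1 (omegaMap_mem φ E)⟩ := rfl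

/-- On the generators N, the powers of ω are the iterates through which the identity of N is
factored. -/
lemma omegaMap_pow_of (n : ℕ) (x : N) : (omegaMap φ E ^ n) (tensorTZero φ N x) =
    tensorTOf φ N n (omegaIter φ E n x) := by
  induction n with
  | zero => rfl
  | succ n ih =>
    rw [pow_succ', Module.End.mul_apply, ih, omegaMap_of]
    rfl

/-- If `ω^n = 0`, then the `n`-th iterate of `omegaZero` is null-homotopic. -/
lemma exists_htpy_of_omega_pow {n : ℕ} (h : omega φ E ^ n = 0) :
    ∃ H, IsHomotopy (omegaIter φ E n) H := by
  rw [omega_eq] at h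
  have h' := ((map_pow (TGMod.htpyCon (tensorT φ N)).mk' _ n).trans h :)
  obtain ⟨H, hH⟩ := exists_htpy_of_gamMk_eq_zero h' n
  refine ⟨H, (congrArg (IsHomotopy · H) (LinearMap.ext fun x => ?_)).mp hH⟩
  refine (congrArg (tensorTComp φ N n) (omegaMap_pow_of E n x)).trans ?_
  exact tensorTComp_of φ N n _

lemma endToGam_mk (f : dgEnd N) : endToGam φ N ((DGMod.htpyCon N).mk' f) =
    gamMk ⟨endT φ f.1, AddSubgroup.mem_iSup_of_mem 0 (endT_mem φ f.2)⟩ := rfl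

lemma endComp_endT (f : Module.End Bᵐᵒᵖ N) : endComp φ N 0 (endT φ f) = f :=
  LinearMap.ext fun x => by
    rw [endComp_apply, endT_tensorTZero]
    exact tensorTComp_of φ N 0 (f x)

-- The degree 0 component of f ⊗ id_T is f, so a null-homotopy of f ⊗ id_T yields one of f.
variable (φ N) in
lemma endToGam_injective : Function.Injective (endToGam φ N) := by
  refine (injective_iff_map_eq_zero _).2 fun x hx => ?_
  obtain ⟨f, rfl⟩ := RingCon.mk'_surjective _ x
  rw [endToGam_mk] at hx
  obtain ⟨H, hH⟩ : ∃ H : Module.End Bᵐᵒᵖ N, IsHomotopy f.1 H := by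
    obtain ⟨H, hH⟩ := exists_htpy_of_gamMk_eq_zero hx 0
    rw [endComp_endT] at hH
    exact ⟨H, hH⟩
  refine Eq.trans ((RingCon.eq _).2 ⟨H, ?_⟩) (map_zero (DGMod.htpyCon N).mk')
  change IsHomotopy (f.1 - 0) H
  rwa [sub_zero]

/-- Components of negative tensor degree are zero, those of positive degree are null-homotopic by
hypothesis, and one of degree 0 equals f ⊗ id_T with f its restriction to N. -/
lemma endToGam_surjective (h : ∀ i : ℕ, 1 ≤ i → Subsingleton (HomK N (tensorPow φ N i))) :
    Function.Surjective (endToGam φ N) := by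
  have key : ∀ F (hF : F ∈ ⨆ n, endDeg (tensorT φ N) n),
      gamMk (⟨F, hF⟩ : endRing (tensorT φ N)) ∈ (endToGam φ N).range := fun F hF => by
    induction hF using AddSubgroup.iSup_induction' with
    | hp n F hF =>
      rcases lt_trichotomy n 0 with hn | hn | hn
      · have h0 := eq_zero_of_mem_neg hn hF
        subst h0
        exact zero_mem _
      · subst hn
        have hf : endComp φ N 0 F ∈ dgHom N N := endComp_mem hF.1 0
        refine ⟨(DGMod.htpyCon N).mk' ⟨endComp φ N 0 F, hf⟩, ?_⟩
        rw [endToGam_mk]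
        refine congrArg gamMk (Subtype.ext ?_)
        refine (isTLinear_ext (endT_tlinear φ _) hF.2 fun x => ?_)
        have h1 := LinearMap.congr_fun (eq_extT_of_mem (a := 0) hF) (tensorTZero φ N x)
        rw [extT_tensorTZero] at h1
        exact (endT_tensorTZero _ x).trans h1.symm
      · obtain ⟨a, rfl⟩ := Int.eq_ofNat_of_zero_le hn.le
        have := mem_endNull_of_subsingleton (h a (by omega)) hF
        rw [gamMk_eq_zero.2 (AddSubgroup.mem_iSup_of_mem _ this)]
        exact zero_mem _
    | h1 => exact zero_mem _
    | hadd x y hx' hy' hx hy => exact add_mem hx hy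
  intro x
  obtain ⟨F, rfl⟩ := gamMk_surjective x
  exact key F.1 F.2

/-- Surjectivity makes Γ a cyclic right module, generated by 1. -/
lemma gamFinite_of_surjective (h : Function.Surjective (endToGam φ N)) : GamFinite φ N := by
  let := gamRightModule φ N
  change Module.Finite (DGMod.EndK N)ᵐᵒᵖ (TGMod.Gam (tensorT φ N))
  refine ⟨⟨{1}, ?_⟩⟩
  refine eq_top_iff.2 fun x _ => ?_
  obtain ⟨e, rfl⟩ := h x
  have h1 : op e • (1 : Gam (tensorT φ N)) = endToGam φ N e := one_mul (endToGam φ N e)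
  rw [← h1]
  exact Submodule.smul_mem _ _ (Submodule.subset_span (by simp))

/-- An element of `⊕_n endDeg n` has only finitely many nonzero components. -/
lemma exists_forall_endComp_eq_zero {F : Module.End Bᵐᵒᵖ (tensorT φ N).toDGMod}
    (hF : F ∈ ⨆ n, endDeg (tensorT φ N) n) : ∃ k₀ : ℕ, ∀ k ≥ k₀, endComp φ N k F = 0 := by
  induction hF using AddSubgroup.iSup_induction' with
  | hp n F hF =>
    refine ⟨n.toNat + 1, fun k hk => LinearMap.ext fun x => ?_⟩
    exact tensorTComp_eq_zero φ N (hF.2.2 0 _ (tensorTZero_tdeg x)) (by omega)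
  | h1 => exact ⟨0, fun k _ => map_zero _⟩
  | hadd x y _ _ hx hy =>
    obtain ⟨a, ha⟩ := hx
    obtain ⟨b, hb⟩ := hy
    refine ⟨max a b, fun k hk => ?_⟩
    rw [map_add, ha k (le_trans (le_max_left _ _) hk), hb k (le_trans (le_max_right _ _) hk),
      add_zero]

/-- If `Γ` is finitely generated, then there are no maps `N → N ⊗_B T^k` up to homotopy for some
`k ≥ 1`. -/
lemma exists_subsingleton_of_gamFinite (h : GamFinite φ N) :
    ∃ k : ℕ, 1 ≤ k ∧ Subsingleton (HomK N (tensorPow φ N k)) := by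
  let := gamRightModule φ N
  obtain ⟨S, hS⟩ := (show Module.Finite (DGMod.EndK N)ᵐᵒᵖ (TGMod.Gam (tensorT φ N)) from h).1
  choose F hF using gamMk_surjective (φ := φ) (N := N)
  choose K hK using fun x => exists_forall_endComp_eq_zero (F x).2
  -- Beyond every tensor degree occurring in the chosen representatives of the generators; the
  -- summand 1 ensures k ≥ 1.
  let k := S.sup K + 1
  have hz : ∀ x : Gam (tensorT φ N), ∃ G, gamMk G = x ∧ endComp φ N k G.1 = 0 := fun x => by
    have hx : x ∈ Submodule.span (DGMod.EndK N)ᵐᵒᵖ (S : Set (Gam (tensorT φ N))) := by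
      rw [hS]
      exact Submodule.mem_top
    induction hx using Submodule.span_induction with
    | mem x hx => exact ⟨F x, hF x, hK x k ((Finset.le_sup hx).trans (Nat.le_succ _))⟩
    | zero => exact ⟨0, map_zero (TGMod.htpyCon (tensorT φ N)).mk', map_zero _⟩
    | add x y _ _ hx hy =>
      obtain ⟨G, rfl, hG⟩ := hx
      obtain ⟨G', rfl, hG'⟩ := hy
      refine ⟨G + G', map_add (TGMod.htpyCon (tensorT φ N)).mk' G G', ?_⟩
      exact (map_add (endComp φ N k) G.1 G'.1).trans (by rw [hG, hG', add_zero])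
    -- Scalars act by precomposition with f ⊗ id_T, which maps N into N, so the k-th component stays
    -- zero.
    | smul e x _ hx =>
      obtain ⟨G, rfl, hG⟩ := hx
      obtain ⟨e, rfl⟩ := MulOpposite.op_surjective e
      obtain ⟨f, rfl⟩ := RingCon.mk'_surjective _ e
      refine ⟨G * ⟨endT φ f.1, AddSubgroup.mem_iSup_of_mem 0 (endT_mem φ f.2)⟩,
        map_mul (TGMod.htpyCon (tensorT φ N)).mk' G _, LinearMap.ext fun x => ?_⟩
      change tensorTComp φ N k (G.1 (endT φ f.1 (tensorTZero φ N x))) = 0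
      rw [endT_tensorTZero]
      exact LinearMap.congr_fun hG (f.1 x)
  refine ⟨k, Nat.le_add_left 1 _, subsingleton_homK_iff.2 fun f hf => ?_⟩
  -- The extension of f has the same class as some G with zero k-th component; comparing k-th
  -- components shows that f is null-homotopic.
  obtain ⟨G, hG, h0⟩ := hz (gamMk ⟨extT f, AddSubgroup.mem_iSup_of_mem _ (extT_mem hf)⟩)
  have h1 : gamMk (⟨extT f, AddSubgroup.mem_iSup_of_mem _ (extT_mem hf)⟩ - G) = 0 :=
    (map_sub (TGMod.htpyCon (tensorT φ N)).mk' _ G).trans (sub_eq_zero.2 hG.symm)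
  obtain ⟨H, hH⟩ := exists_htpy_of_gamMk_eq_zero h1 k
  refine ⟨H, (congrArg (IsHomotopy · H) ?_).mp hH⟩
  refine (map_sub (endComp φ N k) (extT f) G.1).trans ?_
  rw [h0, endComp_extT, sub_zero]

end DGMod

end GradedEndomorphisms

/-! ### The implications between vanishing, homotopical finiteness and ω_N. -/

section Criterion

open DGMod

variable {A B : DGAlg.{u} R} {φ : DGAlg.Hom A B} {N : DGMod B}

namespace DGMod

lemma _root_.AR1.subsingleton_of_hFinite (hφ : StandingAssumptions φ) (hN : AR1 φ N) (h : HFinite N)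
    {i : ℕ} (hi : 1 ≤ i) : Subsingleton (HomK N (tensorPow φ N i)) := by
  obtain ⟨E⟩ := hN.semifree
  exact (E.isSummandOfFree hN h).subsingleton_homK_tensorPow hφ hN hi

/-- The iterate of ω_N is itself a chain map N → N ⊗_B T^i, so it is null-homotopic when there are
no nonzero classes. -/
lemma _root_.AR1.hFinite_of_subsingleton (hφ : StandingAssumptions φ) (hN : AR1 φ N)
    (E : SemifreeBasis N) {i : ℕ} (h : Subsingleton (HomK N (tensorPow φ N i))) : HFinite N := by
  obtain ⟨_, hH⟩ := homK_mk_eq_zero h (omegaIter_mem φ E i)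
  exact hFinite_of_omegaIter_htpy φ E (hN.hFinite_pow_baseChange φ hφ) hH

lemma _root_.AR1.hFinite_of_omega_pow (hφ : StandingAssumptions φ) (hN : AR1 φ N)
    (E : SemifreeBasis N) {n : ℕ} (h : omega φ E ^ n = 0) : HFinite N := by
  obtain ⟨_, hH⟩ := exists_htpy_of_omega_pow E h
  exact hFinite_of_omegaIter_htpy φ E (hN.hFinite_pow_baseChange φ hφ) hH

lemma naivelyLiftable_of_omega_eq_zero (E : SemifreeBasis N) (h : omega φ E = 0) :
    NaivelyLiftable φ N := by
  obtain ⟨_, hH⟩ := exists_htpy_of_omega_pow E ((pow_one _).trans h)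
  exact naivelyLiftable_of_htpy φ E hH

lemma omega_eq_zero_of_gamDeg_eq_bot (E : SemifreeBasis N)
    (h : TGMod.gamDeg (tensorT φ N) (1 : ℕ) = ⊥) : omega φ E = 0 := by
  have h1 : omega φ E ∈ TGMod.gamDeg (tensorT φ N) (1 : ℕ) := ⟨⟨omegaMap φ E, omegaMap_mem φ E⟩, rfl⟩
  rwa [h] at h1

end DGMod

end Criterion

end

theorem theorem6p3 {R : Type v} [CommRing R] {A B : DGAlg.{u} R} (φ : DGAlg.Hom A B)
    (hφ : StandingAssumptions φ) (N : DGMod B) (hN : AR1 φ N) (E : SemifreeBasis N) :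
    List.TFAE [
      NaivelyLiftable φ N,
      omega φ E = 0,
      ∃ n : ℕ, 1 ≤ n ∧ omega φ E ^ n = 0,
      Function.Bijective (endToGam φ N),
      GamFinite φ N,
      ∀ i : ℕ, 1 ≤ i → TGMod.gamDeg (tensorT φ N) i = ⊥,
      ∀ i : ℕ, 1 ≤ i → Subsingleton (DGMod.HomK N (tensorPow φ N i)),
      ∃ i : ℕ, 1 ≤ i ∧ TGMod.gamDeg (tensorT φ N) i = ⊥,
      ∃ i : ℕ, 1 ≤ i ∧ Subsingleton (DGMod.HomK N (tensorPow φ N i)),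
      Subsingleton (DGMod.HomK N (N.tensor (suspDiagonal φ))),
      IsSummandOfFree N] := by
  -- Conditions 6 and 7 of the theorem each appear in two forms below. The strongest vanishing,
  -- entry 7, is the hub, and homotopical finiteness is the way to reach it.
  have hfin : DGMod.HFinite N → ∀ i : ℕ, 1 ≤ i → Subsingleton (DGMod.HomK N (tensorPow φ N i)) :=
    fun h i hi => hN.subsingleton_of_hFinite hφ h hi
  tfae_have 2 → 1 := DGMod.naivelyLiftable_of_omega_eq_zero E
  tfae_have 2 → 3 := fun h => ⟨1, le_rfl, (pow_one _).trans h⟩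
  -- Index 0, because (N|_A ⊗_A B) ⊗_B T^0 is N|_A ⊗_A B itself.
  tfae_have 1 → 7 := fun h =>
    hfin (DGMod.hFinite_of_naivelyLiftable φ (hN.hFinite_pow_baseChange φ hφ 0) h)
  tfae_have 3 → 7 := fun ⟨_, _, h⟩ => hfin (hN.hFinite_of_omega_pow hφ E h)
  tfae_have 7 → 6 := fun h i hi => (DGMod.gamDeg_eq_bot_iff i).2 (h i hi)
  tfae_have 6 → 2 := fun h => DGMod.omega_eq_zero_of_gamDeg_eq_bot E (h 1 le_rfl)
  tfae_have 6 → 8 := fun h => ⟨1, le_rfl, h 1 le_rfl⟩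
  tfae_have 8 → 9 := fun ⟨i, hi, h⟩ => ⟨i, hi, (DGMod.gamDeg_eq_bot_iff i).1 h⟩
  tfae_have 9 → 11 := fun ⟨_, _, h⟩ => E.isSummandOfFree hN (hN.hFinite_of_subsingleton hφ E h)
  tfae_have 11 → 7 := fun h i hi => h.subsingleton_homK_tensorPow hφ hN hi
  tfae_have 7 → 10 := fun h => h 1 le_rfl
  tfae_have 10 → 9 := fun h => ⟨1, le_rfl, h⟩
  tfae_have 7 → 4 := fun h => ⟨DGMod.endToGam_injective φ N, DGMod.endToGam_surjective h⟩
  tfae_have 4 → 5 := fun h => DGMod.gamFinite_of_surjective h.2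
  -- Finite generation gives vanishing only at one uncontrolled index. This suffices, as entry 9
  -- leads back to 7 through the summand condition 11.
  tfae_have 5 → 9 := DGMod.exists_subsingleton_of_gamFinite
  tfae_finish
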